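/- Let $G$ be a graded Lie group: a connected, simply connected Lie group whose Lie algebra has a vector space decomposition $\mathfrak g=\bigoplus_{\ell\ge 1}\mathfrak g_\ell$ with $[\mathfrak g_\ell,\mathfrak g_{\ell'}]\subset\mathfrak g_{\ell+\ell'}$. Identify $G$ with the vector space $\mathfrak g$ through the exponential map, write $D_r x=r\cdot x$ for the dilations ($D_r=r^\ell$ on $\mathfrak g_\ell$, $r>0$), $Q=\sum_\ell \ell\dim\mathfrak g_\ell$, and let $\mathcal S(G)$ be the Schwartz space of $\mathfrak g$. Fix a Haar measure $dx$ on $G$. Let $\Gamma$ be a discrete co-compact subgroup of $G$, $M=\Gamma\backslash G$ with points $\dot x=\Gamma x$, and let $d\dot x$ be the measure on $M$ with $\int_G F(x)\,dx=\int_M\sum_{\gamma\in\Gamma}F(\gamma x)\,d\dot x$ for all measurable $F\ge 0$. Let $\mathcal A_0$ be the class of fields of operators $\sigma(\dot x,\pi)\in\mathcal L(\mathcal H_\pi)$, $\dot x\in M$, $\pi$ a (strongly continuous) unitary irreducible representation of $G$ on a separable Hilbert space $\mathcal H_\pi$, of the form $\sigma(\dot x,\pi)=\int_G\kappa_{\dot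 x}(z)\pi(z)^*\,dz$, where $\dot x\mapsto\kappa_{\dot x}$ is a smooth map from $M$ to $\mathcal S(G)$, called the associated kernel of $\sigma$. For $\varepsilon\in(0,1]$ the symbol $\sigma^{(\varepsilon)}(\dot x,\pi)=\sigma(\dot x,\varepsilon\cdot\pi)$, with $(\varepsilon\cdot\pi)(z)=\pi(\varepsilon\cdot z)$, has associated kernel $\kappa^{(\varepsilon)}_{\dot x}(z)=\varepsilon^{-Q}\kappa_{\dot x}(\varepsilon^{-1}\cdot z)$, and $\mathrm{Op}^{\varepsilon}(\sigma)$ is the operator on $L^2(M)$ given by $$\mathrm{Op}^{\varepsilon}(\sigma)f(\dot x)=\int_G f(\dot y)\,\kappa^{(\varepsilon)}_{\dot x}(y^{-1}x)\,dy .$$ Let $\sigma\in\mathcal A_0$ with associated kernel $\kappa_{\dot x}(z)$. Then for every $\varepsilon\in(0,1]$ the operator $\mathrm{Op}^{\varepsilon}(\sigma)$ is (well defined, bounded,) Hilbert–Schmidt and trace class on $L^2(M)$, and for every $N\in\mathbb N$ there is a constant $C>0$ (depending on $N,\sigma,G,\Gamma$ but not on $\varepsilon$) such that for all $\varepsilon\in(0,1]$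 $$\Big|\,\|\mathrm{Op}^{\varepsilon}(\sigma)\|_{HS}^2-\varepsilon^{-Q}\iint_{G\times M}|\kappa_{\dot x}(z)|^2\,dz\,d\dot x\Big|\le C\varepsilon^N,\qquad \Big|\mathrm{Tr}\big(\mathrm{Op}^{\varepsilon}(\sigma)\big)-\varepsilon^{-Q}\int_M\kappa_{\dot x}(0)\,d\dot x\Big|\le C\varepsilon^N .$$ -/

import Mathlib

open MeasureTheory Filter Topology
open scoped Manifold ContDiff SchwartzMap ENNReal InnerProductSpace

universe u

noncomputable section

/-! ### Graded Lie groups in exponential coordinates -/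

section Group

/-- The group law of `G` is written in exponential coordinates: the manifold `G` is the vector space
`T₁G` itself and each line `t ↦ t • x` is a one-parameter subgroup, so that the exponential map is
the identity. A connected simply connected nilpotent Lie group is always put in this form by
identifying it with its Lie algebra through the exponential map. -/
def IsExponentialCoordinates (G : Type u) [NormedAddCommGroup G] [NormedSpace ℝ G] [Group G] :
    Prop :=
  ∀ (s t : ℝ) (x : G), (s • x) * (t • x) = (s + t) • x

/-- The Lie bracket of the Lie group `G` (Mathlib's bracket on the tangent space at the identity),
as an operation on the vector space `G`. -/
def groupBracket {G : Type u} [NormedAddCommGroup G] [NormedSpace ℝ G] [Group G] (x y : G) : G :=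
  @Bracket.bracket (GroupLieAlgebra 𝓘(ℝ, G) G) (GroupLieAlgebra 𝓘(ℝ, G) G) inferInstance x y

/-- The direct sum decomposition `G = ⨁ 𝒱 ℓ` (given by `DirectSum.Decomposition 𝒱`) is a gradation,
by the positive integers, of the Lie algebra of `G`. -/
structure IsLieGradation {G : Type u} [NormedAddCommGroup G] [NormedSpace ℝ G] [Group G]
    (𝒱 : ℕ → Submodule ℝ G) : Prop where
  zero_eq_bot : 𝒱 0 = ⊥
  bracket_mem : ∀ (i j : ℕ) (x y : G), x ∈ 𝒱 i → y ∈ 𝒱 j → groupBracket x y ∈ 𝒱 (i + j)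

/-- The dilation `D_r`, the linear map equal to `r ^ ℓ` on `𝒱 ℓ`. -/
def dilation {G : Type u} [NormedAddCommGroup G] [NormedSpace ℝ G]
    (𝒱 : ℕ → Submodule ℝ G) [DirectSum.Decomposition 𝒱] (r : ℝ) : G →ₗ[ℝ] G :=
  (DirectSum.toModule ℝ ℕ G fun ℓ => r ^ ℓ • (𝒱 ℓ).subtype) ∘ₗ
    (DirectSum.decomposeLinearEquiv 𝒱).toLinearMap

/-- The homogeneous dimension `Q = ∑ ℓ, ℓ * dim 𝒱 ℓ`. -/
def homogeneousDim {G : Type u} [NormedAddCommGroup G] [NormedSpace ℝ G]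
    (𝒱 : ℕ → Submodule ℝ G) : ℕ :=
  ∑ᶠ ℓ : ℕ, ℓ * Module.finrank ℝ (𝒱 ℓ)

end Group

/-! ### The nil-manifold `M = Γ \ G` and its measure -/

section Nilmanifold

/-- The quotient `Γ \ G` of `G` by the left action of `Γ`, that is, the space of classes `Γ x`. -/
abbrev NilManifold {G : Type u} [Group G] (Γ : Subgroup G) : Type u :=
  Quotient (QuotientGroup.rightRel Γ)

/-- The class `Γ x`. -/
def NilManifold.mk {G : Type u} [Group G] (Γ : Subgroup G) (x : G) : NilManifold Γ :=
  Quotient.mk (QuotientGroup.rightRel Γ) x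

theorem NilManifold.mk_mul {G : Type u} [Group G] (Γ : Subgroup G) (γ : Γ) (x : G) :
    NilManifold.mk Γ ((γ : G) * x) = NilManifold.mk Γ x := by
  apply Quotient.sound
  change QuotientGroup.rightRel Γ _ _
  rw [QuotientGroup.rightRel_apply]
  simp

theorem NilManifold.rel_exists {G : Type u} [Group G] {Γ : Subgroup G} {x y : G}
    (h : QuotientGroup.rightRel Γ x y) : ∃ γ : Γ, y = (γ : G) * x :=
  ⟨⟨y * x⁻¹, QuotientGroup.rightRel_apply.1 h⟩, by simp⟩

/-- The periodisation `Γ x ↦ ∑ γ, F (γ x)`, as a function on `Γ \ G`. -/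
def periodization {G : Type u} [Group G] (Γ : Subgroup G) (F : G → ℝ≥0∞) : NilManifold Γ → ℝ≥0∞ :=
  Quotient.lift (fun x => ∑' γ : Γ, F ((γ : G) * x)) (by
    intro x y h
    obtain ⟨δ, rfl⟩ := NilManifold.rel_exists h
    rw [← (Equiv.mulRight δ).tsum_eq (fun γ : Γ => F ((γ : G) * x))]
    simp [mul_assoc])

/-- `ν` is the measure `dẋ` on `M = Γ \ G` associated with the measure `μ` on `G`:
`∫_G F dμ = ∫_M ∑ γ, F (γ x) dν(ẋ)` for every measurable `F ≥ 0`. -/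
def IsQuotientMeasure {G : Type u} [Group G] [MeasurableSpace G] (Γ : Subgroup G)
    (μ : Measure G) (ν : Measure (NilManifold Γ)) : Prop :=
  ∀ F : G → ℝ≥0∞, Measurable F → ∫⁻ x, F x ∂μ = ∫⁻ p, periodization Γ F p ∂ν

end Nilmanifold

/-! ### Symbols -/

section Symbols

/-- A strongly continuous unitary irreducible representation of `G` on `H`. -/
structure UnitaryIrrep (G : Type u) [Group G] [TopologicalSpace G]
    (H : Type) [NormedAddCommGroup H] [InnerProductSpace ℂ H] where
  toHom : G →* (H ≃ₗᵢ[ℂ] H)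
  continuous_apply : ∀ v : H, Continuous fun g => toHom g v
  nontrivial : Nontrivial H
  irreducible : ∀ W : Submodule ℂ H, IsClosed (W : Set H) →
    (∀ g, ∀ v ∈ W, toHom g v ∈ W) → W = ⊥ ∨ W = ⊤

/-- Fields `σ(ẋ, π)` of bounded operators over `M` and the unitary irreducible representations of
`G` on separable Hilbert spaces. -/
def SymbolField {G : Type u} [Group G] [TopologicalSpace G] (Γ : Subgroup G) : Type (max u 1) :=
  NilManifold Γ → ∀ (H : Type) [NormedAddCommGroup H] [InnerProductSpace ℂ H] [CompleteSpace H]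
    [TopologicalSpace.SeparableSpace H], UnitaryIrrep G H → (H →L[ℂ] H)

/-- `A` is the group Fourier transform `∫_G f(z) π(z)^* dμ(z)` of `f` at `π` (an integral in the
strong sense; `π(z)^* = π(z)⁻¹`). -/
def IsFourierTransformAt {G : Type u} [Group G] [TopologicalSpace G] [MeasurableSpace G]
    (μ : Measure G) (f : G → ℂ) {H : Type} [NormedAddCommGroup H] [InnerProductSpace ℂ H]
    (π : UnitaryIrrep G H) (A : H →L[ℂ] H) : Prop :=
  ∀ v : H, A v = ∫ z, f z • (π.toHom z)⁻¹ v ∂μ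

/-- `f : E → F` is of class `C^k`, for `F` a topological vector space: the iterated directional
derivatives of order at most `k` exist everywhere, in the topology of `F`, and are continuous. -/
def IsCkInto {E : Type*} [NormedAddCommGroup E] [NormedSpace ℝ E]
    {F : Type*} [AddCommGroup F] [Module ℝ F] [TopologicalSpace F] : ℕ → (E → F) → Prop
  | 0, f => Continuous f
  | k + 1, f => Continuous f ∧ ∀ v : E, ∃ g : E → F,
      (∀ x, Tendsto (fun t : ℝ => t⁻¹ • (f (x + t • v) - f x)) (𝓝[≠] 0) (𝓝 (g x))) ∧
        IsCkInto k g

variable {G : Type u} [NormedAddCommGroup G] [NormedSpace ℝ G] [Group G] [MeasurableSpace G]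

/-- `ẋ ↦ κ_ẋ` is a smooth map from `M = Γ \ G` to the Schwartz space `𝓢(G)`, i.e. the `Γ`-periodic
map `x ↦ κ_ẋ` from `G` to `𝓢(G)` is smooth. -/
def IsSmoothKernel (Γ : Subgroup G) (κ : NilManifold Γ → 𝓢(G, ℂ)) : Prop :=
  ∀ k : ℕ, IsCkInto k fun x : G => κ (NilManifold.mk Γ x)

/-- The field `σ` belongs to the symbol class `𝒜₀`, with associated kernel `κ`: the map `κ` is
smooth from `M` to `𝓢(G)`, and `σ(ẋ, π)` is the Fourier transform of `κ_ẋ` at `π`. -/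
structure IsSymbolWithKernel (μ : Measure G) (Γ : Subgroup G) (σ : SymbolField Γ)
    (κ : NilManifold Γ → 𝓢(G, ℂ)) : Prop where
  smooth : IsSmoothKernel Γ κ
  fourier : ∀ (p : NilManifold Γ) (H : Type) [NormedAddCommGroup H] [InnerProductSpace ℂ H]
    [CompleteSpace H] [TopologicalSpace.SeparableSpace H] (π : UnitaryIrrep G H),
    IsFourierTransformAt μ (κ p) π (σ p H π)

/-- The kernel `κ^{(ε)}_ẋ(z) = ε^{-Q} κ_ẋ(ε⁻¹ · z)`. -/
def dilatedKernel (𝒱 : ℕ → Submodule ℝ G) [DirectSum.Decomposition 𝒱] {Γ : Subgroup G}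
    (κ : NilManifold Γ → 𝓢(G, ℂ)) (ε : ℝ) : NilManifold Γ → G → ℂ :=
  fun p z => (((ε ^ homogeneousDim 𝒱)⁻¹ : ℝ) : ℂ) * κ p (dilation 𝒱 ε⁻¹ z)

/-- The functions `k_ẋ` form the kernel of the symbol `σ^{(ε)}(ẋ, π) = σ(ẋ, ε · π)`, where
`ε · π` is the representation `z ↦ π(D_ε z)`. -/
def IsKernelOfDilatedSymbol (𝒱 : ℕ → Submodule ℝ G) [DirectSum.Decomposition 𝒱] (μ : Measure G)
    {Γ : Subgroup G} (σ : SymbolField Γ) (ε : ℝ) (k : NilManifold Γ → G → ℂ) : Prop :=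
  ∀ (p : NilManifold Γ) (H : Type) [NormedAddCommGroup H] [InnerProductSpace ℂ H]
    [CompleteSpace H] [TopologicalSpace.SeparableSpace H] (π επ : UnitaryIrrep G H),
    (∀ z, επ.toHom z = π.toHom (dilation 𝒱 ε z)) → IsFourierTransformAt μ (k p) π (σ p H επ)

end Symbols

/-! ### The quantization -/

section Quantization

variable {G : Type u} [NormedAddCommGroup G] [NormedSpace ℝ G] [Group G] [MeasurableSpace G]

/-- The function `Γ x ↦ (f_G * k_ẋ)(x) = ∫_G f(Γ y) k_ẋ(y⁻¹ x) dy` on `M`. -/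
def opFun [BorelSpace G] [LieGroup 𝓘(ℝ, G) ∞ G] (μ : Measure G) [μ.IsMulLeftInvariant]
    (Γ : Subgroup G) (k : NilManifold Γ → G → ℂ) (f : NilManifold Γ → ℂ) : NilManifold Γ → ℂ :=
  Quotient.lift
    (fun x => ∫ y, f (NilManifold.mk Γ y) * k (NilManifold.mk Γ x) (y⁻¹ * x) ∂μ) (by
      intro x y h
      obtain ⟨γ, rfl⟩ := NilManifold.rel_exists h
      have : IsTopologicalGroup G := topologicalGroup_of_lieGroup 𝓘(ℝ, G) ∞
      have hm : NilManifold.mk Γ ((γ : G) * x) = NilManifold.mk Γ x := NilManifold.mk_mul Γ γ x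
      simp only [hm]
      rw [← integral_mul_left_eq_self (fun y => f (NilManifold.mk Γ y) *
        k (NilManifold.mk Γ x) (y⁻¹ * ((γ : G) * x))) (γ : G)]
      simp [NilManifold.mk_mul, mul_assoc])

/-- The bounded operator `T` on `L²(M)` is the operator with kernel `k`: for each `f ∈ L²(M)`, the
integrals defining `f_G * k_ẋ` converge and `T f (ẋ) = (f_G * k_ẋ)(x)`. -/
def IsOp [BorelSpace G] [LieGroup 𝓘(ℝ, G) ∞ G] (μ : Measure G) [μ.IsMulLeftInvariant]
    (Γ : Subgroup G) (ν : Measure (NilManifold Γ)) (k : NilManifold Γ → G → ℂ)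
    (T : Lp ℂ 2 ν →L[ℂ] Lp ℂ 2 ν) : Prop :=
  ∀ f : Lp ℂ 2 ν,
    (∀ x : G, Integrable
      (fun y => f (NilManifold.mk Γ y) * k (NilManifold.mk Γ x) (y⁻¹ * x)) μ) ∧
    T f =ᵐ[ν] opFun μ Γ k f

end Quantization

/-! ### Hilbert–Schmidt and trace-class operators -/

section Operators

variable {H : Type u} [NormedAddCommGroup H] [InnerProductSpace ℂ H] [CompleteSpace H]

/-- `T` is Hilbert–Schmidt with norm `s`: `∑ ‖T eᵢ‖² = s²` for every orthonormal basis. -/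
def HasHilbertSchmidtNorm (T : H →L[ℂ] H) (s : ℝ) : Prop :=
  0 ≤ s ∧ ∀ (ι : Type u) (e : HilbertBasis ι ℂ H), HasSum (fun i => ‖T (e i)‖ ^ 2) (s ^ 2)

/-- `T` is trace class: `∑ ⟨eᵢ, |T| eᵢ⟩ < ∞` for every orthonormal basis, `|T| = (T^* T)^{1/2}`. -/
def IsTraceClass (T : H →L[ℂ] H) : Prop :=
  ∀ (ι : Type u) (e : HilbertBasis ι ℂ H),
    Summable fun i => (inner ℂ (e i) (CFC.abs T (e i))).re

/-- `T` has trace `τ`: `∑ ⟨eᵢ, T eᵢ⟩ = τ` for every orthonormal basis, with absolute convergence. -/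
def HasTrace (T : H →L[ℂ] H) (τ : ℂ) : Prop :=
  ∀ (ι : Type u) (e : HilbertBasis ι ℂ H), HasSum (fun i => inner ℂ (e i) (T (e i))) τ

end Operators

end

noncomputable section

/-! ### Left translations in exponential coordinates, and bracket-preserving linear maps. -/

section LieGroupLaw

/-! Unfolding over `Γ` turns `Op^ε(σ)` into the integral operator on `M` with kernel K(ẋ, ẏ) = ∑_γ
κ^{(ε)}_ẋ(y⁻¹γx) (`IsSummableKernel.integral_mul_eq`). This kernel is continuous on the compact
space `M × M`, so the squared Hilbert–Schmidt norm is ∬|K|², and the trace, once it is known to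
exist, is ∫ K(ẋ, ẋ).

The term γ = 1 produces the main terms exactly: it equals ε^{-Q} κ_ẋ(0) on the diagonal, and, after
one of the two factors of |K|² has been unfolded, it integrates to ε^{-Q} ∫|κ_ẋ|². All other terms
are O(ε^N). Indeed `x` can be kept in a bounded set by a measurable section, so discreteness of `Γ`
keeps x⁻¹γx away from 0 for γ ≠ 1; the dilation by ε⁻¹ pushes it to distance at least of order ε⁻¹,
and Schwartz decay then beats every power of ε while leaving a power of 1 + ‖γ‖ summable over `Γ`
(`exists_pow_norm_lattice_le`, `exists_summable_lattice`). For the cross terms of the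
Hilbert–Schmidt norm, y⁻¹x and y⁻¹γx differ by the factor x⁻¹γx, so after dilation they cannot both
be small (`exists_norm_dilatedKernel_mul_le`).

Continuity of the kernel does not give the trace class property. Smoothness in ẏ does: Fourier
inversion of a cut-off of K writes it as an absolutely convergent superposition of products a(p, ξ)
c(ξ, q) (`exists_fourier_decomposition`), and an absolutely convergent integral of rank one
operators is trace class with the expected trace (`isTraceClass_and_hasTrace_of_integral`).

The structure of `G` is obtained without the Baker–Campbell–Hausdorff formula. A linear map
preserving the bracket is a group morphism, by a differential equation for the left Maurer–Cartan
form (`map_mul_of_map_groupBracket`), so the dilations are automorphisms. Scaling then gives the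
rest: left translations have Jacobian 1, hence Haar measure is Lebesgue measure, and the product and
its derivatives grow polynomially. -/

theorem mlieBracket_eq_lieBracket {E : Type*} [NormedAddCommGroup E] [NormedSpace ℝ E]
    (V W : E → E) (g : E) :
    VectorField.mlieBracket 𝓘(ℝ, E) (M := E) V W g = VectorField.lieBracket ℝ V W g := by
  rw [← VectorField.lieBracketWithin_univ]
  exact congrFun (VectorField.mlieBracketWithin_eq_lieBracketWithin (s := Set.univ)) g

variable {G : Type u} [NormedAddCommGroup G] [NormedSpace ℝ G] [Group G]

theorem IsExponentialCoordinates.one_eq_zero (hG : IsExponentialCoordinates G) : (1 : G) = 0 := by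
  have h := hG 0 0 (0 : G)
  simp only [zero_smul, add_zero] at h
  exact (mul_eq_left.1 h).symm

theorem IsExponentialCoordinates.inv_eq_neg (hG : IsExponentialCoordinates G) (x : G) :
    x⁻¹ = -x := by
  have h := hG 1 (-1) x
  simp only [one_smul, neg_smul, add_neg_cancel, zero_smul, ← hG.one_eq_zero] at h
  exact (eq_inv_of_mul_eq_one_right h).symm

/-- The left-invariant vector field with value `v` at the identity. -/
def leftField (v g : G) : G := fderiv ℝ (fun a => g * a) 1 v

theorem mulInvariantVectorField_eq_leftField (v : G) :
    (mulInvariantVectorField (I := 𝓘(ℝ, G)) (G := G) v : G → G) = leftField v := by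
  ext g
  simp only [mulInvariantVectorField, leftField]
  rw [mfderiv_eq_fderiv]
  rfl

variable [LieGroup 𝓘(ℝ, G) ∞ G]

theorem contDiff_groupMul : ContDiff ℝ ∞ fun p : G × G => p.1 * p.2 := by
  have h := contMDiff_mul 𝓘(ℝ, G) ∞ (G := G)
  rw [← contMDiff_iff_contDiff]
  rw [modelWithCornersSelf_prod, ← chartedSpaceSelf_prod]
  exact h

theorem contDiff_groupMul_left (g : G) : ContDiff ℝ ∞ fun a : G => g * a :=
  contDiff_groupMul.comp (contDiff_const.prodMk contDiff_id)

theorem lieGroup_minSmoothness : LieGroup 𝓘(ℝ, G) (minSmoothness ℝ 3) G := by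
  refine LieGroup.of_le (n := ∞) ?_
  simp only [minSmoothness_of_isRCLikeNormedField]
  exact WithTop.coe_le_coe.2 (le_top : (3 : ℕ∞) ≤ ⊤)

theorem lieBracket_leftField [CompleteSpace G] (v w g : G) :
    VectorField.lieBracket ℝ (leftField v) (leftField w) g = leftField (groupBracket v w) g := by
  have : LieGroup 𝓘(ℝ, G) (minSmoothness ℝ 3) G := lieGroup_minSmoothness
  -- Abstracting the two fields lets sections of the tangent bundle be replaced by plain functions
  -- `G → G` without rewriting under dependent types.
  have key : ∀ V W : (x : G) → TangentSpace 𝓘(ℝ, G) x,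
      mulInvariantVectorField (I := 𝓘(ℝ, G)) (G := G) v = V →
      mulInvariantVectorField (I := 𝓘(ℝ, G)) (G := G) w = W →
      VectorField.mlieBracket 𝓘(ℝ, G) V W g =
        mulInvariantVectorField (I := 𝓘(ℝ, G)) (G := G) (groupBracket (G := G) v w) g := by
    rintro _ _ rfl rfl
    exact (congrFun (mulInvariantVector_mlieBracket (I := 𝓘(ℝ, G)) (G := G) v w) g).symm
  exact (mlieBracket_eq_lieBracket _ _ g).symm.trans
    ((key _ _ (mulInvariantVectorField_eq_leftField v)
      (mulInvariantVectorField_eq_leftField w)).trans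
      (congrFun (mulInvariantVectorField_eq_leftField (groupBracket v w)) g))

theorem groupBracket_add_left [CompleteSpace G] (x y z : G) :
    groupBracket (x + y) z = groupBracket x z + groupBracket y z := by
  have : LieGroup 𝓘(ℝ, G) (minSmoothness ℝ 3) G := lieGroup_minSmoothness
  exact add_lie (L := GroupLieAlgebra 𝓘(ℝ, G) G) (M := GroupLieAlgebra 𝓘(ℝ, G) G) x y z

theorem groupBracket_add_right [CompleteSpace G] (x y z : G) :
    groupBracket x (y + z) = groupBracket x y + groupBracket x z := by
  have : LieGroup 𝓘(ℝ, G) (minSmoothness ℝ 3) G := lieGroup_minSmoothness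
  exact lie_add (L := GroupLieAlgebra 𝓘(ℝ, G) G) (M := GroupLieAlgebra 𝓘(ℝ, G) G) x y z

theorem groupBracket_smul_left [CompleteSpace G] (c : ℝ) (x y : G) :
    groupBracket (c • x) y = c • groupBracket x y := by
  have : LieGroup 𝓘(ℝ, G) (minSmoothness ℝ 3) G := lieGroup_minSmoothness
  exact smul_lie (L := GroupLieAlgebra 𝓘(ℝ, G) G) (M := GroupLieAlgebra 𝓘(ℝ, G) G) c x y

theorem groupBracket_smul_right [CompleteSpace G] (c : ℝ) (x y : G) :
    groupBracket x (c • y) = c • groupBracket x y := by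
  have : LieGroup 𝓘(ℝ, G) (minSmoothness ℝ 3) G := lieGroup_minSmoothness
  exact lie_smul (L := GroupLieAlgebra 𝓘(ℝ, G) G) (M := GroupLieAlgebra 𝓘(ℝ, G) G) c x y

/-- The derivative at the identity of the left translation by `g`. -/
def leftOp (g : G) : G →L[ℝ] G := fderiv ℝ (fun a => g * a) 1

/-- The derivative at `g` of the left translation by `g⁻¹`. -/
def leftOpInv (g : G) : G →L[ℝ] G := fderiv ℝ (fun a => g⁻¹ * a) g

theorem contDiff_leftOp : ContDiff ℝ ∞ (leftOp : G → G →L[ℝ] G) :=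
  ContDiff.fderiv (f := fun g a : G => g * a) (n := ∞) contDiff_groupMul contDiff_const (by simp)

theorem contDiff_leftOpInv (hG : IsExponentialCoordinates G) :
    ContDiff ℝ ∞ (leftOpInv : G → G →L[ℝ] G) := by
  refine ContDiff.fderiv (f := fun g a : G => g⁻¹ * a) (n := ∞) (m := ∞) ?_ contDiff_id (by simp)
  change ContDiff ℝ ∞ fun p : G × G => p.1⁻¹ * p.2
  simp only [hG.inv_eq_neg]
  exact contDiff_groupMul.comp (contDiff_fst.neg.prodMk contDiff_snd)

theorem hasFDerivAt_leftOp (g : G) : HasFDerivAt (fun a => g * a) (leftOp g) 1 :=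
  ((contDiff_groupMul_left g).differentiable (by simp)).differentiableAt.hasFDerivAt

theorem hasFDerivAt_leftOpInv (g : G) : HasFDerivAt (fun a => g⁻¹ * a) (leftOpInv g) g :=
  ((contDiff_groupMul_left g⁻¹).differentiable (by simp)).differentiableAt.hasFDerivAt

theorem leftOpInv_comp_leftOp (g : G) : (leftOpInv g).comp (leftOp g) = .id ℝ G := by
  have h1 : HasFDerivAt (fun a => g⁻¹ * a) (leftOpInv g) (g * 1) := by
    rw [mul_one]; exact hasFDerivAt_leftOpInv g
  have h := h1.comp (1 : G) (hasFDerivAt_leftOp g)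
  simp only [Function.comp_def, inv_mul_cancel_left] at h
  exact h.unique (hasFDerivAt_id _)

theorem leftOp_comp_leftOpInv (g : G) : (leftOp g).comp (leftOpInv g) = .id ℝ G := by
  have h1 : HasFDerivAt (fun a => g * a) (leftOp g) (g⁻¹ * g) := by
    rw [inv_mul_cancel]; exact hasFDerivAt_leftOp g
  have h := h1.comp g (hasFDerivAt_leftOpInv g)
  simp only [Function.comp_def, mul_inv_cancel_left] at h
  exact h.unique (hasFDerivAt_id _)

theorem leftOpInv_leftOp (g v : G) : leftOpInv g (leftOp g v) = v :=
  congrArg (fun T => T v) (leftOpInv_comp_leftOp g)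

theorem leftOp_leftOpInv (g v : G) : leftOp g (leftOpInv g v) = v :=
  congrArg (fun T => T v) (leftOp_comp_leftOpInv g)

/-- Since x(sv) = (x(tv))((s − t)v), the derivative at `t` reduces to the one at the identity. -/
theorem hasDerivAt_mul_smul (hG : IsExponentialCoordinates G) (x v : G) (t : ℝ) :
    HasDerivAt (fun t : ℝ => x * (t • v)) (leftOp (x * t • v) v) t := by
  have h1 : HasDerivAt (fun h : ℝ => (h - t) • v) v t := by
    simpa using ((hasDerivAt_id t).sub_const t).smul_const v
  have h2 : HasFDerivAt (fun a => (x * t • v) * a) (leftOp (x * t • v)) ((t - t) • v) := by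
    rw [sub_self, zero_smul, ← hG.one_eq_zero]; exact hasFDerivAt_leftOp _
  have h := h2.comp_hasDerivAt t h1
  refine h.congr_of_eventuallyEq (Eventually.of_forall fun s => ?_)
  simp only [Function.comp_def, mul_assoc]
  rw [hG, add_sub_cancel]

/-- The line `s ↦ s • a` is a one-parameter subgroup, so its constant velocity `a` is the value
along it of the left-invariant field of `a`. -/
theorem leftOp_smul_self (hG : IsExponentialCoordinates G) (s : ℝ) (a : G) :
    leftOp (s • a) a = a := by
  have h := hasDerivAt_mul_smul hG 1 a s
  simp only [one_mul] at h
  exact h.unique (by simpa using (hasDerivAt_id s).smul_const a)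

/-- Differentiate `leftOp_smul_self` with respect to `a` in the direction `u`. -/
theorem leftOp_add_fderiv (hG : IsExponentialCoordinates G) (s : ℝ) (a u : G) :
    leftOp (s • a) u + s • (fderiv ℝ leftOp (s • a) u) a = u := by
  have h1 : HasFDerivAt (leftOp : G → G →L[ℝ] G) (fderiv ℝ leftOp (s • a)) (s • a) :=
    (contDiff_leftOp.differentiable (by simp)).differentiableAt.hasFDerivAt
  have h2 : HasFDerivAt (fun b : G => s • b) (s • ContinuousLinearMap.id ℝ G) a :=
    (hasFDerivAt_id a).const_smul s
  have h := (h1.comp a h2).clm_apply (hasFDerivAt_id a)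
  have h3 : (fun b : G => (leftOp ∘ fun b : G => s • b) b (id b)) = id := by
    ext b; simp [leftOp_smul_self hG]
  rw [h3] at h
  have := congrArg (fun T : G →L[ℝ] G => T u) (h.unique (hasFDerivAt_id a))
  simpa using this

/-- The Maurer–Cartan structure equation: the bracket of two left-invariant fields, computed in the
linear coordinates. -/
theorem fderiv_leftOp_bracket [CompleteSpace G] (g v w : G) :
    fderiv ℝ leftOp g (leftOp g v) w - fderiv ℝ leftOp g (leftOp g w) v =
      leftOp g (groupBracket v w) := by
  have h := lieBracket_leftField v w g
  have hd (v : G) : fderiv ℝ (leftField v) g = (fderiv ℝ leftOp g).flip v := by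
    have h1 : HasFDerivAt (leftOp : G → G →L[ℝ] G) (fderiv ℝ leftOp g) g :=
      (contDiff_leftOp.differentiable (by simp)).differentiableAt.hasFDerivAt
    have h2 := h1.clm_apply (hasFDerivAt_const v g)
    refine (h2.congr_fderiv ?_).fderiv
    ext; simp
  simp only [VectorField.lieBracket, hd] at h
  exact h

/-- A linear equation y' = u − [a, y] with y(0) = 0, which determines `leftOpInv a` from the bracket
alone; it stands in for the series (1 − e^{−ad a})/ad a. The factor `s` makes the initial value
vanish. It results from the derivative of `leftOpInv ∘ leftOp = id` along the ray, the structure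
equation and `leftOp_add_fderiv`. -/
theorem hasDerivAt_smul_leftOpInv [CompleteSpace G] (hG : IsExponentialCoordinates G) (a u : G)
    (s : ℝ) : HasDerivAt (fun s : ℝ => s • leftOpInv (s • a) u)
      (u - groupBracket a (s • leftOpInv (s • a) u)) s := by
  set A := leftOp (s • a) with hA
  set M := leftOpInv (s • a) with hM
  have hsa : HasDerivAt (fun s : ℝ => s • a) a s := by simpa using (hasDerivAt_id s).smul_const a
  have h1 : HasDerivAt (fun s : ℝ => (leftOp (s • a) : G →L[ℝ] G))
      (fderiv ℝ leftOp (s • a) a) s :=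
    HasFDerivAt.comp_hasDerivAt (l := leftOp) s
      (contDiff_leftOp.differentiable (by simp)).differentiableAt.hasFDerivAt hsa
  have h2 : HasDerivAt (fun s : ℝ => (leftOpInv (s • a) : G →L[ℝ] G))
      (fderiv ℝ leftOpInv (s • a) a) s :=
    HasFDerivAt.comp_hasDerivAt (l := leftOpInv) s
      ((contDiff_leftOpInv hG).differentiable (by simp)).differentiableAt.hasFDerivAt hsa
  set A' := fderiv ℝ leftOp (s • a) a with hA'
  set M' := fderiv ℝ leftOpInv (s • a) a with hM'
  have h3 : M'.comp A + M.comp A' = 0 := by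
    have h := h2.clm_comp h1
    simp only [leftOpInv_comp_leftOp] at h
    exact h.unique (hasDerivAt_const s _)
  have h4 : M' u = - M (A' (M u)) := by
    have := congrArg (fun T : G →L[ℝ] G => T (M u)) h3
    simp only [add_apply, ContinuousLinearMap.comp_apply, hA, hM,
      leftOp_leftOpInv, zero_apply] at this
    exact eq_neg_of_add_eq_zero_left this
  -- The structure equation with v = a and w = M u, where A a = a and A (M u) = u, trades the radial
  -- derivative of `A` for its derivative in the direction `u`, which `leftOp_add_fderiv` evaluates.
  have h5 : s • A' (M u) = s • A (groupBracket a (M u)) + (u - A u) := by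
    have e1 := fderiv_leftOp_bracket (s • a) a (M u)
    rw [leftOp_smul_self hG, hM, leftOp_leftOpInv] at e1
    have e2 := leftOp_add_fderiv hG s a u
    rw [← hM] at e1
    rw [hA', hA, ← e1, smul_sub]
    nth_rewrite 4 [← e2]
    abel
  have h6 : s • M' u = u - M u - s • groupBracket a (M u) := by
    rw [h4, smul_neg, ← map_smul, h5, map_add, map_sub, map_smul]
    simp only [hA, hM, leftOpInv_leftOp]
    abel
  have h7 := (hasDerivAt_id s).smul (h2.clm_apply (hasDerivAt_const s u))
  refine h7.congr_deriv ?_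
  simp only [id, map_zero, add_zero, one_smul]
  rw [h6, groupBracket_smul_right]
  abel

/-- The bracket with `a` as a linear operator. -/
def bracketLeft [CompleteSpace G] (a : G) : G →ₗ[ℝ] G where
  toFun := groupBracket a
  map_add' := groupBracket_add_right a
  map_smul' c := groupBracket_smul_right c a

theorem eq_zero_of_hasDerivAt_clm {E : Type*} [NormedAddCommGroup E] [NormedSpace ℝ E]
    (L : E →L[ℝ] E) (d : ℝ → E) (h : ∀ s, HasDerivAt d (L (d s)) s) (h0 : d 0 = 0) :
    d = 0 := by
  refine ODE_solution_unique_univ (v := fun _ x => L x) (s := fun _ => Set.univ) (K := ‖L‖₊)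
    (t₀ := 0) (fun t => (L.lipschitz).lipschitzOnWith) (fun t => ⟨h t, trivial⟩)
    (fun t => ⟨?_, trivial⟩) (by simpa using h0)
  simp

/-- With the factor `s` of `hasDerivAt_smul_leftOpInv`, the difference of the two sides along the
ray solves d' = −[φ a, d] and vanishes at 0, hence vanishes at s = 1. -/
theorem map_leftOpInv [FiniteDimensional ℝ G] (hG : IsExponentialCoordinates G) (φ : G →ₗ[ℝ] G)
    (hφ : ∀ x y, φ (groupBracket x y) = groupBracket (φ x) (φ y)) (a u : G) :
    φ (leftOpInv a u) = leftOpInv (φ a) (φ u) := by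
  have : CompleteSpace G := FiniteDimensional.complete ℝ G
  have h1 (s : ℝ) := (LinearMap.toContinuousLinearMap φ).hasFDerivAt.comp_hasDerivAt s
    (hasDerivAt_smul_leftOpInv hG a u s)
  have h2 := hasDerivAt_smul_leftOpInv hG (φ a) (φ u)
  have h := eq_zero_of_hasDerivAt_clm (-(LinearMap.toContinuousLinearMap (bracketLeft (φ a))))
    _ (fun s => ((h1 s).sub (h2 s)).congr_deriv ?_) (by simp)
  · have := congrFun h 1
    simp only [Pi.sub_apply, Function.comp_apply, LinearMap.coe_toContinuousLinearMap', one_smul,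
      Pi.zero_apply] at this
    exact sub_eq_zero.1 this
  · simp only [Pi.sub_apply, Function.comp_apply, neg_apply,
      LinearMap.coe_toContinuousLinearMap', map_sub, hφ]
    simp only [bracketLeft, LinearMap.coe_mk, AddHom.coe_mk]
    abel

theorem map_leftOp [FiniteDimensional ℝ G] (hG : IsExponentialCoordinates G) (φ : G →ₗ[ℝ] G)
    (hφ : ∀ x y, φ (groupBracket x y) = groupBracket (φ x) (φ y)) (a v : G) :
    φ (leftOp a v) = leftOp (φ a) (φ v) := by
  have h := map_leftOpInv hG φ hφ a (leftOp a v)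
  rw [leftOpInv_leftOp] at h
  rw [h, leftOp_leftOpInv]

/-- A linear map which preserves the Lie bracket is a group morphism. -/
theorem map_mul_of_map_groupBracket [FiniteDimensional ℝ G] (hG : IsExponentialCoordinates G)
    (φ : G →ₗ[ℝ] G) (hφ : ∀ x y, φ (groupBracket x y) = groupBracket (φ x) (φ y)) (x v : G) :
    φ (x * v) = φ x * φ v := by
  set w := φ v with hw
  have h1 (t : ℝ) : HasDerivAt (fun t : ℝ => φ (x * t • v)) (leftOp (φ (x * t • v)) w) t := by
    have := (LinearMap.toContinuousLinearMap φ).hasFDerivAt.comp_hasDerivAt t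
      (hasDerivAt_mul_smul hG x v t)
    simpa [Function.comp_def, map_leftOp hG φ hφ] using this
  -- The curves φ(x·tv) and φ(x)·tw both solve c' = `leftOp c w`. Instead of invoking uniqueness for
  -- this nonlinear equation, the first is multiplied by (tw)⁻¹ = −tw and the product is shown to be
  -- constant.
  have key (t : ℝ) : HasDerivAt (fun t : ℝ => φ (x * t • v) * (-t) • w) 0 t := by
    set c := φ (x * t • v) with hc
    have hm : HasFDerivAt (fun p : G × G => p.1 * p.2) (fderiv ℝ (fun p : G × G => p.1 * p.2)
        (c, (-t) • w)) (c, (-t) • w) :=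
      (contDiff_groupMul.differentiable (by simp)).differentiableAt.hasFDerivAt
    set m' := fderiv ℝ (fun p : G × G => p.1 * p.2) (c, (-t) • w)
    have h2 : HasDerivAt (fun s : ℝ => (-s) • w) (-w) t := by
      simpa using (hasDerivAt_id t).neg.smul_const w
    have e1 := hm.comp_hasDerivAt t ((h1 t).prodMk h2)
    -- One curve, s ↦ c·((s − 2t)w), is differentiated in two ways: with (s − t)w attached to the
    -- left factor here, and to the right factor in `e3`. Comparing them shows that the two partial
    -- derivatives of the product cancel in `e1`.
    have e2 : HasDerivAt (fun s : ℝ => (c * (s - t) • w) * (-t) • w) (m' (leftOp c w, 0)) t := by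
      have h3 : HasDerivAt (fun s : ℝ => c * (s - t) • w) (leftOp c w) t := by
        have h4 : HasDerivAt (fun h : ℝ => (h - t) • w) w t := by
          simpa using ((hasDerivAt_id t).sub_const t).smul_const w
        have h5 : HasFDerivAt (fun a => c * a) (leftOp c) ((t - t) • w) := by
          rw [sub_self, zero_smul, ← hG.one_eq_zero]; exact hasFDerivAt_leftOp _
        exact h5.comp_hasDerivAt t h4
      have h6 := h3.prodMk (hasDerivAt_const t ((-t) • w))
      have hm' : HasFDerivAt (fun p : G × G => p.1 * p.2) m' (c * (t - t) • w, (-t) • w) := by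
        rw [sub_self, zero_smul, ← hG.one_eq_zero, mul_one]; exact hm
      exact hm'.comp_hasDerivAt t h6
    have e3 : HasDerivAt (fun s : ℝ => (c * (s - t) • w) * (-t) • w) (m' (0, w)) t := by
      have h4 : HasDerivAt (fun s : ℝ => (s - t + -t) • w) w t := by
        simpa using (((hasDerivAt_id t).sub_const t).add_const (-t)).smul_const w
      have h6 := (hasDerivAt_const t c).prodMk h4
      have hm' : HasFDerivAt (fun p : G × G => p.1 * p.2) m' (c, (t - t + -t) • w) := by
        rw [sub_self, zero_add]; exact hm
      refine (hm'.comp_hasDerivAt t h6).congr_of_eventuallyEq (Eventually.of_forall fun s => ?_)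
      simp only [Function.comp_def, mul_assoc]
      rw [hG]
    refine e1.congr_deriv ?_
    have : (leftOp c w, -w) = (leftOp c w, (0 : G)) - (0, w) := by simp
    rw [this, map_sub, e2.unique e3, sub_self]
  have hconst := is_const_of_deriv_eq_zero (fun t => (key t).differentiableAt)
    (fun t => (key t).deriv) 1 0
  simp only [one_smul, neg_zero, zero_smul, ← hG.one_eq_zero, mul_one, neg_smul,
    ← hG.inv_eq_neg] at hconst
  exact mul_inv_eq_iff_eq_mul.1 hconst

end LieGroupLaw

/-! ### Dilations are group automorphisms. -/

section Dilation

variable {G : Type u} [NormedAddCommGroup G] [NormedSpace ℝ G]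
  (𝒱 : ℕ → Submodule ℝ G) [DirectSum.Decomposition 𝒱]

theorem dilation_of_mem (r : ℝ) {ℓ : ℕ} {x : G} (hx : x ∈ 𝒱 ℓ) :
    dilation 𝒱 r x = r ^ ℓ • x := by
  simp only [dilation, LinearMap.comp_apply]
  erw [DirectSum.decomposeLinearEquiv_apply]
  rw [DirectSum.decompose_of_mem 𝒱 hx]
  erw [DirectSum.toModule_lof]
  simp

theorem dilation_groupBracket [FiniteDimensional ℝ G] [Group G] [LieGroup 𝓘(ℝ, G) ∞ G]
    (h𝒱 : IsLieGradation 𝒱) (r : ℝ) (x y : G) :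
    dilation 𝒱 r (groupBracket x y) = groupBracket (dilation 𝒱 r x) (dilation 𝒱 r y) := by
  have : CompleteSpace G := FiniteDimensional.complete ℝ G
  have z1 (x : G) : groupBracket x 0 = 0 := map_zero (bracketLeft x)
  have z2 (y : G) : groupBracket 0 y = 0 := by
    simpa using groupBracket_smul_left (0 : ℝ) 0 y
  induction x using DirectSum.Decomposition.inductionOn 𝒱 with
  | zero => simp [z2]
  | add a b ha hb => simp [groupBracket_add_left, ha, hb]
  | @homogeneous i a =>
    induction y using DirectSum.Decomposition.inductionOn 𝒱 with
    | zero => simp [z1]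
    | add a b ha hb => simp [groupBracket_add_right, ha, hb]
    | @homogeneous j b =>
      rw [dilation_of_mem 𝒱 r a.2, dilation_of_mem 𝒱 r b.2,
        dilation_of_mem 𝒱 r (h𝒱.bracket_mem i j a b a.2 b.2), groupBracket_smul_left,
        groupBracket_smul_right, smul_smul, pow_add]

theorem dilation_mul [FiniteDimensional ℝ G] [Group G] [LieGroup 𝓘(ℝ, G) ∞ G]
    (hG : IsExponentialCoordinates G) (h𝒱 : IsLieGradation 𝒱) (r : ℝ) (x y : G) :
    dilation 𝒱 r (x * y) = dilation 𝒱 r x * dilation 𝒱 r y :=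
  map_mul_of_map_groupBracket hG _ (dilation_groupBracket 𝒱 h𝒱 r) x y

end Dilation

/-! ### Norm bounds and determinant of the dilations. -/

section DilationBounds

variable {G : Type u} [NormedAddCommGroup G] [NormedSpace ℝ G]
  (𝒱 : ℕ → Submodule ℝ G) [DirectSum.Decomposition 𝒱]

theorem finite_ne_bot_of_decomposition [FiniteDimensional ℝ G] : {ℓ | 𝒱 ℓ ≠ ⊥}.Finite :=
  WellFoundedGT.finite_ne_bot_of_iSupIndep
    (DirectSum.Decomposition.isInternal 𝒱).submodule_iSupIndep

/-- The set of weights of the decomposition. -/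
def weights [FiniteDimensional ℝ G] : Finset ℕ := (finite_ne_bot_of_decomposition 𝒱).toFinset

theorem mem_weights [FiniteDimensional ℝ G] {ℓ : ℕ} : ℓ ∈ weights 𝒱 ↔ 𝒱 ℓ ≠ ⊥ := by
  simp [weights]

/-- The projection on `𝒱 ℓ`. -/
def weightProj (ℓ : ℕ) : G →ₗ[ℝ] G :=
  (𝒱 ℓ).subtype ∘ₗ DirectSum.component ℝ ℕ (fun i => 𝒱 i) ℓ ∘ₗ
    (DirectSum.decomposeLinearEquiv 𝒱).toLinearMap

theorem weightProj_of_mem {ℓ : ℕ} {x : G} (hx : x ∈ 𝒱 ℓ) : weightProj 𝒱 ℓ x = x :=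
  DirectSum.decompose_of_mem_same 𝒱 hx

theorem weightProj_of_mem_ne {i j : ℕ} {x : G} (hx : x ∈ 𝒱 i) (h : i ≠ j) :
    weightProj 𝒱 j x = 0 :=
  DirectSum.decompose_of_mem_ne 𝒱 hx h

theorem dilation_one (x : G) : dilation 𝒱 1 x = x := by
  induction x using DirectSum.Decomposition.inductionOn 𝒱 with
  | zero => simp
  | add a b ha hb => simp [ha, hb]
  | @homogeneous i a => simp [dilation_of_mem 𝒱 1 a.2]

theorem dilation_dilation (r s : ℝ) (x : G) :
    dilation 𝒱 r (dilation 𝒱 s x) = dilation 𝒱 (r * s) x := by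
  induction x using DirectSum.Decomposition.inductionOn 𝒱 with
  | zero => simp
  | add a b ha hb => simp [ha, hb]
  | @homogeneous i a =>
    simp [dilation_of_mem 𝒱 _ a.2, smul_smul, mul_pow, mul_comm]

variable [FiniteDimensional ℝ G]

theorem dilation_eq_sum (r : ℝ) (x : G) :
    dilation 𝒱 r x = ∑ ℓ ∈ weights 𝒱, r ^ ℓ • weightProj 𝒱 ℓ x := by
  induction x using DirectSum.Decomposition.inductionOn 𝒱 with
  | zero => simp
  | add a b ha hb => simp [ha, hb, Finset.sum_add_distrib]
  | @homogeneous i a =>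
    rw [dilation_of_mem 𝒱 r a.2]
    by_cases hi : i ∈ weights 𝒱
    · rw [Finset.sum_eq_single i]
      · rw [weightProj_of_mem 𝒱 a.2]
      · intro j _ hj
        rw [weightProj_of_mem_ne 𝒱 a.2 hj.symm, smul_zero]
      · exact fun h => absurd hi h
    · rw [mem_weights, not_not] at hi
      have : (a : G) = 0 := by simpa [hi] using a.2
      simp [this]

/-- The dilation by a nonzero factor as a continuous linear equivalence. -/
def dilationEquiv {r : ℝ} (hr : r ≠ 0) : G ≃L[ℝ] G :=
  (LinearEquiv.ofLinearMap (dilation 𝒱 r) (dilation 𝒱 r⁻¹)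
    (by ext x; simp [dilation_dilation, hr, dilation_one])
    (by ext x; simp [dilation_dilation, hr, dilation_one])).toContinuousLinearEquiv

theorem continuous_dilation_left (x : G) : Continuous fun r : ℝ => dilation 𝒱 r x := by
  simp only [dilation_eq_sum]
  exact continuous_finsetSum _ fun ℓ _ => (continuous_id.pow ℓ).smul continuous_const

theorem exists_norm_weightProj_le : ∃ C : ℝ, 1 ≤ C ∧
    ∀ c : ℕ → ℝ, ∀ b : ℝ, (∀ ℓ ∈ weights 𝒱, |c ℓ| ≤ b) → ∀ x : G,
      ‖∑ ℓ ∈ weights 𝒱, c ℓ • weightProj 𝒱 ℓ x‖ ≤ C * b * ‖x‖ := by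
  have hK (ℓ : ℕ) (x : G) : ‖weightProj 𝒱 ℓ x‖ ≤
      ‖LinearMap.toContinuousLinearMap (weightProj 𝒱 ℓ)‖ * ‖x‖ :=
    (LinearMap.toContinuousLinearMap (weightProj 𝒱 ℓ)).le_opNorm x
  set K := ∑ ℓ ∈ weights 𝒱, ‖LinearMap.toContinuousLinearMap (weightProj 𝒱 ℓ)‖ with hKdef
  have hK0 : 0 ≤ K := Finset.sum_nonneg fun _ _ => norm_nonneg _
  refine ⟨1 + K, by linarith, fun c b hb x => ?_⟩
  -- Without weights the hypothesis does not force `0 ≤ b`; but then every `x` is 0.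
  rcases (weights 𝒱).eq_empty_or_nonempty with h | ⟨ℓ₀, hℓ₀⟩
  · have : x = 0 := by
      have := dilation_eq_sum 𝒱 1 x
      rwa [dilation_one, h, Finset.sum_empty] at this
    simp [this]
  have hb0 : 0 ≤ b := (abs_nonneg _).trans (hb ℓ₀ hℓ₀)
  calc ‖∑ ℓ ∈ weights 𝒱, c ℓ • weightProj 𝒱 ℓ x‖
      ≤ ∑ ℓ ∈ weights 𝒱, b * (‖LinearMap.toContinuousLinearMap (weightProj 𝒱 ℓ)‖ * ‖x‖) := by
        refine norm_sum_le_of_le _ fun ℓ hℓ => ?_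
        rw [norm_smul, Real.norm_eq_abs]
        exact mul_le_mul (hb ℓ hℓ) (hK ℓ x) (norm_nonneg _) hb0
    _ = K * b * ‖x‖ := by rw [← Finset.mul_sum, ← Finset.sum_mul]; ring
    _ ≤ (1 + K) * b * ‖x‖ := by gcongr; linarith

/-- Polynomial bounds for large dilations and contraction bounds for small ones. -/
theorem exists_norm_dilation_le (h0 : 𝒱 0 = ⊥) : ∃ C : ℝ, 1 ≤ C ∧ ∃ s : ℕ, ∀ r : ℝ, 1 ≤ r →
    ∀ x : G, ‖dilation 𝒱 r x‖ ≤ C * r ^ s * ‖x‖ ∧ ‖dilation 𝒱 r⁻¹ x‖ ≤ C * r⁻¹ * ‖x‖ := by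
  obtain ⟨C, hC1, hC⟩ := exists_norm_weightProj_le 𝒱
  refine ⟨C, hC1, (weights 𝒱).sup id, fun r hr x => ⟨?_, ?_⟩⟩
  · rw [dilation_eq_sum]
    refine hC (fun ℓ => r ^ ℓ) _ (fun ℓ hℓ => ?_) x
    rw [abs_of_nonneg (by positivity)]
    exact pow_le_pow_right₀ hr (Finset.le_sup (f := id) hℓ)
  · rw [dilation_eq_sum]
    refine hC (fun ℓ => r⁻¹ ^ ℓ) _ (fun ℓ hℓ => ?_) x
    rw [abs_of_nonneg (by positivity)]
    -- Every weight is at least 1, so each component contracts at least as fast as r⁻¹.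
    refine pow_le_of_le_one (by positivity) (inv_le_one_of_one_le₀ hr) ?_
    rintro rfl
    exact (mem_weights 𝒱).1 hℓ h0

theorem dilation_zero (h0 : 𝒱 0 = ⊥) (x : G) : dilation 𝒱 0 x = 0 := by
  rw [dilation_eq_sum]
  refine Finset.sum_eq_zero fun ℓ hℓ => ?_
  have : ℓ ≠ 0 := by rintro rfl; exact (mem_weights 𝒱).1 hℓ h0
  simp [this]

/-- In a basis of homogeneous vectors the dilation is diagonal, with r^ℓ repeated dim 𝒱 ℓ times. -/
theorem det_dilation (r : ℝ) : LinearMap.det (dilation 𝒱 r) = r ^ homogeneousDim 𝒱 := by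
  classical
  let b := (DirectSum.Decomposition.isInternal 𝒱).collectedBasis
    (fun ℓ => Module.finBasis ℝ (𝒱 ℓ))
  have : Finite (Σ ℓ, Fin (Module.finrank ℝ (𝒱 ℓ))) := Module.Finite.finite_basis b
  let : Fintype (Σ ℓ, Fin (Module.finrank ℝ (𝒱 ℓ))) := Fintype.ofFinite _
  have hb (i) : b i ∈ 𝒱 i.1 := DirectSum.IsInternal.collectedBasis_mem _ _ i
  have hd : LinearMap.toMatrix b b (dilation 𝒱 r) = Matrix.diagonal fun i => r ^ i.1 := by
    ext i j
    rw [LinearMap.toMatrix_apply, dilation_of_mem 𝒱 r (hb j), map_smul, b.repr_self,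
      Matrix.diagonal_apply]
    rcases eq_or_ne i j with rfl | h
    · simp
    · simp [h]
  rw [← LinearMap.det_toMatrix b, hd, Matrix.det_diagonal, Finset.prod_pow_eq_pow_sum]
  congr 1
  rw [homogeneousDim, finsum_eq_sum_of_support_subset (s := weights 𝒱)]
  · have : (Finset.univ : Finset (Σ ℓ, Fin (Module.finrank ℝ (𝒱 ℓ)))) =
        (weights 𝒱).sigma fun _ => Finset.univ := by
      ext ⟨ℓ, i⟩
      simp only [Finset.mem_univ, Finset.mem_sigma, and_true, true_iff, mem_weights]
      intro h
      have h2 := i.2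
      have h3 : Module.finrank ℝ (𝒱 ℓ) = 0 := by rw [h, finrank_bot]
      omega
    rw [this, Finset.sum_sigma]
    simp [mul_comm]
  · intro ℓ hℓ
    simp only [Finset.mem_coe, mem_weights]
    intro h
    simp [h] at hℓ

end DilationBounds

/-! ### Haar measure is Lebesgue measure. -/

section Haar

variable {G : Type u} [NormedAddCommGroup G] [NormedSpace ℝ G] [FiniteDimensional ℝ G]
  (𝒱 : ℕ → Submodule ℝ G) [DirectSum.Decomposition 𝒱] [Group G] [LieGroup 𝓘(ℝ, G) ∞ G]

/-- The Jacobian is continuous in (x, y) and, dilations being linear automorphisms, unchanged under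
(x, y) ↦ (D_r x, D_r y). Letting r → 0⁺ it equals its value at (0, 0), where the translation is the
identity. -/
theorem det_fderiv_groupMul_left (hG : IsExponentialCoordinates G) (h𝒱 : IsLieGradation 𝒱)
    (x y : G) : (fderiv ℝ (fun a => x * a) y).det = 1 := by
  have hc : Continuous fun p : G × G => (fderiv ℝ (fun a => p.1 * a) p.2).det := by
    refine ContinuousLinearMap.continuous_det.comp ?_
    have h : ContDiff ℝ ∞ fun p : G × G => fderiv ℝ (fun a => p.1 * a) p.2 := by
      refine ContDiff.fderiv (f := fun (p : G × G) a => p.1 * a) (n := ∞) (m := ∞) ?_ contDiff_snd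
        (by simp)
      change ContDiff ℝ ∞ fun q : (G × G) × G => q.1.1 * q.2
      exact contDiff_groupMul.comp (contDiff_fst.fst.prodMk contDiff_snd)
    exact h.continuous
  have hinv (r : ℝ) (hr : 0 < r) :
      (fderiv ℝ (fun a => dilation 𝒱 r x * a) (dilation 𝒱 r y)).det =
        (fderiv ℝ (fun a => x * a) y).det := by
    let D := LinearMap.toContinuousLinearMap (dilation 𝒱 r)
    have h1 (x y : G) : HasFDerivAt (fun a => x * a) (fderiv ℝ (fun a => x * a) y) y :=
      ((contDiff_groupMul_left x).differentiable (by simp)).differentiableAt.hasFDerivAt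
    have e1 := D.hasFDerivAt.comp y (h1 x y)
    have e2 := (h1 (dilation 𝒱 r x) (dilation 𝒱 r y)).comp y (f := D) D.hasFDerivAt
    have e3 : (D ∘ fun a => x * a) = (fun a => dilation 𝒱 r x * a) ∘ D := by
      ext a; exact dilation_mul 𝒱 hG h𝒱 r x a
    rw [e3] at e1
    have h := congrArg ContinuousLinearMap.det (e1.unique e2)
    have hD : D.det ≠ 0 := by
      change LinearMap.det (dilation 𝒱 r) ≠ 0
      rw [det_dilation]; positivity
    simp only [ContinuousLinearMap.det, ContinuousLinearMap.toLinearMap_comp,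
      LinearMap.det_comp] at h hD ⊢
    rw [mul_comm] at h
    exact (mul_right_cancel₀ hD h).symm
  have hx (x : G) : Tendsto (fun r : ℝ => dilation 𝒱 r x) (𝓝[>] 0) (𝓝 0) := by
    have h2 := (continuous_dilation_left 𝒱 x).tendsto 0
    rw [dilation_zero 𝒱 h𝒱.zero_eq_bot] at h2
    exact h2.mono_left nhdsWithin_le_nhds
  have hl := (hc.tendsto (0, 0)).comp ((hx x).prodMk_nhds (hx y))
  have hl2 : Tendsto (fun _ : ℝ => (fderiv ℝ (fun a => x * a) y).det) (𝓝[>] 0) _ :=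
    hl.congr' (eventually_nhdsWithin_of_forall fun r hr => hinv r hr)
  have h3 := tendsto_nhds_unique tendsto_const_nhds hl2
  have h4 : (fun a : G => (0 : G) * a) = id := by ext; simp [← hG.one_eq_zero]
  rw [h3]
  simp only [h4, fderiv_id]
  simp [ContinuousLinearMap.det]

variable [MeasurableSpace G] [BorelSpace G]

include 𝒱 in
theorem isMulLeftInvariant_addHaar (hG : IsExponentialCoordinates G) (h𝒱 : IsLieGradation 𝒱)
    (lam : Measure G) [lam.IsAddHaarMeasure] : lam.IsMulLeftInvariant := by
  refine ⟨fun g => ?_⟩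
  have h := map_withDensity_abs_det_fderiv_eq_addHaar lam (s := Set.univ)
    (f := fun a : G => g * a) (f' := fun y => fderiv ℝ (fun a => g * a) y)
    MeasurableSet.univ.nullMeasurableSet
    (fun y _ => ((contDiff_groupMul_left g).differentiable
      (by simp)).differentiableAt.hasFDerivAt.hasFDerivWithinAt)
    (mul_right_injective g).injOn
  simpa [det_fderiv_groupMul_left 𝒱 hG h𝒱, Set.image_univ, (Group.mulLeft_bijective g).2.range_eq]
    using h

include 𝒱 in
-- Lebesgue measure is left invariant, so uniqueness of Haar measure makes `μ` a positive multiple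
-- of it. This gives access to linear changes of variables and to integrability of powers of 1 +
-- ‖z‖.
theorem isAddHaarMeasure_of_isHaarMeasure (hG : IsExponentialCoordinates G)
    (h𝒱 : IsLieGradation 𝒱) (μ : Measure G) [μ.IsHaarMeasure] : μ.IsAddHaarMeasure := by
  have : IsTopologicalGroup G := topologicalGroup_of_lieGroup 𝓘(ℝ, G) ∞
  have : ProperSpace G := FiniteDimensional.proper ℝ G
  let lam : Measure G := Measure.addHaar
  have h1 : lam.IsMulLeftInvariant := isMulLeftInvariant_addHaar 𝒱 hG h𝒱 lam
  have : lam.IsHaarMeasure := { }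
  rw [Measure.isMulLeftInvariant_eq_smul μ lam]
  exact Measure.IsAddHaarMeasure.nnreal_smul lam
    (Measure.haarScalarFactor_pos_of_isHaarMeasure μ lam).ne'

omit [Group G] [LieGroup 𝓘(ℝ, G) ∞ G] in
theorem map_dilation_addHaar (μ : Measure G) [μ.IsAddHaarMeasure] {r : ℝ} (hr : 0 < r) :
    μ.map (dilation 𝒱 r) = ENNReal.ofReal (r ^ homogeneousDim 𝒱)⁻¹ • μ := by
  have hd : LinearMap.det (dilation 𝒱 r) ≠ 0 := by rw [det_dilation]; positivity
  rw [Measure.map_linearMap_addHaar_eq_smul_addHaar μ hd, det_dilation, abs_of_pos (by positivity)]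

omit [Group G] [LieGroup 𝓘(ℝ, G) ∞ G] in
theorem integral_comp_dilation {E : Type*} [NormedAddCommGroup E] [NormedSpace ℝ E]
    (μ : Measure G) [μ.IsAddHaarMeasure] {r : ℝ} (hr : 0 < r) (f : G → E) :
    ∫ x, f (dilation 𝒱 r x) ∂μ = (r ^ homogeneousDim 𝒱)⁻¹ • ∫ x, f x ∂μ := by
  have h : MeasurableEmbedding (dilation 𝒱 r) :=
    (dilationEquiv 𝒱 hr.ne').toHomeomorph.measurableEmbedding
  rw [← h.integral_map, map_dilation_addHaar 𝒱 μ hr, integral_smul_measure,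
    ENNReal.toReal_ofReal (by positivity)]

end Haar

/-! ### Polynomial growth of the group law and its derivatives. -/

section Growth

variable {G : Type u} [NormedAddCommGroup G] [NormedSpace ℝ G] [FiniteDimensional ℝ G]
  (𝒱 : ℕ → Submodule ℝ G) [DirectSum.Decomposition 𝒱] [Group G] [LieGroup 𝓘(ℝ, G) ∞ G]

include 𝒱 in
-- With r = 1 + ‖p‖, the product is its own conjugate by D_r. The inner D_{1/r} brings `p` into a
-- fixed ball, where compactness bounds the derivatives, and the outer D_r costs only a power of r.
theorem exists_norm_iteratedFDeriv_groupMul_le (hG : IsExponentialCoordinates G)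
    (h𝒱 : IsLieGradation 𝒱) (n : ℕ) : ∃ C : ℝ, 1 ≤ C ∧ ∃ k : ℕ, ∀ p : G × G,
      ‖iteratedFDeriv ℝ n (fun p : G × G => p.1 * p.2) p‖ ≤ C * (1 + ‖p‖) ^ k := by
  obtain ⟨C, hC1, s, hC⟩ := exists_norm_dilation_le 𝒱 h𝒱.zero_eq_bot
  have : ProperSpace G := FiniteDimensional.proper ℝ G
  have hcomp : IsCompact (Metric.closedBall (0 : G × G) C) := isCompact_closedBall 0 C
  have hsm : ContDiff ℝ n fun p : G × G => p.1 * p.2 :=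
    contDiff_groupMul.of_le (by exact_mod_cast le_top)
  have hcont : Continuous fun p : G × G => iteratedFDeriv ℝ n (fun p : G × G => p.1 * p.2) p :=
    hsm.continuous_iteratedFDeriv'
  obtain ⟨K, hK⟩ := hcomp.exists_bound_of_continuousOn hcont.continuousOn
  have hK0 : 0 ≤ K := (norm_nonneg _).trans (hK 0 (by simp; linarith))
  refine ⟨1 + C * K * C ^ n, ?_, s, fun p => ?_⟩
  · have : 0 ≤ C * K * C ^ n := by positivity
    linarith
  set r := 1 + ‖p‖ with hr
  have hr1 : 1 ≤ r := by simp [hr]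
  have hr0 : r ≠ 0 := by linarith
  let D := LinearMap.toContinuousLinearMap (dilation 𝒱 r)
  let D₁ := LinearMap.toContinuousLinearMap (dilation 𝒱 r⁻¹)
  let D' : G × G →L[ℝ] G × G := D₁.prodMap D₁
  have hD : ‖D‖ ≤ C * r ^ s :=
    ContinuousLinearMap.opNorm_le_bound _ (by positivity) fun x => (hC r hr1 x).1
  have hD'p (q : G × G) : ‖D' q‖ ≤ C * r⁻¹ * ‖q‖ := by
    rw [Prod.norm_def]
    refine max_le ((hC r hr1 q.1).2.trans ?_) ((hC r hr1 q.2).2.trans ?_)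
    · gcongr; exact norm_fst_le q
    · gcongr; exact norm_snd_le q
  have hD' : ‖D'‖ ≤ C := by
    refine (ContinuousLinearMap.opNorm_le_bound _ (by positivity) hD'p).trans ?_
    exact mul_le_of_le_one_right (by linarith) (inv_le_one_of_one_le₀ hr1)
  have hD'p1 : ‖D' p‖ ≤ C := by
    refine (hD'p p).trans ?_
    rw [mul_assoc]
    refine mul_le_of_le_one_right (by linarith) ?_
    rw [inv_mul_le_iff₀ (by linarith)]
    linarith
  have hfun : (fun p : G × G => p.1 * p.2) = D ∘ ((fun p : G × G => p.1 * p.2) ∘ D') := by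
    ext q
    change _ = dilation 𝒱 r (dilation 𝒱 r⁻¹ q.1 * dilation 𝒱 r⁻¹ q.2)
    rw [dilation_mul 𝒱 hG h𝒱, dilation_dilation, dilation_dilation, mul_inv_cancel₀ hr0,
      dilation_one, dilation_one]
  rw [hfun, D.iteratedFDeriv_comp_left (hsm.comp D'.contDiff).contDiffAt le_rfl,
    D'.iteratedFDeriv_comp_right hsm p le_rfl]
  calc _ ≤ ‖D‖ * _ := ContinuousLinearMap.norm_compContinuousMultilinearMap_le _ _
    _ ≤ ‖D‖ * (_ * ∏ _ : Fin n, ‖D'‖) := by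
        gcongr
        exact ContinuousMultilinearMap.norm_compContinuousLinearMap_le _ _
    _ ≤ (C * r ^ s) * (K * C ^ n) := by
        rw [Finset.prod_const, Finset.card_univ, Fintype.card_fin]
        gcongr
        exact hK _ (by simpa using hD'p1)
    _ = (C * K * C ^ n) * r ^ s := by ring
    _ ≤ (1 + C * K * C ^ n) * r ^ s := by gcongr; linarith

include 𝒱 in
theorem exists_one_add_norm_mul_le (hG : IsExponentialCoordinates G) (h𝒱 : IsLieGradation 𝒱) :
    ∃ C : ℝ, 1 ≤ C ∧ ∃ k : ℕ, ∀ x y : G,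
      1 + ‖x * y‖ ≤ C * (1 + ‖x‖) ^ k * (1 + ‖y‖) ^ k := by
  obtain ⟨C, hC1, k, hC⟩ := exists_norm_iteratedFDeriv_groupMul_le 𝒱 hG h𝒱 0
  refine ⟨1 + C, by linarith, k, fun x y => ?_⟩
  have h := hC (x, y)
  rw [norm_iteratedFDeriv_zero] at h
  have h1 : 1 + ‖(x, y)‖ ≤ (1 + ‖x‖) * (1 + ‖y‖) := by
    have hx := norm_nonneg x
    have hy := norm_nonneg y
    rw [Prod.norm_mk]
    rcases max_cases ‖x‖ ‖y‖ with h | h <;> rw [h.1] <;> nlinarith [mul_nonneg hx hy]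
  have h2 : (1 + ‖(x, y)‖) ^ k ≤ (1 + ‖x‖) ^ k * (1 + ‖y‖) ^ k := by
    rw [← mul_pow]; gcongr
  have h3 : (1 : ℝ) ≤ (1 + ‖x‖) ^ k * (1 + ‖y‖) ^ k := by
    rw [← mul_pow]
    refine one_le_pow₀ (le_trans ?_ h1)
    simp
  calc 1 + ‖x * y‖ ≤ (1 + ‖x‖) ^ k * (1 + ‖y‖) ^ k + C * ((1 + ‖x‖) ^ k * (1 + ‖y‖) ^ k) := by
        gcongr
        exact h.trans (by gcongr)
    _ = _ := by ring

include 𝒱 in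
theorem exists_norm_iteratedFDeriv_inv_mul_le (hG : IsExponentialCoordinates G)
    (h𝒱 : IsLieGradation 𝒱) (n : ℕ) : ∃ C : ℝ, 1 ≤ C ∧ ∃ k : ℕ, ∀ i ≤ n, ∀ g y : G,
      ‖iteratedFDeriv ℝ i (fun y : G => y⁻¹ * g) y‖ ≤ C * ((1 + ‖y‖) * (1 + ‖g‖)) ^ k := by
  choose C hC1 k hC using exists_norm_iteratedFDeriv_groupMul_le 𝒱 hG h𝒱
  refine ⟨∑ i ∈ Finset.range (n + 1), C i, ?_, ∑ i ∈ Finset.range (n + 1), k i,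
    fun i hi g y => ?_⟩
  · exact (hC1 0).trans (Finset.single_le_sum (f := C) (fun i _ => by linarith [hC1 i])
      (Finset.mem_range.2 (Nat.succ_pos n)))
  have hi' : i ∈ Finset.range (n + 1) := Finset.mem_range.2 (by omega)
  have hsm : ContDiff ℝ i fun p : G × G => p.1 * p.2 :=
    contDiff_groupMul.of_le (by exact_mod_cast le_top)
  let L : G →L[ℝ] G × G := (-ContinuousLinearMap.id ℝ G).prod 0
  have hL : ‖L‖ ≤ 1 := ContinuousLinearMap.opNorm_le_bound _ zero_le_one fun x => by
    simp [L, Prod.norm_def]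
  have hfun : (fun y : G => y⁻¹ * g) = (fun p : G × G => (p + (0, g)).1 * (p + (0, g)).2) ∘ L := by
    ext y
    simp [L, hG.inv_eq_neg]
  have hsm' : ContDiff ℝ i fun p : G × G => (p + (0, g)).1 * (p + (0, g)).2 :=
    hsm.comp (contDiff_id.add contDiff_const)
  rw [hfun, L.iteratedFDeriv_comp_right hsm' y le_rfl,
    iteratedFDeriv_comp_add_right (f := fun p : G × G => p.1 * p.2)]
  have hnorm : 1 + ‖L y + (0, g)‖ ≤ (1 + ‖y‖) * (1 + ‖g‖) := by
    have hx := norm_nonneg y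
    have hy := norm_nonneg g
    have : L y + (0, g) = (-y, g) := by simp [L]
    rw [this, Prod.norm_mk, norm_neg]
    rcases max_cases ‖y‖ ‖g‖ with h | h <;> rw [h.1] <;> nlinarith [mul_nonneg hx hy]
  have h1 : 1 ≤ (1 + ‖y‖) * (1 + ‖g‖) := by
    refine le_trans ?_ hnorm
    simp
  calc _ ≤ ‖iteratedFDeriv ℝ i (fun p : G × G => p.1 * p.2) (L y + (0, g))‖ *
        ∏ _ : Fin i, ‖L‖ := ContinuousMultilinearMap.norm_compContinuousLinearMap_le _ _
    _ ≤ ‖iteratedFDeriv ℝ i (fun p : G × G => p.1 * p.2) (L y + (0, g))‖ := by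
        rw [Finset.prod_const]
        exact mul_le_of_le_one_right (norm_nonneg _) (pow_le_one₀ (norm_nonneg _) hL)
    _ ≤ C i * (1 + ‖L y + (0, g)‖) ^ k i := hC i _
    _ ≤ C i * ((1 + ‖y‖) * (1 + ‖g‖)) ^ k i := by
        gcongr
        linarith [hC1 i]
    _ ≤ _ := by
        gcongr
        · exact Finset.sum_nonneg fun i _ => by linarith [hC1 i]
        · exact Finset.single_le_sum (f := C) (fun i _ => by linarith [hC1 i]) hi'
        · exact Finset.single_le_sum (f := k) (fun i _ => Nat.zero_le _) hi'

include 𝒱 in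
/-- Rapid decay in `g` of the derivatives of `y ↦ f (y⁻¹ * g)` for `y` bounded and `f` rapidly
decreasing. -/
theorem exists_norm_iteratedFDeriv_comp_inv_mul_le (hG : IsExponentialCoordinates G)
    (h𝒱 : IsLieGradation 𝒱) (n m : ℕ) (R : ℝ) (hR : 0 ≤ R) :
    ∃ q : ℕ, ∃ C : ℝ, 0 ≤ C ∧ ∀ (f : G → ℂ) (A : ℝ), ContDiff ℝ ∞ f →
      (∀ i ≤ n, ∀ z, (1 + ‖z‖) ^ q * ‖iteratedFDeriv ℝ i f z‖ ≤ A) → ∀ g y : G, ‖y‖ ≤ R →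
      ∀ i ≤ n, (1 + ‖g‖) ^ m * ‖iteratedFDeriv ℝ i (fun y : G => f (y⁻¹ * g)) y‖ ≤ C * A := by
  obtain ⟨C, hC1, k, hC⟩ := exists_norm_iteratedFDeriv_inv_mul_le 𝒱 hG h𝒱 n
  obtain ⟨K, hK1, l, hK⟩ := exists_one_add_norm_mul_le 𝒱 hG h𝒱
  -- The chain rule costs (1 + ‖g‖)^{kn} and the weight costs (1 + ‖g‖)^m; since 1 + ‖g‖ is bounded
  -- by a constant times (1 + ‖y⁻¹g‖)^l, decay of `f` to the order l(m + kn) pays for both.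
  refine ⟨l * (m + k * n), n.factorial * (C * (1 + R) ^ k) ^ n * (K * (1 + R) ^ l) ^ (m + k * n),
    by positivity, fun f A hf hA g y hy i hi => ?_⟩
  set z := y⁻¹ * g with hz
  have hsm : ContDiff ℝ ∞ fun y : G => y⁻¹ * g := by
    simp only [hG.inv_eq_neg]
    exact contDiff_groupMul.comp (contDiff_neg.prodMk contDiff_const)
  have hD1 : 1 ≤ C * ((1 + R) * (1 + ‖g‖)) ^ k := by
    refine one_le_mul_of_one_le_of_one_le hC1 (one_le_pow₀ ?_)
    exact one_le_mul_of_one_le_of_one_le (by linarith) (by simp)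
  have hA0 : 0 ≤ A := le_trans (by positivity) (hA 0 (Nat.zero_le _) 0)
  have key := norm_iteratedFDeriv_comp_le (n := i) (N := ∞) (g := f) (f := fun y : G => y⁻¹ * g)
    hf hsm (by exact_mod_cast le_top) y (C := A / (1 + ‖z‖) ^ (l * (m + k * n)))
    (D := C * ((1 + R) * (1 + ‖g‖)) ^ k)
    (fun j hj => by
      rw [le_div_iff₀' (by positivity)]
      exact hA j (hj.trans hi) _)
    (fun j hj1 hj => by
      refine (hC j (hj.trans hi) g y).trans ?_
      refine le_trans ?_ (le_self_pow₀ hD1 (by omega))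
      gcongr)
  have hfun : (fun y : G => f (y⁻¹ * g)) = f ∘ fun y : G => y⁻¹ * g := rfl
  rw [hfun]
  have hg : 1 + ‖g‖ ≤ (K * (1 + R) ^ l) * (1 + ‖z‖) ^ l := by
    have h := hK y z
    rw [hz, mul_inv_cancel_left, ← hz] at h
    exact h.trans (by gcongr)
  have hfac : ((i.factorial : ℕ) : ℝ) ≤ n.factorial := by exact_mod_cast Nat.factorial_le hi
  calc _ ≤ (1 + ‖g‖) ^ m * (n.factorial * (A / (1 + ‖z‖) ^ (l * (m + k * n))) *
        (C * ((1 + R) * (1 + ‖g‖)) ^ k) ^ n) := by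
        gcongr
        refine key.trans ?_
        gcongr
    _ = n.factorial * (C * (1 + R) ^ k) ^ n * (A / (1 + ‖z‖) ^ (l * (m + k * n))) *
        (1 + ‖g‖) ^ (m + k * n) := by
        rw [pow_add, pow_mul, mul_pow (1 + R), ← mul_assoc, mul_pow _ _ n]; ring
    _ ≤ n.factorial * (C * (1 + R) ^ k) ^ n * (A / (1 + ‖z‖) ^ (l * (m + k * n))) *
        ((K * (1 + R) ^ l) * (1 + ‖z‖) ^ l) ^ (m + k * n) := by gcongr
    _ = n.factorial * (C * (1 + R) ^ k) ^ n * (K * (1 + R) ^ l) ^ (m + k * n) * A := by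
        rw [mul_pow _ _ (m + k * n), ← pow_mul]
        field_simp

end Growth

/-! ### Lattice points: counting and separation. -/

section Lattice

variable {G : Type u} [NormedAddCommGroup G] [NormedSpace ℝ G] [FiniteDimensional ℝ G]
  (𝒱 : ℕ → Submodule ℝ G) [DirectSum.Decomposition 𝒱] [Group G] [LieGroup 𝓘(ℝ, G) ∞ G]
  (Γ : Subgroup G) [DiscreteTopology Γ]

/-- Choose V with V V⁻¹ inside a neighbourhood of 1 that meets `Γ` only at 1. -/
theorem exists_isOpen_pairwise_disjoint_translates {G : Type*} [TopologicalSpace G] [Group G]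
    [IsTopologicalGroup G] (Γ : Subgroup G) [DiscreteTopology Γ] :
    ∃ V : Set G, IsOpen V ∧ (1 : G) ∈ V ∧ ∀ v ∈ V, ∀ w ∈ V, ∀ γ : Γ, (γ : G) * v = w → γ = 1 := by
  obtain ⟨U, hU, hUΓ⟩ : ∃ U : Set G, IsOpen U ∧ (Subtype.val ⁻¹' U : Set Γ) = {1} :=
    isOpen_induced_iff.1 (isOpen_discrete ({1} : Set Γ))
  have h1U : U ∈ 𝓝 (1 : G) := hU.mem_nhds (by
    have : (1 : Γ) ∈ (Subtype.val ⁻¹' U : Set Γ) := by rw [hUΓ]; rfl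
    exact this)
  obtain ⟨V, hV, hVU⟩ := exists_nhds_split_inv h1U
  refine ⟨interior V, isOpen_interior, mem_interior_iff_mem_nhds.2 hV, fun v hv w hw γ h => ?_⟩
  have h2 : w / v ∈ U := hVU w (interior_subset hw) v (interior_subset hv)
  have h3 : γ ∈ (Subtype.val ⁻¹' U : Set Γ) := by
    change (γ : G) ∈ U
    rwa [← h, mul_div_cancel_right] at h2
  rwa [hUΓ] at h3

include 𝒱 in
-- Volume counting: the translates γV of a small open set are disjoint and of equal volume, and on
-- γV the integrable function (1 + ‖y‖)^{-d} is at least a multiple of (1 + ‖γ‖)^{-kd}.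
theorem exists_summable_lattice [MeasurableSpace G] [BorelSpace G]
    (hG : IsExponentialCoordinates G) (h𝒱 : IsLieGradation 𝒱) :
    ∃ m : ℕ, Summable fun γ : Γ => ((1 + ‖(γ : G)‖) ^ m)⁻¹ := by
  have : IsTopologicalGroup G := topologicalGroup_of_lieGroup 𝓘(ℝ, G) ∞
  have : ProperSpace G := FiniteDimensional.proper ℝ G
  let lam : Measure G := Measure.addHaar
  have : lam.IsMulLeftInvariant := isMulLeftInvariant_addHaar 𝒱 hG h𝒱 lam
  obtain ⟨V₀, hV₀, h1V₀, hV₀Γ⟩ := exists_isOpen_pairwise_disjoint_translates Γ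
  obtain ⟨C, hC1, k, hC⟩ := exists_one_add_norm_mul_le 𝒱 hG h𝒱
  set V := V₀ ∩ Metric.ball 0 1 with hV
  have hVo : IsOpen V := hV₀.inter Metric.isOpen_ball
  have hVne : V.Nonempty := ⟨1, h1V₀, by simp [hG.one_eq_zero]⟩
  have hVpos : 0 < lam.real V := by
    refine ENNReal.toReal_pos (hVo.measure_pos lam hVne).ne' ?_
    exact ((measure_mono Set.inter_subset_right).trans_lt measure_ball_lt_top).ne
  set d := Module.finrank ℝ G + 1 with hd
  set h : G → ℝ := fun y => (1 + ‖y‖) ^ (-(d : ℝ)) with hh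
  have hint : Integrable h lam := integrable_one_add_norm (by simp [hd])
  have hpos (y : G) : 0 ≤ h y := Real.rpow_nonneg (by positivity) _
  set K := C * 2 ^ k with hK
  have hK0 : 0 < K := by positivity
  have hmeas (γ : Γ) : MeasurableSet ((fun v => (γ : G) * v) '' V) :=
    ((isOpenMap_mul_left (γ : G)) V hVo).measurableSet
  have hvol (γ : Γ) : lam.real ((fun v => (γ : G) * v) '' V) = lam.real V := by
    rw [measureReal_def, Set.image_mul_left, measure_preimage_mul, measureReal_def]
  have hlow (γ : Γ) : lam.real V * (K ^ d)⁻¹ * ((1 + ‖(γ : G)‖) ^ (k * d))⁻¹ ≤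
      ∫ y in (fun v => (γ : G) * v) '' V, h y ∂lam := by
    have hfin : lam ((fun v => (γ : G) * v) '' V) ≠ ⊤ := by
      rw [Set.image_mul_left, measure_preimage_mul]
      exact ((measure_mono Set.inter_subset_right).trans_lt measure_ball_lt_top).ne
    have := setIntegral_mono_on (μ := lam)
      (f := fun _ => (K ^ d)⁻¹ * ((1 + ‖(γ : G)‖) ^ (k * d))⁻¹) (g := h)
      (integrableOn_const hfin) hint.integrableOn (hmeas γ) (by
        rintro _ ⟨v, hv, rfl⟩
        have hv1 : ‖v‖ ≤ 1 := by simpa using (Metric.mem_ball.1 hv.2).le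
        have h1 : 1 + ‖(γ : G) * v‖ ≤ K * (1 + ‖(γ : G)‖) ^ k := by
          refine (hC γ v).trans ?_
          have : (1 + ‖v‖) ^ k ≤ 2 ^ k := by gcongr; linarith
          calc _ ≤ C * (1 + ‖(γ : G)‖) ^ k * 2 ^ k := by gcongr
            _ = _ := by rw [hK]; ring
        rw [hh]
        simp only
        rw [Real.rpow_neg (by positivity), Real.rpow_natCast, ← mul_inv, pow_mul, ← mul_pow]
        gcongr)
    rwa [setIntegral_const, hvol, smul_eq_mul, ← mul_assoc] at this
  refine ⟨k * d, ?_⟩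
  have hc : 0 < lam.real V * (K ^ d)⁻¹ := by positivity
  have : Summable fun γ : Γ => lam.real V * (K ^ d)⁻¹ * ((1 + ‖(γ : G)‖) ^ (k * d))⁻¹ := by
    refine summable_of_sum_le (c := ∫ y, h y ∂lam) (fun γ => by positivity) fun s => ?_
    calc _ ≤ ∑ γ ∈ s, ∫ y in (fun v => (γ : G) * v) '' V, h y ∂lam :=
          Finset.sum_le_sum fun γ _ => hlow γ
      _ = ∫ y in ⋃ γ ∈ s, (fun v => (γ : G) * v) '' V, h y ∂lam := by
          rw [integral_biUnion_finset _ (fun γ _ => hmeas γ) ?_ (fun γ _ => hint.integrableOn)]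
          intro γ _ γ' _ hne
          rw [Function.onFun, Set.disjoint_left]
          rintro _ ⟨v, hv, rfl⟩ ⟨w, hw, hvw⟩
          refine hne ?_
          have := hV₀Γ v hv.1 w hw.1 (γ'⁻¹ * γ) (by
            simp only [Subgroup.coe_mul, Subgroup.coe_inv, mul_assoc]
            rw [← show (γ' : G) * w = γ * v from hvw, inv_mul_cancel_left])
          exact (inv_mul_eq_one.1 this).symm
      _ ≤ ∫ y, h y ∂lam := setIntegral_le_integral hint (Eventually.of_forall hpos)
  exact (summable_mul_left_iff hc.ne').1 this

omit [FiniteDimensional ℝ G] in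
-- The map (x, y) ↦ x y x⁻¹ sends B × {0} to the identity, which is isolated in `Γ`. By the tube
-- lemma some ball around 0, conjugated by points of `B`, meets `Γ` only at 1.
theorem exists_le_norm_conj (hG : IsExponentialCoordinates G) {B : Set G} (hB : IsCompact B) :
    ∃ δ : ℝ, 0 < δ ∧ ∀ x ∈ B, ∀ γ : Γ, γ ≠ 1 → δ ≤ ‖x⁻¹ * (γ : G) * x‖ := by
  have : IsTopologicalGroup G := topologicalGroup_of_lieGroup 𝓘(ℝ, G) ∞
  obtain ⟨U, hU, hUΓ⟩ : ∃ U : Set G, IsOpen U ∧ (Subtype.val ⁻¹' U : Set Γ) = {1} :=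
    isOpen_induced_iff.1 (isOpen_discrete ({1} : Set Γ))
  have h1U : (1 : G) ∈ U := by
    have : (1 : Γ) ∈ (Subtype.val ⁻¹' U : Set Γ) := by rw [hUΓ]; rfl
    exact this
  have hc : Continuous fun p : G × G => p.1 * p.2 * p.1⁻¹ := by fun_prop
  have hN : IsOpen ((fun p : G × G => p.1 * p.2 * p.1⁻¹) ⁻¹' U) := hU.preimage hc
  obtain ⟨u, v, _, hv, hBu, h0v, huv⟩ := generalized_tube_lemma hB
    (isCompact_singleton (x := (0 : G))) hN (by
      rintro ⟨x, y⟩ ⟨_, hy⟩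
      obtain rfl : y = 0 := hy
      simp [← hG.one_eq_zero, h1U])
  obtain ⟨δ, hδ, hball⟩ := Metric.isOpen_iff.1 hv 0 (h0v rfl)
  refine ⟨δ, hδ, fun x hx γ hγ => ?_⟩
  by_contra! hlt
  have h1 : x⁻¹ * (γ : G) * x ∈ v := hball (by simpa using hlt)
  have h2 := huv (Set.mk_mem_prod (hBu hx) h1)
  have h3 : γ ∈ (Subtype.val ⁻¹' U : Set Γ) := by
    change (γ : G) ∈ U
    simpa [mul_assoc] using h2
  rw [hUΓ] at h3
  exact hγ h3

include 𝒱 in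
theorem exists_one_add_norm_lattice_le (hG : IsExponentialCoordinates G) (h𝒱 : IsLieGradation 𝒱)
    (R : ℝ) (hR : 0 ≤ R) : ∃ C : ℝ, 1 ≤ C ∧ ∃ k : ℕ, ∀ x y g : G, ‖x‖ ≤ R → ‖y‖ ≤ R →
      1 + ‖g‖ ≤ C * (1 + ‖y⁻¹ * (g * x)‖) ^ k := by
  obtain ⟨C, hC1, k, hC⟩ := exists_one_add_norm_mul_le 𝒱 hG h𝒱
  refine ⟨C * (C * (1 + R) ^ k) ^ k * (1 + R) ^ k, ?_, k * k, fun x y g hx hy => ?_⟩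
  · have h1 : 1 ≤ (1 + R) ^ k := one_le_pow₀ (by linarith)
    exact one_le_mul_of_one_le_of_one_le (one_le_mul_of_one_le_of_one_le hC1
      (one_le_pow₀ (one_le_mul_of_one_le_of_one_le hC1 h1))) h1
  set z := y⁻¹ * (g * x) with hz
  have hg : y * z * x⁻¹ = g := by rw [hz]; group
  have h1 := hC (y * z) x⁻¹
  have h2 := hC y z
  rw [hg, hG.inv_eq_neg, norm_neg] at h1
  calc 1 + ‖g‖ ≤ C * (C * (1 + R) ^ k * (1 + ‖z‖) ^ k) ^ k * (1 + R) ^ k := by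
        refine h1.trans ?_
        gcongr
        refine h2.trans ?_
        gcongr
    _ = _ := by rw [mul_pow _ ((1 + ‖z‖) ^ k), ← pow_mul]; ring

include 𝒱 in
/-- The dilated conjugates of the nontrivial lattice points are far away. -/
theorem exists_pow_norm_lattice_le (hG : IsExponentialCoordinates G) (h𝒱 : IsLieGradation 𝒱)
    (R : ℝ) (hR : 0 ≤ R) (N m : ℕ) : ∃ C : ℝ, 0 ≤ C ∧ ∃ q : ℕ, ∀ ε ∈ Set.Ioc (0 : ℝ) 1,
      ∀ x : G, ‖x‖ ≤ R → ∀ γ : Γ, γ ≠ 1 →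
        (1 + ‖(γ : G)‖) ^ m ≤ C * ε ^ N * (1 + ‖dilation 𝒱 ε⁻¹ (x⁻¹ * (γ * x))‖) ^ q := by
  have : ProperSpace G := FiniteDimensional.proper ℝ G
  obtain ⟨δ, hδ, hδΓ⟩ := exists_le_norm_conj Γ hG (isCompact_closedBall (0 : G) R)
  obtain ⟨C, hC1, k, hC⟩ := exists_one_add_norm_lattice_le 𝒱 hG h𝒱 R hR
  obtain ⟨K, hK1, _, hK⟩ := exists_norm_dilation_le 𝒱 h𝒱.zero_eq_bot
  -- The power km controls (1 + ‖γ‖)^m, and the additional N factors each contribute one ε.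
  refine ⟨C ^ m * ((1 + δ⁻¹) * K) ^ (k * m + N), by positivity, k * m + N,
    fun ε hε x hx γ hγ => ?_⟩
  have hε0 : 0 < ε := hε.1
  set v := x⁻¹ * (γ * x) with hv
  have hv1 : δ ≤ ‖v‖ := by
    have := hδΓ x (by simpa using hx) γ hγ
    rwa [mul_assoc] at this
  have hv2 : ‖v‖ ≤ K * ε * ‖dilation 𝒱 ε⁻¹ v‖ := by
    have := (hK ε⁻¹ (one_le_inv₀ hε0 |>.2 hε.2) (dilation 𝒱 ε⁻¹ v)).2
    rwa [dilation_dilation, inv_inv, mul_inv_cancel₀ hε0.ne', dilation_one] at this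
  set w := dilation 𝒱 ε⁻¹ v with hw
  -- The lower bound δ absorbs the 1 into ‖v‖; what remains is multiplied by ε because v = D_ε w.
  have h1 : 1 + ‖v‖ ≤ (1 + δ⁻¹) * K * ε * (1 + ‖w‖) := by
    have h2 : 1 ≤ δ⁻¹ * ‖v‖ := by rwa [inv_mul_eq_div, one_le_div hδ]
    calc 1 + ‖v‖ ≤ (1 + δ⁻¹) * ‖v‖ := by linarith
      _ ≤ (1 + δ⁻¹) * (K * ε * (1 + ‖w‖)) := by
          gcongr
          refine hv2.trans ?_
          gcongr
          linarith
      _ = _ := by ring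
  calc (1 + ‖(γ : G)‖) ^ m ≤ (C * (1 + ‖v‖) ^ k) ^ m := by
        gcongr
        exact hC x x γ hx hx
    _ = C ^ m * (1 + ‖v‖) ^ (k * m) := by rw [mul_pow, pow_mul]
    _ ≤ C ^ m * (1 + ‖v‖) ^ (k * m + N) := by
        gcongr
        · linarith [norm_nonneg v]
        · omega
    _ ≤ C ^ m * ((1 + δ⁻¹) * K * ε * (1 + ‖w‖)) ^ (k * m + N) := by gcongr
    _ = C ^ m * ((1 + δ⁻¹) * K) ^ (k * m + N) * ε ^ (k * m + N) * (1 + ‖w‖) ^ (k * m + N) := by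
        rw [mul_pow _ (1 + ‖w‖), mul_pow _ ε]; ring
    _ ≤ _ := by
        gcongr ?_ * ?_ * ?_
        exact pow_le_pow_of_le_one hε0.le hε.2 (by omega)

end Lattice

/-! ### Topology and Borel structure of the quotient. -/

section Quotient

variable {G : Type u} [Group G] (Γ : Subgroup G)

theorem NilManifold.mk_out (p : NilManifold Γ) : NilManifold.mk Γ (Quotient.out p) = p :=
  Quotient.out_eq p

theorem NilManifold.mk_eq_mk_iff {x y : G} :
    NilManifold.mk Γ x = NilManifold.mk Γ y ↔ ∃ γ : Γ, y = (γ : G) * x :=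
  ⟨fun h => NilManifold.rel_exists (Quotient.exact h), by
    rintro ⟨γ, rfl⟩; exact (NilManifold.mk_mul Γ γ x).symm⟩

theorem periodization_section (F : G → ℝ≥0∞) {s : NilManifold Γ → G}
    (hsec : ∀ p, NilManifold.mk Γ (s p) = p) (p : NilManifold Γ) :
    periodization Γ F p = ∑' γ : Γ, F (γ * s p) := by
  conv_lhs => rw [← hsec p]
  rfl

theorem Subgroup.countable_of_discreteTopology [TopologicalSpace G]
    [SecondCountableTopology G] [DiscreteTopology Γ] :
    Countable Γ := by
  have : SecondCountableTopology Γ := TopologicalSpace.Subtype.secondCountableTopology _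
  exact TopologicalSpace.separableSpace_iff_countable.1 inferInstance


variable [TopologicalSpace G] [IsTopologicalGroup G]

theorem NilManifold.isOpenQuotientMap_mk : IsOpenQuotientMap (NilManifold.mk Γ) :=
  MulAction.isOpenQuotientMap_quotientMk (Γ := Γ) (T := G)

theorem NilManifold.continuous_mk : Continuous (NilManifold.mk Γ) :=
  (NilManifold.isOpenQuotientMap_mk Γ).continuous

theorem NilManifold.secondCountableTopology [SecondCountableTopology G] :
    SecondCountableTopology (NilManifold Γ) :=
  (NilManifold.isOpenQuotientMap_mk Γ).isQuotientMap.secondCountableTopology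
    (NilManifold.isOpenQuotientMap_mk Γ).isOpenMap

theorem NilManifold.t2Space [T2Space G] [LocallyCompactSpace G] [DiscreteTopology Γ] :
    T2Space (NilManifold Γ) := by
  have h : Tendsto Γ.subtype cofinite (cocompact G) :=
    Subgroup.tendsto_coe_cofinite_of_discrete Γ ⟨inferInstance⟩
  have : ProperlyDiscontinuousSMul Γ G := Γ.properlyDiscontinuousSMul_of_tendsto_cofinite h
  exact t2Space_of_properlyDiscontinuousSMul_of_t2Space (Γ := Γ) (T := G)

/-- `M` carries the quotient σ-algebra. It is the Borel one because `G` is Polish and `M` is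
Hausdorff and second countable, which makes continuous functions on `M` measurable. -/
theorem NilManifold.borelSpace [PolishSpace G] [LocallyCompactSpace G] [MeasurableSpace G]
    [BorelSpace G] [DiscreteTopology Γ] : BorelSpace (NilManifold Γ) := by
  have := NilManifold.t2Space Γ
  have := NilManifold.secondCountableTopology Γ
  exact Quotient.borelSpace

end Quotient

/-! ### A bounded measurable section and the unfolding of integrals. -/

section Measure

variable {G : Type u} [NormedAddCommGroup G] [NormedSpace ℝ G] [FiniteDimensional ℝ G]
  [MeasurableSpace G] [BorelSpace G] [Group G] [IsTopologicalGroup G]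
  (Γ : Subgroup G) [DiscreteTopology Γ] [CompactSpace (NilManifold Γ)]

/-- A bounded measurable section of the projection `G → Γ \ G`. -/
theorem NilManifold.exists_measurable_section : ∃ s : NilManifold Γ → G, Measurable s ∧
    (∀ p, NilManifold.mk Γ (s p) = p) ∧ ∃ R : ℝ, 0 ≤ R ∧ ∀ p, ‖s p‖ ≤ R := by
  classical
  have : ProperSpace G := FiniteDimensional.proper ℝ G
  have : CompleteSpace G := FiniteDimensional.complete ℝ G
  have : SecondCountableTopology G := secondCountable_of_proper
  have := NilManifold.t2Space Γ
  have := NilManifold.secondCountableTopology Γ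
  have : BorelSpace (NilManifold Γ) := NilManifold.borelSpace Γ
  have hop := NilManifold.isOpenQuotientMap_mk Γ
  have key : ∃ S : Set (NilManifold Γ), Set.univ ⊆ S ∧ MeasurableSet S ∧
      ∃ s : NilManifold Γ → G, Measurable s ∧ (∀ p ∈ S, NilManifold.mk Γ (s p) = p) ∧
        ∃ R : ℝ, ∀ p ∈ S, ‖s p‖ ≤ R := by
    -- Having a bounded measurable section over a measurable superset passes to subsets and finite
    -- unions, so by compactness it is enough to have it near each point.
    refine isCompact_univ.induction_on (p := fun T : Set (NilManifold Γ) => ∃ S, T ⊆ S ∧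
      MeasurableSet S ∧ ∃ s : NilManifold Γ → G, Measurable s ∧
        (∀ p ∈ S, NilManifold.mk Γ (s p) = p) ∧ ∃ R : ℝ, ∀ p ∈ S, ‖s p‖ ≤ R) ?_ ?_ ?_ ?_
    · exact ⟨∅, subset_rfl, MeasurableSet.empty, fun _ => 0, measurable_const, by simp, 0, by simp⟩
    · rintro T T' hT ⟨S, hTS, h⟩
      exact ⟨S, hT.trans hTS, h⟩
    · rintro T T' ⟨S, hTS, hS, s, hs, hsec, R, hR⟩ ⟨S', hTS', hS', s', hs', hsec', R', hR'⟩
      refine ⟨S ∪ S', Set.union_subset_union hTS hTS', hS.union hS', S.piecewise s s',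
        hs.piecewise hS hs', fun p hp => ?_, max R R', fun p hp => ?_⟩
      all_goals by_cases hpS : p ∈ S
      · simp [hpS, hsec p hpS]
      · simp [hpS, hsec' p (hp.resolve_left hpS)]
      · simp [hpS, hR p hpS]
      · simp [hpS, hR' p (hp.resolve_left hpS)]
    · intro p _
      obtain ⟨x, rfl⟩ := hop.surjective p
      obtain ⟨V, hV, h1V, hVΓ⟩ := exists_isOpen_pairwise_disjoint_translates Γ
      set U : Set G := ((fun y => y * x⁻¹) ⁻¹' V) ∩ Metric.ball x 1 with hU
      have hUo : IsOpen U := (hV.preimage (continuous_mul_const _)).inter Metric.isOpen_ball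
      have hxU : x ∈ U := ⟨by simpa using h1V, Metric.mem_ball_self one_pos⟩
      have hinj : Set.InjOn (NilManifold.mk Γ) U := by
        intro y hy z hz h
        obtain ⟨γ, rfl⟩ := (NilManifold.mk_eq_mk_iff Γ).1 h
        have := hVΓ _ hy.1 _ hz.1 γ (by simp [mul_assoc])
        simp [this]
      -- The projection is continuous and injective on the open set `U`, hence a measurable
      -- embedding (Lusin–Souslin); its inverse is extended measurably to give the local section.
      have hemb := (NilManifold.continuous_mk Γ).continuousOn.measurableEmbedding
        hUo.measurableSet hinj
      obtain ⟨g, hg, hgU⟩ := hemb.exists_measurable_extend measurable_subtype_coe (fun _ => ⟨0⟩)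
      have hgU' (y : G) (hy : y ∈ U) : g (NilManifold.mk Γ y) = y := congrFun hgU ⟨y, hy⟩
      refine ⟨NilManifold.mk Γ '' U, nhdsWithin_le_nhds (hop.isOpenMap.image_mem_nhds
        (hUo.mem_nhds hxU)), _, subset_rfl, (hop.isOpenMap U hUo).measurableSet, g, hg, ?_,
        ‖x‖ + 1, ?_⟩
      · rintro _ ⟨y, hy, rfl⟩
        rw [hgU' y hy]
      · rintro _ ⟨y, hy, rfl⟩
        rw [hgU' y hy]
        have := hy.2
        rw [Metric.mem_ball, dist_eq_norm] at this
        calc ‖y‖ = ‖x + (y - x)‖ := by congr 1; abel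
          _ ≤ ‖x‖ + ‖y - x‖ := norm_add_le _ _
          _ ≤ ‖x‖ + 1 := by linarith
  obtain ⟨S, hS, -, s, hs, hsec, R, hR⟩ := key
  exact ⟨s, hs, fun p => hsec p (hS trivial), max R 0, le_max_right _ _,
    fun p => (hR p (hS trivial)).trans (le_max_left _ _)⟩

variable {Γ} {μ : Measure G} {ν : Measure (NilManifold Γ)}

omit [CompactSpace (NilManifold Γ)] in
-- The defining identity of `ν` applied to indicator functions. It extends unfolding from
-- nonnegative functions to integrable vector-valued ones through the integration theory of sums of
-- measures.
theorem IsQuotientMeasure.eq_sum_map (hν : IsQuotientMeasure Γ μ ν) {s : NilManifold Γ → G}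
    (hs : Measurable s) (hsec : ∀ p, NilManifold.mk Γ (s p) = p) :
    μ = Measure.sum fun γ : Γ => ν.map fun p => (γ : G) * s p := by
  have : ProperSpace G := FiniteDimensional.proper ℝ G
  have : SecondCountableTopology G := secondCountable_of_proper
  have : Countable Γ := Subgroup.countable_of_discreteTopology Γ
  ext A hA
  have hm (γ : Γ) : Measurable fun p => (γ : G) * s p := hs.const_mul _
  rw [Measure.sum_apply _ hA, ← lintegral_indicator_one hA, hν _ (measurable_one.indicator hA)]
  simp only [periodization_section _ _ hsec]
  rw [lintegral_tsum (f := fun (γ : Γ) p => A.indicator 1 ((γ : G) * s p))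
    fun γ => ((measurable_one.indicator hA).comp (hm γ)).aemeasurable]
  refine tsum_congr fun γ => ?_
  rw [Measure.map_apply (hm γ) hA, ← lintegral_indicator_one (hm γ hA)]
  rfl

/-- The summand γ = 1 of `μ` is a copy of `ν` carried by a closed ball, which has finite
`μ`-measure. -/
theorem IsQuotientMeasure.isFiniteMeasure [IsFiniteMeasureOnCompacts μ]
    (hν : IsQuotientMeasure Γ μ ν) : IsFiniteMeasure ν := by
  have : ProperSpace G := FiniteDimensional.proper ℝ G
  obtain ⟨s, hs, hsec, R, hR, hsR⟩ := NilManifold.exists_measurable_section Γ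
  refine ⟨?_⟩
  have h := hν.eq_sum_map hs hsec
  have hm : Measurable fun p => ((1 : Γ) : G) * s p := by simpa using hs
  calc ν Set.univ = ν.map (fun p => ((1 : Γ) : G) * s p) (Metric.closedBall 0 R) := by
        rw [Measure.map_apply hm measurableSet_closedBall]
        congr 1
        ext p
        simp [hsR p]
    _ ≤ μ (Metric.closedBall 0 R) := by
        conv_rhs => rw [h]
        exact Measure.le_sum (fun γ : Γ => ν.map fun p => (γ : G) * s p) 1 _
    _ < ⊤ := measure_closedBall_lt_top

variable {E : Type*} [NormedAddCommGroup E]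

omit [CompactSpace (NilManifold Γ)] in
theorem IsQuotientMeasure.integrable_iff (hν : IsQuotientMeasure Γ μ ν) {s : NilManifold Γ → G}
    (hs : Measurable s) (hsec : ∀ p, NilManifold.mk Γ (s p) = p) {F : G → E}
    (hF : ∀ γ : Γ, AEStronglyMeasurable F (ν.map fun p => (γ : G) * s p)) :
    Integrable F μ ↔ (∀ γ : Γ, Integrable (fun p => F (γ * s p)) ν) ∧
      Summable fun γ : Γ => ∫ p, ‖F (γ * s p)‖ ∂ν := by
  have : ProperSpace G := FiniteDimensional.proper ℝ G
  have : SecondCountableTopology G := secondCountable_of_proper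
  have : Countable Γ := Subgroup.countable_of_discreteTopology Γ
  have hm (γ : Γ) : Measurable fun p => (γ : G) * s p := hs.const_mul _
  conv_lhs => rw [hν.eq_sum_map hs hsec]
  rw [integrable_sum_measure_iff]
  refine and_congr (forall_congr' fun γ => integrable_map_measure (hF γ) (hm γ).aemeasurable) ?_
  refine iff_of_eq (congrArg Summable (funext fun γ => ?_))
  exact integral_map (hm γ).aemeasurable (hF γ).norm

omit [CompactSpace (NilManifold Γ)] in
theorem IsQuotientMeasure.integral_eq [NormedSpace ℝ E] (hν : IsQuotientMeasure Γ μ ν)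
    {s : NilManifold Γ → G} (hs : Measurable s) (hsec : ∀ p, NilManifold.mk Γ (s p) = p)
    {F : G → E} (hF : Integrable F μ) : ∫ x, F x ∂μ = ∫ p, ∑' γ : Γ, F (γ * s p) ∂ν := by
  have : ProperSpace G := FiniteDimensional.proper ℝ G
  have : SecondCountableTopology G := secondCountable_of_proper
  have : Countable Γ := Subgroup.countable_of_discreteTopology Γ
  have hm (γ : Γ) : Measurable fun p => (γ : G) * s p := hs.const_mul _
  have hF' := hF
  rw [hν.eq_sum_map hs hsec] at hF'
  have hae (γ : Γ) : AEStronglyMeasurable F (ν.map fun p => (γ : G) * s p) :=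
    hF'.aestronglyMeasurable.mono_measure (Measure.le_sum _ γ)
  obtain ⟨h1, h2⟩ := (hν.integrable_iff hs hsec hae).1 hF
  rw [← integral_tsum_of_summable_integral_norm h1 h2]
  conv_lhs => rw [hν.eq_sum_map hs hsec]
  rw [integral_sum_measure hF']
  exact tsum_congr fun γ => integral_map (hm γ).aemeasurable (hae γ)

end Measure

/-! ### Criteria for trace class operators. -/

section OperatorTheory

/-- Take R = (P + δ)⁻¹; on the spectrum, t²/(t + δ)² ≤ 1 and t − t²/(t + δ) = δt/(t + δ) ≤ δ. For P
= |T| the contraction T R then replaces the partial isometry of the polar decomposition. -/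
theorem exists_regularization {A : Type*} [CStarAlgebra A] [PartialOrder A] [StarOrderedRing A]
    {P : A} (hP : 0 ≤ P) {δ : ℝ} (hδ : 0 < δ) :
    ∃ R : A, IsSelfAdjoint R ∧ ‖R * (P * P) * R‖ ≤ 1 ∧ ‖P - R * (P * P)‖ ≤ δ := by
  have hsa : IsSelfAdjoint P := .of_nonneg hP
  have hspec : ∀ t ∈ spectrum ℝ P, 0 ≤ t := fun t ht => spectrum_nonneg_of_nonneg hP ht
  have hne : ∀ t ∈ spectrum ℝ P, t + δ ≠ 0 := fun t ht => by linarith [hspec t ht]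
  have hc : ContinuousOn (fun t : ℝ => (t + δ)⁻¹) (spectrum ℝ P) :=
    (continuousOn_id.add continuousOn_const).inv₀ hne
  have hc2 : ContinuousOn (fun t : ℝ => t * t) (spectrum ℝ P) := by fun_prop
  have hc3 : ContinuousOn (fun t : ℝ => (t + δ)⁻¹ * (t * t)) (spectrum ℝ P) := hc.mul hc2
  have hid : P = cfc (fun t : ℝ => t) P := (cfc_id' ℝ P).symm
  have hPP : P * P = cfc (fun t : ℝ => t * t) P := by
    rw [cfc_mul (fun t : ℝ => t) (fun t : ℝ => t) P, cfc_id' ℝ P]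
  have hRPP : cfc (fun t : ℝ => (t + δ)⁻¹) P * (P * P) =
      cfc (fun t : ℝ => (t + δ)⁻¹ * (t * t)) P := by
    rw [hPP, ← cfc_mul _ _ P hc hc2]
  refine ⟨cfc (fun t : ℝ => (t + δ)⁻¹) P, cfc_predicate _ _, ?_, ?_⟩
  · rw [hRPP, ← cfc_mul _ _ P hc3 hc]
    refine norm_cfc_le zero_le_one fun t ht => ?_
    have h0 := hspec t ht
    rw [Real.norm_of_nonneg (by positivity)]
    rw [← div_eq_mul_inv, inv_mul_eq_div, div_div, div_le_one (by positivity)]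
    gcongr <;> linarith
  · rw [hRPP]
    nth_rewrite 1 [hid]
    rw [← cfc_sub (fun t : ℝ => t) _ P continuousOn_id hc3]
    refine norm_cfc_le hδ.le fun t ht => ?_
    have h0 := hspec t ht
    have : t - (t + δ)⁻¹ * (t * t) = t / (t + δ) * δ := by
      field_simp [hne t ht]
      ring
    rw [this, Real.norm_of_nonneg (by positivity)]
    exact mul_le_of_le_one_left hδ.le (by rw [div_le_one (by positivity)]; linarith)

variable {H : Type u} [NormedAddCommGroup H] [InnerProductSpace ℂ H] [CompleteSpace H]

theorem HilbertBasis.countable_index {H : Type*} [NormedAddCommGroup H] [InnerProductSpace ℂ H]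
    [TopologicalSpace.SeparableSpace H] {ι : Type*} (e : HilbertBasis ι ℂ H) : Countable ι := by
  have hdist : ∀ i j, i ≠ j → 1 ≤ dist (e i) (e j) := by
    intro i j hij
    have h1 : ‖e i - e j‖ * ‖e i - e j‖ = 2 := by
      have h0 : inner ℂ (e i) (e j) = 0 := e.orthonormal.2 hij
      have h := norm_sub_mul_self (𝕜 := ℂ) (e i) (e j)
      rw [h0, e.orthonormal.1 i, e.orthonormal.1 j] at h
      norm_num at h
      exact h
    rw [dist_eq_norm]
    nlinarith [norm_nonneg (e i - e j)]
  refine Pairwise.countable_of_isOpen_disjoint (s := fun i => Metric.ball (e i) (1 / 2)) ?_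
    (fun i => Metric.isOpen_ball) (fun i => ⟨e i, Metric.mem_ball_self (by norm_num)⟩)
  intro i j hij
  exact Metric.ball_disjoint_ball (by linarith [hdist i j hij])

/-- An operator whose matrix coefficients `⟪V eᵢ, T eᵢ⟫` are uniformly absolutely summable over all
contractions `V` is trace class. -/
theorem isTraceClass_of_sum_le (T : H →L[ℂ] H) (B : ℝ)
    (hB : ∀ (ι : Type u) (e : HilbertBasis ι ℂ H) (V : H →L[ℂ] H), ‖V‖ ≤ 1 → ∀ s : Finset ι,
      ∑ i ∈ s, ‖inner ℂ (V (e i)) (T (e i))‖ ≤ B) : IsTraceClass T := by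
  intro ι e
  set P := CFC.abs T with hPdef
  have hP : 0 ≤ P := CFC.abs_nonneg T
  have hPpos : P.IsPositive := (ContinuousLinearMap.nonneg_iff_isPositive P).1 hP
  have hPP : P * P = star T * T := CFC.abs_mul_abs T
  refine summable_of_sum_le (c := B) (fun i => hPpos.re_inner_nonneg_right (e i)) fun s => ?_
  -- For V = T R one has V^* T = R P², within δ of P in norm. The error is δ per basis vector, and δ
  -- → 0 with `s` fixed.
  have key (δ : ℝ) (hδ : 0 < δ) : ∑ i ∈ s, (inner ℂ (e i) (P (e i))).re ≤ B + s.card * δ := by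
    obtain ⟨R, hR, h1, h2⟩ := exists_regularization hP hδ
    set V : H →L[ℂ] H := T * R with hV
    have hVn : ‖V‖ ≤ 1 := by
      have h3 : star V * V = R * (P * P) * R := by
        rw [hV, hPP, star_mul, hR.star_eq]; simp only [mul_assoc]
      have h4 : ‖V‖ * ‖V‖ ≤ 1 := by rw [← CStarRing.norm_star_mul_self, h3]; exact h1
      nlinarith [norm_nonneg V]
    have hterm (i : ι) : (inner ℂ (e i) (P (e i))).re ≤
        ‖inner ℂ (V (e i)) (T (e i))‖ + δ := by
      have h3 : inner ℂ (V (e i)) (T (e i)) = inner ℂ (e i) ((R * (P * P)) (e i)) := by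
        rw [hPP, ← ContinuousLinearMap.adjoint_inner_right]
        congr 1
        change (star V * T) (e i) = _
        rw [hV, star_mul, hR.star_eq, mul_assoc]
      have h4 : inner ℂ (e i) (P (e i)) = inner ℂ (e i) ((R * (P * P)) (e i)) +
          inner ℂ (e i) ((P - R * (P * P)) (e i)) := by
        rw [← inner_add_right]; simp
      have hei : ‖e i‖ = 1 := e.orthonormal.1 i
      rw [h4, Complex.add_re, h3]
      refine add_le_add (Complex.re_le_norm _) ((Complex.re_le_norm _).trans ?_)
      refine (norm_inner_le_norm _ _).trans ?_
      rw [hei, one_mul]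
      refine ((P - R * (P * P)).le_opNorm _).trans ?_
      rw [hei, mul_one]
      exact h2
    calc _ ≤ ∑ i ∈ s, (‖inner ℂ (V (e i)) (T (e i))‖ + δ) := Finset.sum_le_sum fun i _ => hterm i
      _ = ∑ i ∈ s, ‖inner ℂ (V (e i)) (T (e i))‖ + s.card * δ := by
          rw [Finset.sum_add_distrib, Finset.sum_const, nsmul_eq_mul]
      _ ≤ _ := by gcongr; exact hB ι e V hVn s
  have hlim : Tendsto (fun δ : ℝ => B + s.card * δ) (𝓝[>] 0) (𝓝 B) := by
    have : Continuous fun δ : ℝ => B + s.card * δ := by fun_prop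
    simpa using (this.tendsto 0).mono_left nhdsWithin_le_nhds
  exact ge_of_tendsto hlim (eventually_nhdsWithin_of_forall fun δ hδ => key δ hδ)

variable {Ξ : Type*} [MeasurableSpace Ξ]

/-- Cauchy–Schwarz, then Bessel's inequality for V^* a and for b. -/
theorem sum_norm_inner_mul_inner_le {ι : Type*} (e : HilbertBasis ι ℂ H) (V : H →L[ℂ] H)
    (hV : ‖V‖ ≤ 1) (s : Finset ι) (a b : H) :
    ∑ i ∈ s, ‖inner ℂ (V (e i)) a * inner ℂ b (e i)‖ ≤ ‖a‖ * ‖b‖ := by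
  have h1 : ∑ i ∈ s, ‖inner ℂ (V (e i)) a‖ ^ 2 ≤ ‖a‖ ^ 2 := by
    have h : ∑ i ∈ s, ‖inner ℂ (e i) (ContinuousLinearMap.adjoint V a)‖ ^ 2 ≤ _ :=
      e.orthonormal.sum_inner_products_le _
    simp only [ContinuousLinearMap.adjoint_inner_right] at h
    refine h.trans ?_
    gcongr
    refine ((ContinuousLinearMap.adjoint V).le_opNorm a).trans ?_
    rw [LinearIsometryEquiv.norm_map]
    exact mul_le_of_le_one_left (norm_nonneg _) hV
  have h2 : ∑ i ∈ s, ‖inner ℂ b (e i)‖ ^ 2 ≤ ‖b‖ ^ 2 := by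
    have h : ∑ i ∈ s, ‖inner ℂ (e i) b‖ ^ 2 ≤ _ := e.orthonormal.sum_inner_products_le _
    simpa only [norm_inner_symm b] using h
  simp only [norm_mul]
  calc _ ≤ √(∑ i ∈ s, ‖inner ℂ (V (e i)) a‖ ^ 2) * √(∑ i ∈ s, ‖inner ℂ b (e i)‖ ^ 2) :=
        Real.sum_mul_le_sqrt_mul_sqrt _ _ _
    _ ≤ √(‖a‖ ^ 2) * √(‖b‖ ^ 2) := by gcongr
    _ = _ := by rw [Real.sqrt_sq (norm_nonneg _), Real.sqrt_sq (norm_nonneg _)]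

/-- An absolutely convergent integral of operators of rank one is trace class, and its trace is the
integral of the traces. -/
theorem isTraceClass_and_hasTrace_of_integral [TopologicalSpace.SeparableSpace H] (ρ : Measure Ξ)
    (T : H →L[ℂ] H) (a b : Ξ → H) (β : Ξ → ℝ) (hβ : Integrable β ρ)
    (ha : ∀ g, AEStronglyMeasurable (fun ξ => inner ℂ g (a ξ)) ρ)
    (hb : ∀ g, AEStronglyMeasurable (fun ξ => inner ℂ (b ξ) g) ρ)
    (hab : ∀ ξ, ‖a ξ‖ * ‖b ξ‖ ≤ β ξ)
    (hT : ∀ g f, inner ℂ g (T f) = ∫ ξ, inner ℂ g (a ξ) * inner ℂ (b ξ) f ∂ρ) :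
    IsTraceClass T ∧ HasTrace T (∫ ξ, inner ℂ (b ξ) (a ξ) ∂ρ) := by
  have hint (g f : H) : Integrable (fun ξ => inner ℂ g (a ξ) * inner ℂ (b ξ) f) ρ := by
    refine (hβ.const_mul (‖g‖ * ‖f‖)).mono' ((ha g).mul (hb f)) (Eventually.of_forall fun ξ => ?_)
    rw [norm_mul]
    calc _ ≤ (‖g‖ * ‖a ξ‖) * (‖b ξ‖ * ‖f‖) := by
          gcongr <;> exact norm_inner_le_norm _ _
      _ = ‖g‖ * ‖f‖ * (‖a ξ‖ * ‖b ξ‖) := by ring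
      _ ≤ _ := by gcongr; exact hab ξ
  -- One bound serves twice: arbitrary contractions `V` give the trace class property, and V = id
  -- gives the absolute convergence needed to exchange sum and integral in the trace.
  have hsum {ι : Type u} (e : HilbertBasis ι ℂ H) (V : H →L[ℂ] H) (hV : ‖V‖ ≤ 1) (s : Finset ι) :
      ∑ i ∈ s, ∫ ξ, ‖inner ℂ (V (e i)) (a ξ) * inner ℂ (b ξ) (e i)‖ ∂ρ ≤ ∫ ξ, β ξ ∂ρ := by
    rw [← integral_finsetSum _ fun i _ => (hint _ _).norm]
    refine integral_mono (integrable_finsetSum _ fun i _ => (hint _ _).norm) hβ fun ξ => ?_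
    exact (sum_norm_inner_mul_inner_le e V hV s _ _).trans (hab ξ)
  constructor
  · refine isTraceClass_of_sum_le T (∫ ξ, β ξ ∂ρ) fun ι e V hV s => ?_
    refine le_trans (Finset.sum_le_sum fun i _ => ?_) (hsum e V hV s)
    rw [hT]
    exact norm_integral_le_integral_norm _
  · intro ι e
    have : Countable ι := e.countable_index
    have h := hasSum_integral_of_summable_integral_norm
      (F := fun i ξ => inner ℂ (e i) (a ξ) * inner ℂ (b ξ) (e i)) (fun i => hint _ _)
      (summable_of_sum_le (fun i => integral_nonneg fun ξ => norm_nonneg _) fun s =>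
        hsum e (.id ℂ H) (ContinuousLinearMap.norm_id_le) s)
    have h2 (ξ : Ξ) : ∑' i, inner ℂ (e i) (a ξ) * inner ℂ (b ξ) (e i) = inner ℂ (b ξ) (a ξ) := by
      rw [← e.tsum_inner_mul_inner]
      exact tsum_congr fun i => mul_comm _ _
    simp only [h2] at h
    simpa only [hT] using h

end OperatorTheory

/-! ### Integral operators with bounded kernels on a finite measure space. -/

section IntegralOperator

variable {X : Type u} [MeasurableSpace X] (ν : Measure X) [IsFiniteMeasure ν]

/-- The class in `L²` of a bounded measurable function. -/
def toL2 (f : X → ℂ) (hf : Measurable f) (C : ℝ) (hC : ∀ x, ‖f x‖ ≤ C) : Lp ℂ 2 ν :=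
  (MemLp.of_bound hf.aestronglyMeasurable C (Eventually.of_forall hC)).toLp f

theorem coeFn_toL2 (f : X → ℂ) (hf : Measurable f) (C : ℝ) (hC : ∀ x, ‖f x‖ ≤ C) :
    toL2 ν f hf C hC =ᵐ[ν] f :=
  MemLp.coeFn_toLp _

theorem norm_toL2_le (f : X → ℂ) (hf : Measurable f) (C : ℝ) (hC : ∀ x, ‖f x‖ ≤ C) (h0 : 0 ≤ C) :
    ‖toL2 ν f hf C hC‖ ≤ (measureUnivNNReal ν : ℝ) ^ (2 : ℝ)⁻¹ * C := by
  refine (Lp.norm_le_of_ae_bound h0 ?_).trans_eq ?_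
  · filter_upwards [coeFn_toL2 ν f hf C hC] with x hx
    rw [hx]; exact hC x
  · simp

theorem inner_toL2_left (f : X → ℂ) (hf : Measurable f) (C : ℝ) (hC : ∀ x, ‖f x‖ ≤ C)
    (g : Lp ℂ 2 ν) : inner ℂ (toL2 ν f hf C hC) g = ∫ x, starRingEnd ℂ (f x) * g x ∂ν := by
  rw [L2.inner_def]
  refine integral_congr_ae ?_
  filter_upwards [coeFn_toL2 ν f hf C hC] with x hx
  rw [hx, RCLike.inner_apply, mul_comm]

theorem inner_toL2_right (f : X → ℂ) (hf : Measurable f) (C : ℝ) (hC : ∀ x, ‖f x‖ ≤ C)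
    (g : Lp ℂ 2 ν) : inner ℂ g (toL2 ν f hf C hC) = ∫ x, starRingEnd ℂ (g x) * f x ∂ν := by
  rw [L2.inner_def]
  refine integral_congr_ae ?_
  filter_upwards [coeFn_toL2 ν f hf C hC] with x hx
  rw [hx, RCLike.inner_apply, mul_comm]

theorem integrable_L2 (f : Lp ℂ 2 ν) : Integrable f ν :=
  (Lp.memLp f).integrable (by norm_num)

variable (K : X → X → ℂ) (hK : Measurable (Function.uncurry K)) (C : ℝ) (hC : ∀ p q, ‖K p q‖ ≤ C)

include hK in
theorem measurable_conj_kernel (p : X) : Measurable fun q => starRingEnd ℂ (K p q) :=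
  (Complex.continuous_conj.measurable).comp (hK.comp measurable_prodMk_left)

omit [MeasurableSpace X] in
include hC in
theorem norm_conj_kernel_le (p q : X) : ‖starRingEnd ℂ (K p q)‖ ≤ C := by
  rw [RCLike.norm_conj]; exact hC p q

/-- The row `q ↦ conj (K p q)` of a kernel. -/
def kernelRow (p : X) : Lp ℂ 2 ν :=
  toL2 ν (fun q => starRingEnd ℂ (K p q)) (measurable_conj_kernel K hK p) C
    (norm_conj_kernel_le K C hC p)

theorem inner_kernelRow (p : X) (f : Lp ℂ 2 ν) :
    inner ℂ (kernelRow ν K hK C hC p) f = ∫ q, K p q * f q ∂ν := by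
  rw [kernelRow, inner_toL2_left]
  simp

include hK in
theorem stronglyMeasurable_integral_kernel_mul (f : Lp ℂ 2 ν) :
    StronglyMeasurable fun p => ∫ q, K p q * f q ∂ν := by
  refine StronglyMeasurable.integral_prod_right ?_
  exact hK.stronglyMeasurable.mul ((Lp.stronglyMeasurable f).comp_measurable measurable_snd)

include hK hC in
theorem norm_inner_kernelRow_le (h0 : 0 ≤ C) (p : X) (f : Lp ℂ 2 ν) :
    ‖∫ q, K p q * f q ∂ν‖ ≤ (measureUnivNNReal ν : ℝ) ^ (2 : ℝ)⁻¹ * C * ‖f‖ := by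
  rw [← inner_kernelRow ν K hK C hC]
  refine (norm_inner_le_norm _ _).trans ?_
  gcongr
  exact norm_toL2_le ν _ _ _ _ h0

/-- The function `p ↦ ∫ q, K p q * f q` as an element of `L²`. -/
def integralOperatorFun (h0 : 0 ≤ C) (f : Lp ℂ 2 ν) : Lp ℂ 2 ν :=
  toL2 ν (fun p => ∫ q, K p q * f q ∂ν)
    (stronglyMeasurable_integral_kernel_mul ν K hK f).measurable _
    (fun p => norm_inner_kernelRow_le ν K hK C hC h0 p f)

theorem coeFn_integralOperatorFun (h0 : 0 ≤ C) (f : Lp ℂ 2 ν) :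
    integralOperatorFun ν K hK C hC h0 f =ᵐ[ν] fun p => ∫ q, K p q * f q ∂ν :=
  coeFn_toL2 ν (fun p => ∫ q, K p q * f q ∂ν)
    (stronglyMeasurable_integral_kernel_mul ν K hK f).measurable _
    (fun p => norm_inner_kernelRow_le ν K hK C hC h0 p f)

/-- The integral operator with a bounded measurable kernel. -/
def integralOperator (h0 : 0 ≤ C) : Lp ℂ 2 ν →L[ℂ] Lp ℂ 2 ν :=
  LinearMap.mkContinuous
    { toFun := integralOperatorFun ν K hK C hC h0
      map_add' := fun f g => by
        refine Lp.ext ?_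
        refine (coeFn_integralOperatorFun ν K hK C hC h0 _).trans ?_
        refine EventuallyEq.trans ?_ (Lp.coeFn_add _ _).symm
        refine EventuallyEq.trans ?_
          ((coeFn_integralOperatorFun ν K hK C hC h0 f).add
            (coeFn_integralOperatorFun ν K hK C hC h0 g)).symm
        refine Eventually.of_forall fun p => ?_
        simp only [Pi.add_apply, ← inner_kernelRow ν K hK C hC, inner_add_right]
      map_smul' := fun c f => by
        refine Lp.ext ?_
        refine (coeFn_integralOperatorFun ν K hK C hC h0 _).trans ?_
        refine EventuallyEq.trans ?_ (Lp.coeFn_smul _ _).symm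
        refine EventuallyEq.trans ?_
          ((coeFn_integralOperatorFun ν K hK C hC h0 f).const_smul c).symm
        refine Eventually.of_forall fun p => ?_
        simp only [Pi.smul_apply, ← inner_kernelRow ν K hK C hC, inner_smul_right, smul_eq_mul] }
    ((measureUnivNNReal ν : ℝ) ^ (2 : ℝ)⁻¹ * ((measureUnivNNReal ν : ℝ) ^ (2 : ℝ)⁻¹ * C))
    (fun f => by
      refine (norm_toL2_le ν (fun p => ∫ q, K p q * f q ∂ν)
        (stronglyMeasurable_integral_kernel_mul ν K hK f).measurable _
        (fun p => norm_inner_kernelRow_le ν K hK C hC h0 p f) (by positivity)).trans_eq ?_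
      ring)

theorem coeFn_integralOperator (h0 : 0 ≤ C) (f : Lp ℂ 2 ν) :
    integralOperator ν K hK C hC h0 f =ᵐ[ν] fun p => ∫ q, K p q * f q ∂ν :=
  coeFn_integralOperatorFun ν K hK C hC h0 f

theorem norm_sq_kernelRow (p : X) :
    ‖kernelRow ν K hK C hC p‖ ^ 2 = ∫ q, ‖K p q‖ ^ 2 ∂ν := by
  rw [← @inner_self_eq_norm_sq ℂ, kernelRow, inner_toL2_left]
  rw [integral_congr_ae (g := fun q => ((‖K p q‖ ^ 2 : ℝ) : ℂ))]
  · rw [integral_complex_ofReal]; simp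
  · filter_upwards [coeFn_toL2 ν _ (measurable_conj_kernel K hK p) C
      (norm_conj_kernel_le K C hC p)] with q hq
    rw [hq]
    simp only [RingHomCompTriple.comp_apply, RingHom.id_apply]
    rw [Complex.mul_conj, Complex.normSq_eq_norm_sq]

include hK hC in
theorem integrable_integral_norm_sq_kernel : Integrable (fun p => ∫ q, ‖K p q‖ ^ 2 ∂ν) ν := by
  have h : Integrable (fun x : X × X => ‖K x.1 x.2‖ ^ 2) (ν.prod ν) :=
    Integrable.of_bound (hK.norm.pow_const 2).aestronglyMeasurable (C ^ 2)
      (Eventually.of_forall fun x => by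
        rw [Real.norm_of_nonneg (by positivity)]
        exact pow_le_pow_left₀ (norm_nonneg _) (hC x.1 x.2) 2)
  exact h.integral_prod_left

/-- (T eᵢ)(p) is the inner product of the row at `p` with eᵢ. Parseval sums the squares for each
`p`, and dominated convergence integrates over `p`; separability makes the basis countable. -/
theorem hasHilbertSchmidtNorm_integralOperator (h0 : 0 ≤ C)
    [TopologicalSpace.SeparableSpace (Lp ℂ 2 ν)] :
    HasHilbertSchmidtNorm (integralOperator ν K hK C hC h0)
      (√(∫ p, ∫ q, ‖K p q‖ ^ 2 ∂ν ∂ν)) := by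
  refine ⟨Real.sqrt_nonneg _, fun ι e => ?_⟩
  have : Countable ι := e.countable_index
  rw [Real.sq_sqrt (by positivity)]
  have hterm (i : ι) : ‖integralOperator ν K hK C hC h0 (e i)‖ ^ 2 =
      ∫ p, ‖inner ℂ (kernelRow ν K hK C hC p) (e i)‖ ^ 2 ∂ν := by
    rw [← @inner_self_eq_norm_sq ℂ, L2.inner_def]
    rw [integral_congr_ae (g := fun p =>
      ((‖inner ℂ (kernelRow ν K hK C hC p) (e i)‖ ^ 2 : ℝ) : ℂ))]
    · rw [integral_complex_ofReal]; simp
    · filter_upwards [coeFn_integralOperator ν K hK C hC h0 (e i)] with p hp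
      rw [hp, inner_kernelRow, RCLike.inner_apply, Complex.mul_conj, Complex.normSq_eq_norm_sq]
  have hrow (p : X) : HasSum (fun i => ‖inner ℂ (kernelRow ν K hK C hC p) (e i)‖ ^ 2)
      (∫ q, ‖K p q‖ ^ 2 ∂ν) := by
    rw [← norm_sq_kernelRow ν K hK C hC, ← @inner_self_eq_norm_sq ℂ]
    have h := Complex.hasSum_re
      (e.hasSum_inner_mul_inner (kernelRow ν K hK C hC p) (kernelRow ν K hK C hC p))
    convert h using 1
    · ext i
      rw [← inner_conj_symm (e i), Complex.mul_conj, Complex.normSq_eq_norm_sq, Complex.ofReal_re]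
    · rfl
  simp only [hterm]
  refine hasSum_integral_of_dominated_convergence
    (fun i p => ‖inner ℂ (kernelRow ν K hK C hC p) (e i)‖ ^ 2) (fun i => ?_)
    (fun i => Eventually.of_forall fun p => ?_) (Eventually.of_forall fun p => (hrow p).summable)
    ?_ (Eventually.of_forall hrow)
  · simp only [inner_kernelRow]
    exact ((stronglyMeasurable_integral_kernel_mul ν K hK (e i)).norm.pow 2).aestronglyMeasurable
  · rw [Real.norm_of_nonneg (by positivity)]
  · simp only [fun p => (hrow p).tsum_eq]
    exact integrable_integral_norm_sq_kernel ν K hK C hC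

/-- An integral operator whose kernel is a superposition of bounded product kernels is trace
class, and its trace is the integral of the kernel over the diagonal. -/
theorem isTraceClass_and_hasTrace_integralOperator (h0 : 0 ≤ C)
    [TopologicalSpace.SeparableSpace (Lp ℂ 2 ν)] {Ξ : Type*} [MeasurableSpace Ξ] (ρ : Measure Ξ)
    [SigmaFinite ρ] (a : X → Ξ → ℂ) (c : Ξ → X → ℂ) (α : Ξ → ℝ) (hα : Integrable α ρ)
    (ha : Measurable (Function.uncurry a)) (hc : Measurable (Function.uncurry c))
    (haα : ∀ p ξ, ‖a p ξ‖ ≤ α ξ) (hc1 : ∀ ξ q, ‖c ξ q‖ ≤ 1)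
    (hKac : ∀ p q, K p q = ∫ ξ, a p ξ * c ξ q ∂ρ) :
    IsTraceClass (integralOperator ν K hK C hC h0) ∧
      HasTrace (integralOperator ν K hK C hC h0) (∫ p, K p p ∂ν) := by
  set W := (measureUnivNNReal ν : ℝ) ^ (2 : ℝ)⁻¹ with hW
  have hW0 : 0 ≤ W := by positivity
  have ham (ξ : Ξ) : Measurable fun p => a p ξ := ha.comp measurable_prodMk_right
  have hcm (ξ : Ξ) : Measurable fun q => c ξ q := hc.comp measurable_prodMk_left
  have hab (ξ : Ξ) (p : X) : ‖a p ξ‖ ≤ |α ξ| := (haα p ξ).trans (le_abs_self _)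
  let A : Ξ → Lp ℂ 2 ν := fun ξ => toL2 ν (fun p => a p ξ) (ham ξ) |α ξ| (hab ξ)
  let B : Ξ → Lp ℂ 2 ν := fun ξ => toL2 ν (fun q => starRingEnd ℂ (c ξ q))
    (Complex.continuous_conj.measurable.comp (hcm ξ)) 1
    (fun q => by rw [RCLike.norm_conj]; exact hc1 ξ q)
  have hB (ξ : Ξ) (f : Lp ℂ 2 ν) : inner ℂ (B ξ) f = ∫ q, c ξ q * f q ∂ν := by
    simp only [B]; rw [inner_toL2_left]; simp
  have hA (ξ : Ξ) (g : Lp ℂ 2 ν) : inner ℂ g (A ξ) = ∫ p, starRingEnd ℂ (g p) * a p ξ ∂ν := by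
    simp only [A]; rw [inner_toL2_right]
  have hBA (ξ : Ξ) : inner ℂ (B ξ) (A ξ) = ∫ p, a p ξ * c ξ p ∂ν := by
    rw [hB]
    refine integral_congr_ae ?_
    filter_upwards [coeFn_toL2 ν _ (ham ξ) |α ξ| (hab ξ)] with p hp
    rw [hp, mul_comm]
  have hgm (g : Lp ℂ 2 ν) : StronglyMeasurable fun p => starRingEnd ℂ (g p) :=
    Complex.continuous_conj.comp_stronglyMeasurable (Lp.stronglyMeasurable g)
  have hBm (f : Lp ℂ 2 ν) : StronglyMeasurable fun ξ => ∫ q, c ξ q * f q ∂ν :=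
    StronglyMeasurable.integral_prod_right (f := fun ξ q => c ξ q * f q)
      (hc.stronglyMeasurable.mul ((Lp.stronglyMeasurable f).comp_measurable measurable_snd))
  have hAm (g : Lp ℂ 2 ν) : StronglyMeasurable fun ξ => ∫ p, starRingEnd ℂ (g p) * a p ξ ∂ν :=
    StronglyMeasurable.integral_prod_right (f := fun ξ p => starRingEnd ℂ (g p) * a p ξ)
      (((hgm g).comp_measurable measurable_snd).mul
        (ha.stronglyMeasurable.comp_measurable measurable_swap))
  -- The diagonal is a null set in general, so the pointwise formula for `K` is used here, not
  -- merely an almost everywhere one.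
  have hdiag : ∫ ξ, inner ℂ (B ξ) (A ξ) ∂ρ = ∫ p, K p p ∂ν := by
    simp only [hBA, hKac]
    refine integral_integral_swap (f := fun ξ p => a p ξ * c ξ p) ?_
    refine (hα.abs.mul_prod (integrable_const (1 : ℝ) (μ := ν))).mono' ?_ ?_
    · exact ((ha.comp measurable_swap).mul hc).aestronglyMeasurable
    · refine Eventually.of_forall fun x => ?_
      rw [Function.uncurry, norm_mul]
      exact mul_le_mul (hab _ _) (hc1 _ _) (norm_nonneg _) (abs_nonneg _)
  rw [← hdiag]
  refine isTraceClass_and_hasTrace_of_integral ρ _ A B (fun ξ => W * |α ξ| * (W * 1))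
    ((hα.abs.const_mul W).mul_const _) (fun g => ?_) (fun f => ?_) (fun ξ => ?_) (fun g f => ?_)
  · simp only [hA]; exact (hAm g).aestronglyMeasurable
  · simp only [hB]; exact (hBm f).aestronglyMeasurable
  · exact mul_le_mul (norm_toL2_le ν _ _ _ _ (abs_nonneg _)) (norm_toL2_le ν _ _ _ _ zero_le_one)
      (norm_nonneg _) (by positivity)
  simp only [hA, hB]
  have hf1 : Integrable (fun q => f q) ν := integrable_L2 ν f
  have hg1 : Integrable (fun q => g q) ν := integrable_L2 ν g
  have hrow (p : X) : ∫ q, K p q * f q ∂ν = ∫ ξ, a p ξ * ∫ q, c ξ q * f q ∂ν ∂ρ := by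
    simp only [hKac, ← integral_mul_const, ← integral_const_mul, ← mul_assoc]
    refine integral_integral_swap (f := fun q ξ => a p ξ * c ξ q * f q) ?_
    refine (hf1.norm.mul_prod hα.abs).mono' ?_ ?_
    · refine (StronglyMeasurable.mul ?_ ?_).aestronglyMeasurable
      · exact ((ha.comp (measurable_const.prodMk measurable_snd)).mul
          (hc.comp measurable_swap)).stronglyMeasurable
      · exact (Lp.stronglyMeasurable f).comp_measurable measurable_fst
    · refine Eventually.of_forall fun x => ?_
      rw [Function.uncurry, norm_mul, norm_mul, mul_comm]
      refine mul_le_mul_of_nonneg_left ?_ (norm_nonneg _)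
      calc _ ≤ |α x.2| * 1 :=
            mul_le_mul (hab _ _) (hc1 _ _) (norm_nonneg _) (abs_nonneg _)
        _ = _ := mul_one _
  have hleft : inner ℂ g (integralOperator ν K hK C hC h0 f) =
      ∫ p, ∫ ξ, starRingEnd ℂ (g p) * (a p ξ * ∫ q, c ξ q * f q ∂ν) ∂ρ ∂ν := by
    rw [L2.inner_def]
    refine integral_congr_ae ?_
    filter_upwards [coeFn_integralOperator ν K hK C hC h0 f] with p hp
    rw [hp, RCLike.inner_apply, hrow, mul_comm, integral_const_mul]
  rw [hleft]
  simp only [← integral_mul_const, mul_assoc]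
  have hFb (ξ : Ξ) : ‖∫ q, c ξ q * f q ∂ν‖ ≤ ∫ q, ‖f q‖ ∂ν := by
    refine (norm_integral_le_integral_norm _).trans ?_
    refine integral_mono_of_nonneg (Eventually.of_forall fun q => norm_nonneg _) hf1.norm
      (Eventually.of_forall fun q => ?_)
    simp only [norm_mul]
    exact mul_le_of_le_one_left (norm_nonneg _) (hc1 _ _)
  refine integral_integral_swap
    (f := fun p ξ => starRingEnd ℂ (g p) * (a p ξ * ∫ q, c ξ q * f q ∂ν)) ?_
  refine (hg1.norm.mul_prod (hα.abs.mul_const (∫ q, ‖f q‖ ∂ν))).mono' ?_ ?_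
  · refine (StronglyMeasurable.mul ?_ (StronglyMeasurable.mul ?_ ?_)).aestronglyMeasurable
    · exact (hgm g).comp_measurable measurable_fst
    · exact ha.stronglyMeasurable
    · exact (hBm f).comp_measurable measurable_snd
  · refine Eventually.of_forall fun x => ?_
    rw [Function.uncurry, norm_mul, norm_mul, RCLike.norm_conj]
    refine mul_le_mul_of_nonneg_left ?_ (norm_nonneg _)
    exact mul_le_mul (hab _ _) (hFb _) (norm_nonneg _) (abs_nonneg _)

end IntegralOperator

/-! ### The kernel on `M × M` obtained by summing over `Γ`. -/

section LatticeKernel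

variable {G : Type u} [Group G] {Γ : Subgroup G}

/-- The sum `∑ γ, k_ẋ (y⁻¹ γ x)`. -/
def latticeKernel (k : NilManifold Γ → G → ℂ) (x y : G) : ℂ :=
  ∑' γ : Γ, k (NilManifold.mk Γ x) (y⁻¹ * (γ * x))

/-- The function induced by `latticeKernel` on `M × M`. -/
def nilKernel (k : NilManifold Γ → G → ℂ) (p q : NilManifold Γ) : ℂ :=
  latticeKernel k (Quotient.out p) (Quotient.out q)

theorem latticeKernel_mul (k : NilManifold Γ → G → ℂ) (x y : G) (δ η : Γ) :
    latticeKernel k (δ * x) (η * y) = latticeKernel k x y := by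
  unfold latticeKernel
  -- Reindex by γ ↦ η γ δ⁻¹.
  rw [← ((Equiv.mulRight δ⁻¹).trans (Equiv.mulLeft η)).tsum_eq]
  simp [NilManifold.mk_mul, mul_assoc]

theorem nilKernel_mk_mk (k : NilManifold Γ → G → ℂ) (x y : G) :
    nilKernel k (NilManifold.mk Γ x) (NilManifold.mk Γ y) = latticeKernel k x y := by
  obtain ⟨δ, hδ⟩ := (NilManifold.mk_eq_mk_iff Γ).1 (NilManifold.mk_out Γ (NilManifold.mk Γ x))
  obtain ⟨η, hη⟩ := (NilManifold.mk_eq_mk_iff Γ).1 (NilManifold.mk_out Γ (NilManifold.mk Γ y))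
  conv_rhs => rw [hδ, hη]
  rw [latticeKernel_mul]
  rfl

variable [NormedAddCommGroup G]

/-- A continuous kernel whose lattice sums converge absolutely, uniformly on bounded sets. -/
structure IsSummableKernel (k : NilManifold Γ → G → ℂ) : Prop where
  continuous_uncurry : Continuous (Function.uncurry k)
  exists_summable : ∀ R : ℝ, ∃ u : Γ → ℝ, Summable u ∧ ∀ x y : G, ‖x‖ ≤ R → ‖y‖ ≤ R → ∀ γ : Γ,
    ‖k (NilManifold.mk Γ x) (y⁻¹ * (γ * x))‖ ≤ u γ

variable {k : NilManifold Γ → G → ℂ} (hk : IsSummableKernel k)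
include hk

theorem IsSummableKernel.continuous_latticeKernel [IsTopologicalGroup G] :
    Continuous fun z : G × G => latticeKernel k z.1 z.2 := by
  refine continuous_iff_continuousAt.2 fun z => ?_
  obtain ⟨u, hu, hbd⟩ := hk.exists_summable (‖z‖ + 1)
  have h := continuousOn_tsum (s := Metric.ball z 1)
    (f := fun (γ : Γ) (w : G × G) => k (NilManifold.mk Γ w.1) (w.2⁻¹ * (γ * w.1))) (u := u)
    (fun γ => (hk.continuous_uncurry.comp (((NilManifold.continuous_mk Γ).comp
      continuous_fst).prodMk (by fun_prop))).continuousOn) hu (fun γ w hw => by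
        have h1 : ‖w‖ ≤ ‖z‖ + 1 := by
          have h2 := norm_le_norm_add_norm_sub' w z
          have h3 := (mem_ball_iff_norm.1 hw).le
          linarith
        exact hbd _ _ ((norm_fst_le w).trans h1) ((norm_snd_le w).trans h1) γ)
  exact h.continuousAt (Metric.ball_mem_nhds z one_pos)

theorem IsSummableKernel.continuous_nilKernel [IsTopologicalGroup G] :
    Continuous (Function.uncurry (nilKernel k)) := by
  have hop := (NilManifold.isOpenQuotientMap_mk Γ).prodMap (NilManifold.isOpenQuotientMap_mk Γ)
  rw [hop.isQuotientMap.continuous_iff]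
  convert hk.continuous_latticeKernel using 1
  ext z
  exact nilKernel_mk_mk k z.1 z.2

theorem IsSummableKernel.exists_norm_nilKernel_le [IsTopologicalGroup G]
    [CompactSpace (NilManifold Γ)] : ∃ C : ℝ, 0 ≤ C ∧ ∀ p q, ‖nilKernel k p q‖ ≤ C := by
  obtain ⟨C, hC⟩ := isCompact_univ.exists_bound_of_continuousOn
    hk.continuous_nilKernel.continuousOn
  exact ⟨max C 0, le_max_right _ _, fun p q => (hC (p, q) trivial).trans (le_max_left _ _)⟩

omit hk

variable [NormedSpace ℝ G] [FiniteDimensional ℝ G] [MeasurableSpace G] [BorelSpace G]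
  [DiscreteTopology Γ]

include hk in
theorem IsSummableKernel.measurable_nilKernel [IsTopologicalGroup G] :
    Measurable (Function.uncurry (nilKernel k)) := by
  have : ProperSpace G := FiniteDimensional.proper ℝ G
  have : CompleteSpace G := FiniteDimensional.complete ℝ G
  have : SecondCountableTopology G := secondCountable_of_proper
  have := NilManifold.secondCountableTopology Γ
  have : BorelSpace (NilManifold Γ) := NilManifold.borelSpace Γ
  exact hk.continuous_nilKernel.measurable

variable {μ : Measure G} {ν : Measure (NilManifold Γ)}

theorem separableSpace_L2 [IsTopologicalGroup G] [IsFiniteMeasure ν] :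
    TopologicalSpace.SeparableSpace (Lp ℂ 2 ν) := by
  have : ProperSpace G := FiniteDimensional.proper ℝ G
  have : CompleteSpace G := FiniteDimensional.complete ℝ G
  have : SecondCountableTopology G := secondCountable_of_proper
  have := NilManifold.secondCountableTopology Γ
  have : BorelSpace (NilManifold Γ) := NilManifold.borelSpace Γ
  have : Fact ((2 : ℝ≥0∞) ≠ ⊤) := ⟨by simp⟩
  have : SecondCountableTopology (Lp ℂ 2 ν) := inferInstance
  infer_instance

variable [CompactSpace (NilManifold Γ)]
variable [LieGroup 𝓘(ℝ, G) ∞ G]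

include hk in
-- After unfolding, the term of γ involves (γ s(q))⁻¹x = s(q)⁻¹γ⁻¹x, hence is dominated by
-- u(γ⁻¹)‖f(q)‖; inversion of `Γ` preserves summability.
theorem IsSummableKernel.integrable_mul (hν : IsQuotientMeasure Γ μ ν)
    {f : NilManifold Γ → ℂ} (hfm : StronglyMeasurable f) (hf : Integrable f ν) (x : G) :
    Integrable (fun y => f (NilManifold.mk Γ y) * k (NilManifold.mk Γ x) (y⁻¹ * x)) μ := by
  have : IsTopologicalGroup G := topologicalGroup_of_lieGroup 𝓘(ℝ, G) ∞
  obtain ⟨s, hs, hsec, R, hR0, hR⟩ := NilManifold.exists_measurable_section Γ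
  have hkx : Continuous (k (NilManifold.mk Γ x)) :=
    hk.continuous_uncurry.comp (continuous_const.prodMk continuous_id)
  have hmk : Measurable (NilManifold.mk Γ) := fun _ hs => hs
  have hF : StronglyMeasurable fun y =>
      f (NilManifold.mk Γ y) * k (NilManifold.mk Γ x) (y⁻¹ * x) :=
    (hfm.comp_measurable hmk).mul
      (hkx.comp (continuous_inv.mul continuous_const)).stronglyMeasurable
  obtain ⟨u, hu, hbd⟩ := hk.exists_summable (max ‖x‖ R)
  have hterm (γ : Γ) (q : NilManifold Γ) :
      ‖f (NilManifold.mk Γ (γ * s q)) * k (NilManifold.mk Γ x) ((γ * s q)⁻¹ * x)‖ ≤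
        u γ⁻¹ * ‖f q‖ := by
    rw [NilManifold.mk_mul, hsec, norm_mul, mul_comm]
    gcongr
    have := hbd x (s q) (le_max_left _ _) ((hR q).trans (le_max_right _ _)) γ⁻¹
    simpa [mul_assoc] using this
  have hint (γ : Γ) : Integrable (fun q =>
      f (NilManifold.mk Γ (γ * s q)) * k (NilManifold.mk Γ x) ((γ * s q)⁻¹ * x)) ν :=
    (hf.norm.const_mul (u γ⁻¹)).mono'
      (hF.comp_measurable (hs.const_mul _)).aestronglyMeasurable
      (Eventually.of_forall (hterm γ))
  refine (hν.integrable_iff hs hsec fun γ => hF.aestronglyMeasurable).2 ⟨hint, ?_⟩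
  refine Summable.of_nonneg_of_le (fun γ => integral_nonneg fun q => norm_nonneg _) (fun γ => ?_)
    (((Equiv.inv Γ).summable_iff.2 hu).mul_right (∫ q, ‖f q‖ ∂ν))
  simp only [Function.comp_apply, Equiv.inv_apply]
  rw [← integral_const_mul]
  exact integral_mono (hint γ).norm (hf.norm.const_mul _) (hterm γ)

include hk in
-- The convolution over `G` folds to `M` because `f` is constant on the orbits of `Γ`. It is used
-- both to identify the operator and, with f the conjugate of a row of the kernel, to compute the
-- Hilbert–Schmidt norm.
theorem IsSummableKernel.integral_mul_eq (hν : IsQuotientMeasure Γ μ ν)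
    {f : NilManifold Γ → ℂ} (hfm : StronglyMeasurable f) (hf : Integrable f ν) (x : G) :
    ∫ y, f (NilManifold.mk Γ y) * k (NilManifold.mk Γ x) (y⁻¹ * x) ∂μ =
      ∫ q, nilKernel k (NilManifold.mk Γ x) q * f q ∂ν := by
  have : IsTopologicalGroup G := topologicalGroup_of_lieGroup 𝓘(ℝ, G) ∞
  obtain ⟨s, hs, hsec, R, hR0, hR⟩ := NilManifold.exists_measurable_section Γ
  rw [hν.integral_eq hs hsec (hk.integrable_mul hν hfm hf x)]
  refine integral_congr_ae (Eventually.of_forall fun q => ?_)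
  simp only [NilManifold.mk_mul, hsec, tsum_mul_left]
  rw [mul_comm]
  congr 1
  conv_rhs => rw [← hsec q]
  rw [nilKernel_mk_mk, latticeKernel, ← (Equiv.inv Γ).tsum_eq]
  simp [mul_assoc]

variable [IsFiniteMeasure ν] [μ.IsMulLeftInvariant]

include hk in
/-- The operator on `L²(M)` with kernel `k`. -/
theorem IsSummableKernel.isOp_integralOperator (hν : IsQuotientMeasure Γ μ ν)
    (hm : Measurable (Function.uncurry (nilKernel k))) {C : ℝ} (h0 : 0 ≤ C)
    (hC : ∀ p q, ‖nilKernel k p q‖ ≤ C) :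
    IsOp μ Γ ν k (integralOperator ν (nilKernel k) hm C hC h0) := by
  refine fun f =>
    ⟨fun x => hk.integrable_mul hν (Lp.stronglyMeasurable f) (integrable_L2 ν f) x, ?_⟩
  filter_upwards [coeFn_integralOperator ν (nilKernel k) hm C hC h0 f] with p hp
  rw [hp]
  obtain ⟨x, rfl⟩ : ∃ x, NilManifold.mk Γ x = p := ⟨_, NilManifold.mk_out Γ p⟩
  exact (hk.integral_mul_eq hν (Lp.stronglyMeasurable f) (integrable_L2 ν f) x).symm

end LatticeKernel

/-! ### Continuous families of Schwartz functions over a compact space. -/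

section SchwartzKernel

variable {G : Type u} [NormedAddCommGroup G] [NormedSpace ℝ G]

theorem SchwartzMap.exists_uniform_bound {X : Type*} [TopologicalSpace X] [CompactSpace X]
    {κ : X → 𝓢(G, ℂ)} (hκ : Continuous κ) (q n : ℕ) : ∃ A : ℝ, 0 ≤ A ∧ ∀ p, ∀ i ≤ n, ∀ z,
      (1 + ‖z‖) ^ q * ‖iteratedFDeriv ℝ i (κ p) z‖ ≤ A := by
  have h1 (m : ℕ × ℕ) : ∃ A : ℝ, ∀ p, schwartzSeminormFamily ℝ G ℂ m (κ p) ≤ A := by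
    have hc : Continuous fun p => schwartzSeminormFamily ℝ G ℂ m (κ p) :=
      ((schwartz_withSeminorms ℝ G ℂ).continuous_seminorm m).comp hκ
    obtain ⟨A, hA⟩ := isCompact_univ.exists_bound_of_continuousOn hc.continuousOn
    exact ⟨A, fun p => (le_abs_self _).trans (hA p trivial)⟩
  choose A hA using h1
  set B := ∑ m ∈ Finset.Iic (q, n), |A m|
  have hB0 : 0 ≤ B := Finset.sum_nonneg fun _ _ => abs_nonneg _
  refine ⟨2 ^ q * B, by positivity, fun p i hi z => ?_⟩
  refine (SchwartzMap.one_add_le_sup_seminorm_apply (𝕜 := ℝ) (m := (q, n)) le_rfl hi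
    (κ p) z).trans ?_
  gcongr
  refine Seminorm.finset_sup_apply_le hB0 fun m hm => (hA m p).trans ((le_abs_self _).trans ?_)
  exact Finset.single_le_sum (f := fun m => |A m|) (fun _ _ => abs_nonneg _) hm

theorem SchwartzMap.continuous_uncurry {X : Type*} [TopologicalSpace X]
    {κ : X → 𝓢(G, ℂ)} (hκ : Continuous κ) :
    Continuous (Function.uncurry fun p => ⇑(κ p)) := by
  have h : Continuous fun p => SchwartzMap.toBoundedContinuousFunctionCLM ℝ G ℂ (κ p) :=
    (SchwartzMap.toBoundedContinuousFunctionCLM ℝ G ℂ).continuous.comp hκ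
  exact (h.comp continuous_fst).eval continuous_snd

variable [FiniteDimensional ℝ G] (𝒱 : ℕ → Submodule ℝ G) [DirectSum.Decomposition 𝒱] [Group G]
  [LieGroup 𝓘(ℝ, G) ∞ G] [MeasurableSpace G] [BorelSpace G] {Γ : Subgroup G} [DiscreteTopology Γ]
  [CompactSpace (NilManifold Γ)]

include 𝒱 in
-- For bounded x and y, 1 + ‖γ‖ is at most a constant times a power of 1 + ‖y⁻¹γx‖, so decay uniform
-- over `M` yields a summable power of 1 + ‖γ‖.
theorem isSummableKernel_schwartz (hG : IsExponentialCoordinates G) (h𝒱 : IsLieGradation 𝒱)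
    {κ : NilManifold Γ → 𝓢(G, ℂ)} (hκ : Continuous κ) :
    IsSummableKernel fun p => ⇑(κ p) := by
  refine ⟨SchwartzMap.continuous_uncurry hκ, fun R => ?_⟩
  obtain ⟨m, hm⟩ := exists_summable_lattice 𝒱 Γ hG h𝒱
  obtain ⟨C, hC1, l, hC⟩ := exists_one_add_norm_lattice_le 𝒱 hG h𝒱 (max R 0) (le_max_right _ _)
  obtain ⟨A, hA0, hA⟩ := SchwartzMap.exists_uniform_bound hκ (l * m) 0
  refine ⟨fun γ => C ^ m * A * ((1 + ‖(γ : G)‖) ^ m)⁻¹, hm.mul_left _, fun x y hx hy γ => ?_⟩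
  have h1 := hC x y γ (hx.trans (le_max_left _ _)) (hy.trans (le_max_left _ _))
  have h2 := hA (NilManifold.mk Γ x) 0 le_rfl (y⁻¹ * (γ * x))
  rw [norm_iteratedFDeriv_zero] at h2
  change _ ≤ C ^ m * A * ((1 + ‖(γ : G)‖) ^ m)⁻¹
  rw [← div_eq_mul_inv, le_div_iff₀' (by positivity)]
  calc _ ≤ (C * (1 + ‖y⁻¹ * (γ * x)‖) ^ l) ^ m * ‖κ (NilManifold.mk Γ x) (y⁻¹ * (γ * x))‖ := by
        gcongr
    _ = C ^ m * ((1 + ‖y⁻¹ * (γ * x)‖) ^ (l * m) *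
        ‖κ (NilManifold.mk Γ x) (y⁻¹ * (γ * x))‖) := by rw [mul_pow, pow_mul]; ring
    _ ≤ C ^ m * A := by gcongr

end SchwartzKernel

/-! ### Quantitative decay of Fourier transforms. -/

section FourierDecay

open FourierTransform

variable {V : Type*} [NormedAddCommGroup V] [InnerProductSpace ℝ V] [FiniteDimensional ℝ V]
  [MeasurableSpace V] [BorelSpace V]

/-- The Fourier transform of a function supported in a fixed compact set decays, with bounds linear
in the bounds of the derivatives. -/
theorem exists_norm_fourier_le {S : Set V} (hS : IsCompact S) (N : ℕ) : ∃ C : ℝ, 0 ≤ C ∧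
    ∀ (f : V → ℂ) (A : ℝ), ContDiff ℝ N f → tsupport f ⊆ S →
      (∀ i ≤ N, ∀ t, ‖iteratedFDeriv ℝ i f t‖ ≤ A) → ∀ ξ, (1 + ‖ξ‖) ^ N * ‖𝓕 f ξ‖ ≤ C * A := by
  refine ⟨2 ^ N * (2 * (2 ^ N * ((N + 1) * volume.real S))), by positivity,
    fun f A hf hfS hA ξ => ?_⟩
  have hA0 : 0 ≤ A := (norm_nonneg _).trans (hA 0 (Nat.zero_le _) 0)
  have hsupp (n : ℕ) (t : V) (ht : t ∉ S) : iteratedFDeriv ℝ n f t = 0 :=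
    image_eq_zero_of_notMem_tsupport fun h => ht (hfS (tsupport_iteratedFDeriv_subset n h))
  have hcs : HasCompactSupport f := hS.of_isClosed_subset (isClosed_tsupport f) hfS
  have hint (k n : ℕ) (_ : (k : ℕ∞) ≤ (0 : ℕ)) (hn : (n : ℕ∞) ≤ (N : ℕ)) :
      Integrable fun v => ‖v‖ ^ k * ‖iteratedFDeriv ℝ n f v‖ := by
    refine Continuous.integrable_of_hasCompactSupport ?_ ?_
    · exact (continuous_norm.pow k).mul (hf.continuous_iteratedFDeriv (mod_cast hn)).norm
    · exact HasCompactSupport.mul_left (hcs.iteratedFDeriv n).norm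
  have hI (n : ℕ) (hn : n ≤ N) : ∫ v, ‖iteratedFDeriv ℝ n f v‖ ≤ A * volume.real S := by
    rw [← setIntegral_eq_integral_of_forall_compl_eq_zero (s := S)
      fun t ht => by rw [hsupp n t ht, norm_zero]]
    refine (le_abs_self _).trans ?_
    have := norm_setIntegral_le_of_norm_le_const (μ := volume) (s := S)
      (f := fun v => ‖iteratedFDeriv ℝ n f v‖) (C := A) hS.measure_lt_top
      fun t _ => by rw [norm_norm]; exact hA n hn t
    simpa using this
  have hpow (n : ℕ) (hn : n ≤ N) : ‖ξ‖ ^ n * ‖𝓕 f ξ‖ ≤ 2 ^ N * ((N + 1) * volume.real S) * A := by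
    have h := Real.pow_mul_norm_iteratedFDeriv_fourier_le (K := (0 : ℕ)) (N := (N : ℕ))
      (by exact_mod_cast hf) hint (k := 0) (n := n) le_rfl (mod_cast hn) ξ
    simp only [norm_iteratedFDeriv_zero] at h
    refine h.trans ?_
    have hsum : ∑ p ∈ Finset.range (0 + 1) ×ˢ Finset.range (n + 1),
        ∫ v, ‖v‖ ^ p.1 * ‖iteratedFDeriv ℝ p.2 f v‖ ≤ (n + 1) * (A * volume.real S) := by
      refine (Finset.sum_le_card_nsmul _ _ (A * volume.real S) fun p hp => ?_).trans ?_
      · rw [Finset.mem_product, Finset.mem_range, Finset.mem_range] at hp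
        rw [show p.1 = 0 by omega]
        simpa using hI p.2 (by omega)
      · simp
    calc _ ≤ (2 * Real.pi) ^ 0 * (2 * ((0 : ℕ) : ℝ) + 2) ^ n * ((n + 1) * (A * volume.real S)) := by
          gcongr
      _ = 2 ^ n * ((n + 1) * (A * volume.real S)) := by simp
      _ ≤ 2 ^ N * ((N + 1) * (A * volume.real S)) := by
          gcongr
          exact one_le_two
      _ = _ := by ring
  have h1 : (1 + ‖ξ‖) ^ N ≤ 2 ^ N * 1 + 2 ^ N * ‖ξ‖ ^ N := by
    rcases le_total ‖ξ‖ 1 with h | h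
    · calc (1 + ‖ξ‖) ^ N ≤ 2 ^ N := by gcongr; linarith
        _ ≤ _ := by linarith [show 0 ≤ (2 : ℝ) ^ N * ‖ξ‖ ^ N by positivity]
    · calc (1 + ‖ξ‖) ^ N ≤ (2 * ‖ξ‖) ^ N := by gcongr; linarith
        _ ≤ _ := by rw [mul_pow]; linarith [show 0 ≤ (2 : ℝ) ^ N by positivity]
  have h2 := hpow N le_rfl
  have h3 := hpow 0 (Nat.zero_le _)
  rw [pow_zero, one_mul] at h3
  calc (1 + ‖ξ‖) ^ N * ‖𝓕 f ξ‖ ≤ (2 ^ N * 1 + 2 ^ N * ‖ξ‖ ^ N) * ‖𝓕 f ξ‖ := by gcongr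
    _ = 2 ^ N * (‖𝓕 f ξ‖ + ‖ξ‖ ^ N * ‖𝓕 f ξ‖) := by ring
    _ ≤ 2 ^ N * (2 ^ N * ((N + 1) * volume.real S) * A +
        2 ^ N * ((N + 1) * volume.real S) * A) := by gcongr
    _ = _ := by ring

theorem measurable_uncurry_fourier {X : Type*} [MeasurableSpace X] {f : X → V → ℂ}
    (hf : Measurable (Function.uncurry f)) :
    Measurable (Function.uncurry fun p ξ => 𝓕 (f p) ξ) := by
  have h1 : Measurable fun w : (X × V) × V =>
      ((Real.fourierChar (-inner ℝ w.2 w.1.2) : Circle) : ℂ) * f w.1.1 w.2 := by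
    have h2 : Measurable fun r : ℝ => ((Real.fourierChar r : Circle) : ℂ) :=
      (continuous_subtype_val.comp Real.continuous_fourierChar).measurable
    have h3 : Measurable fun w : (X × V) × V => -inner ℝ w.2 w.1.2 :=
      (measurable_snd.inner (measurable_snd.comp measurable_fst)).neg
    exact (h2.comp h3).mul <| hf.comp ((measurable_fst.comp measurable_fst).prodMk measurable_snd)
  exact h1.stronglyMeasurable.integral_prod_right.measurable

variable {G : Type*} [NormedAddCommGroup G] [NormedSpace ℝ G]

omit [FiniteDimensional ℝ V] [MeasurableSpace V] [BorelSpace V] in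
-- Leibniz' rule on the support of χ; `R` bounds the image of that support under `e`, so bounds on
-- `g` are needed on one ball only, and the constant does not depend on `g`.
theorem exists_norm_iteratedFDeriv_smul_comp_le {χ : V → ℝ} (hχ : ContDiff ℝ ∞ χ)
    (hχc : HasCompactSupport χ) (e : V →L[ℝ] G) (N : ℕ) :
    ∃ R C : ℝ, 0 ≤ R ∧ 0 ≤ C ∧ ∀ g : G → ℂ, ContDiff ℝ ∞ g → ∀ B : ℝ,
      (∀ i ≤ N, ∀ y, ‖y‖ ≤ R → ‖iteratedFDeriv ℝ i g y‖ ≤ B) →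
      ∀ i ≤ N, ∀ t, ‖iteratedFDeriv ℝ i (fun t => χ t • g (e t)) t‖ ≤ C * B := by
  obtain ⟨R, hR⟩ := (hχc.image e.continuous).isBounded.exists_norm_le
  have hX (j : ℕ) : ∃ X : ℝ, ∀ t, ‖iteratedFDeriv ℝ j χ t‖ ≤ X :=
    (hχc.iteratedFDeriv j).exists_bound_of_continuous
      (hχ.continuous_iteratedFDeriv (mod_cast le_top))
  choose X hX using hX
  have hX0 (j : ℕ) : 0 ≤ X j := (norm_nonneg _).trans (hX j 0)
  refine ⟨max R 0, 2 ^ N * (∑ j ∈ Finset.range (N + 1), X j) * (1 + ‖e‖) ^ N, le_max_right _ _,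
    by have := Finset.sum_nonneg fun j (_ : j ∈ Finset.range (N + 1)) => hX0 j; positivity,
    fun g hg B hB i hi t => ?_⟩
  have hB0 : 0 ≤ B := (norm_nonneg _).trans (hB 0 (Nat.zero_le _) 0 (by simp))
  set Y := ∑ j ∈ Finset.range (N + 1), X j with hY
  have hXY (j : ℕ) (hj : j ≤ N) : X j ≤ Y :=
    Finset.single_le_sum (fun j _ => hX0 j) (Finset.mem_range.2 (by omega))
  have hY0 : 0 ≤ Y := (hX0 0).trans (hXY 0 (Nat.zero_le _))
  have hge : ContDiff ℝ ∞ (g ∘ e) := hg.comp e.contDiff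
  have h := norm_iteratedFDeriv_smul_le hχ hge t (n := i) (mod_cast le_top)
  refine h.trans ?_
  by_cases ht : t ∈ tsupport χ
  · have het : ‖e t‖ ≤ max R 0 := (hR _ (Set.mem_image_of_mem e ht)).trans (le_max_left _ _)
    calc _ ≤ ∑ j ∈ Finset.range (i + 1), (i.choose j : ℝ) * (Y * ((1 + ‖e‖) ^ N * B)) := by
          refine Finset.sum_le_sum fun j hj => ?_
          rw [Finset.mem_range] at hj
          rw [mul_assoc]
          gcongr
          · exact (hX j t).trans (hXY j (by omega))
          · rw [e.iteratedFDeriv_comp_right hg t (i := i - j)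
              (WithTop.coe_le_coe.2 (le_top : ((i - j : ℕ) : ℕ∞) ≤ ⊤))]
            refine (ContinuousMultilinearMap.norm_compContinuousLinearMap_le _ _).trans ?_
            rw [Finset.prod_const, Finset.card_univ, Fintype.card_fin, mul_comm]
            gcongr
            · calc ‖e‖ ^ (i - j) ≤ (1 + ‖e‖) ^ (i - j) := by gcongr; linarith
                _ ≤ (1 + ‖e‖) ^ N :=
                  pow_le_pow_right₀ (by linarith [norm_nonneg e]) (by omega)
            · exact hB _ (by omega) _ het
      _ = 2 ^ i * (Y * ((1 + ‖e‖) ^ N * B)) := by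
          rw [← Finset.sum_mul]
          congr 1
          exact_mod_cast Nat.sum_range_choose i
      _ ≤ 2 ^ N * (Y * ((1 + ‖e‖) ^ N * B)) := by
          gcongr
          exact one_le_two
      _ = _ := by ring
  · have h0 (j : ℕ) : iteratedFDeriv ℝ j χ t = 0 :=
      image_eq_zero_of_notMem_tsupport fun h => ht (tsupport_iteratedFDeriv_subset j h)
    simp only [h0, norm_zero, mul_zero, zero_mul, Finset.sum_const_zero]
    positivity

end FourierDecay

/-! ### The kernel as a superposition of product kernels. -/

section FourierDecomposition

open FourierTransform Module

variable {G : Type u} [NormedAddCommGroup G] [NormedSpace ℝ G] [FiniteDimensional ℝ G]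
  (𝒱 : ℕ → Submodule ℝ G) [DirectSum.Decomposition 𝒱] [Group G]
  [LieGroup 𝓘(ℝ, G) ∞ G] [MeasurableSpace G] [BorelSpace G] {Γ : Subgroup G} [DiscreteTopology Γ]
  [CompactSpace (NilManifold Γ)]

include 𝒱 in
/-- Uniform bounds on compact sets for the derivatives in `y` of `κ_ẋ (y⁻¹ γ x)`, summable
over `γ`. -/
theorem exists_summable_iteratedFDeriv_le (hG : IsExponentialCoordinates G)
    (h𝒱 : IsLieGradation 𝒱) {κ : NilManifold Γ → 𝓢(G, ℂ)} (hκ : Continuous κ) (N : ℕ)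
    {R₁ R₂ : ℝ} (h1 : 0 ≤ R₁) (h2 : 0 ≤ R₂) : ∃ u : Γ → ℝ, Summable u ∧
      ∀ x y : G, ‖x‖ ≤ R₁ → ‖y‖ ≤ R₂ → ∀ p, ∀ γ : Γ, ∀ i ≤ N,
        ‖iteratedFDeriv ℝ i (fun y => κ p (y⁻¹ * (γ * x))) y‖ ≤ u γ := by
  obtain ⟨m, hm⟩ := exists_summable_lattice 𝒱 Γ hG h𝒱
  obtain ⟨C, hC1, k, hC⟩ := exists_one_add_norm_lattice_le 𝒱 hG h𝒱 R₁ h1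
  obtain ⟨q, D, hD0, hD⟩ := exists_norm_iteratedFDeriv_comp_inv_mul_le 𝒱 hG h𝒱 N (k * m) R₂ h2
  obtain ⟨A, hA0, hA⟩ := SchwartzMap.exists_uniform_bound hκ q N
  refine ⟨fun γ => C ^ m * (D * A) * ((1 + ‖(γ : G)‖) ^ m)⁻¹, hm.mul_left _,
    fun x y hx hy p γ i hi => ?_⟩
  have h3 := hC x 1 γ hx (by rw [hG.one_eq_zero, norm_zero]; exact h1)
  rw [inv_one, one_mul] at h3
  have h4 := hD (κ p) A (κ p).smooth' (hA p) (γ * x) y hy i hi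
  change _ ≤ C ^ m * (D * A) * ((1 + ‖(γ : G)‖) ^ m)⁻¹
  rw [← div_eq_mul_inv, le_div_iff₀' (by positivity)]
  calc _ ≤ (C * (1 + ‖(γ : G) * x‖) ^ k) ^ m *
        ‖iteratedFDeriv ℝ i (fun y => κ p (y⁻¹ * (γ * x))) y‖ := by gcongr
    _ = C ^ m * ((1 + ‖(γ : G) * x‖) ^ (k * m) *
        ‖iteratedFDeriv ℝ i (fun y => κ p (y⁻¹ * (γ * x))) y‖) := by rw [mul_pow, pow_mul]; ring
    _ ≤ _ := by gcongr

include 𝒱 in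
-- Lift the second variable to `G`, cut off around the image of the section and apply Fourier
-- inversion there: a(p, ξ) is the Fourier transform of the cut-off kernel, c(ξ, q) the character ξ
-- evaluated at the lift of `q`. With dim G + 1 derivatives bounded uniformly in `p`, the transform
-- has an integrable majorant.
theorem exists_fourier_decomposition (hG : IsExponentialCoordinates G) (h𝒱 : IsLieGradation 𝒱)
    {κ : NilManifold Γ → 𝓢(G, ℂ)} (hκ : Continuous κ) :
    ∃ (a : NilManifold Γ → EuclideanSpace ℝ (Fin (finrank ℝ G)) → ℂ)
      (c : EuclideanSpace ℝ (Fin (finrank ℝ G)) → NilManifold Γ → ℂ)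
      (α : EuclideanSpace ℝ (Fin (finrank ℝ G)) → ℝ), Integrable α ∧
      Measurable (Function.uncurry a) ∧ Measurable (Function.uncurry c) ∧
      (∀ p ξ, ‖a p ξ‖ ≤ α ξ) ∧ (∀ ξ q, ‖c ξ q‖ ≤ 1) ∧
      ∀ p q, nilKernel (fun p => ⇑(κ p)) p q = ∫ ξ, a p ξ * c ξ q := by
  have : IsTopologicalGroup G := topologicalGroup_of_lieGroup 𝓘(ℝ, G) ∞
  have hk := isSummableKernel_schwartz 𝒱 hG h𝒱 hκ
  obtain ⟨s, hs, hsec, R, hR0, hR⟩ := NilManifold.exists_measurable_section Γ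
  set n := finrank ℝ G with hn
  let V := EuclideanSpace ℝ (Fin n)
  let e : V ≃L[ℝ] G := (toEuclidean (E := G)).symm
  set R₁ := ‖(e.symm : G →L[ℝ] V)‖ * R with hR₁
  have hR₁0 : 0 ≤ R₁ := by positivity
  have heR (p : NilManifold Γ) : ‖e.symm (s p)‖ ≤ R₁ :=
    ((e.symm : G →L[ℝ] V).le_opNorm _).trans (by rw [hR₁]; gcongr; exact hR p)
  -- χ is 1 at every lifted point, so the cut-off does not change the kernel there.
  let χ : ContDiffBump (0 : V) := ⟨R₁ + 1, R₁ + 2, by linarith, by linarith⟩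
  have hχ1 (p : NilManifold Γ) : χ (e.symm (s p)) = 1 := by
    refine χ.one_of_mem_closedBall ?_
    rw [mem_closedBall_zero_iff]
    change _ ≤ R₁ + 1
    linarith [heR p]
  have hχs : ContDiff ℝ ∞ χ := χ.contDiff
  obtain ⟨R₂, D, hR₂0, hD0, hD⟩ := exists_norm_iteratedFDeriv_smul_comp_le hχs
    χ.hasCompactSupport (e : V →L[ℝ] G) (n + 1)
  obtain ⟨u, hu, hbd⟩ := exists_summable_iteratedFDeriv_le 𝒱 hG h𝒱 hκ (n + 1) hR0 hR₂0
  let F : NilManifold Γ → Γ → V → ℂ := fun p γ t => χ t • κ p ((e t)⁻¹ * (γ * s p))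
  have hsm (p : NilManifold Γ) (γ : Γ) : ContDiff ℝ ∞ fun y : G => κ p (y⁻¹ * (γ * s p)) := by
    refine (κ p).smooth'.comp ((contDiff_groupMul (G := G)).comp (ContDiff.prodMk ?_
      contDiff_const))
    rw [show (Inv.inv : G → G) = fun y => -y from funext hG.inv_eq_neg]
    exact contDiff_neg
  have hFs (p : NilManifold Γ) (γ : Γ) : ContDiff ℝ ∞ (F p γ) :=
    hχs.smul ((hsm p γ).comp (e : V →L[ℝ] G).contDiff)
  have hFb (p : NilManifold Γ) (γ : Γ) (i : ℕ) (hi : i ≤ n + 1) (t : V) :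
      ‖iteratedFDeriv ℝ i (F p γ) t‖ ≤ D * u γ :=
    hD _ (hsm p γ) (u γ) (fun i hi y hy => hbd (s p) y (hR p) hy p γ i hi) i hi t
  have hDu : Summable fun γ => D * u γ := hu.mul_left D
  let f : NilManifold Γ → V → ℂ := fun p t =>
    χ t • nilKernel (fun p => ⇑(κ p)) p (NilManifold.mk Γ (e t))
  have hfF (p : NilManifold Γ) : f p = fun t => ∑' γ, F p γ t := by
    ext t
    simp only [f, F]
    conv_lhs => rw [← hsec p]
    rw [nilKernel_mk_mk, latticeKernel, hsec, tsum_const_smul'']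
  have hfs (p : NilManifold Γ) : ContDiff ℝ (n + 1 : ℕ) (f p) := by
    rw [hfF]
    exact contDiff_tsum (N := ((n + 1 : ℕ) : ℕ∞)) (v := fun _ γ => D * u γ)
      (fun γ => (hFs p γ).of_le (mod_cast le_top)) (fun _ _ => hDu)
      fun i γ t hi => hFb p γ i (mod_cast hi) t
  have hfb (p : NilManifold Γ) (i : ℕ) (hi : i ≤ n + 1) (t : V) :
      ‖iteratedFDeriv ℝ i (f p) t‖ ≤ ∑' γ, D * u γ := by
    rw [hfF, iteratedFDeriv_tsum_apply (N := ((n + 1 : ℕ) : ℕ∞)) (v := fun _ γ => D * u γ)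
      (fun γ => (hFs p γ).of_le (mod_cast le_top)) (fun _ _ => hDu)
      (fun i γ t hi => hFb p γ i (mod_cast hi) t) (mod_cast hi)]
    exact tsum_of_norm_bounded hDu.hasSum fun γ => hFb p γ i hi t
  have hfsupp (p : NilManifold Γ) : tsupport (f p) ⊆ tsupport χ :=
    closure_mono (Function.support_smul_subset_left (⇑χ)
      fun t => nilKernel (fun p => ⇑(κ p)) p (NilManifold.mk Γ (e t)))
  obtain ⟨B, hB0, hB⟩ := exists_norm_fourier_le χ.hasCompactSupport.isCompact (n + 1)
  set A := B * ∑' γ, D * u γ with hA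
  have hdecay (p : NilManifold Γ) (ξ : V) : ‖𝓕 (f p) ξ‖ ≤ A * (1 + ‖ξ‖) ^ (-((n + 1 : ℕ) : ℝ)) := by
    rw [Real.rpow_neg (by positivity), Real.rpow_natCast, ← div_eq_mul_inv,
      le_div_iff₀' (by positivity)]
    exact hB (f p) _ (hfs p) (hfsupp p) (hfb p) ξ
  have hα : Integrable fun ξ : V => A * (1 + ‖ξ‖) ^ (-((n + 1 : ℕ) : ℝ)) := by
    refine (integrable_one_add_norm ?_).const_mul A
    simp [V]
  have hfint (p : NilManifold Γ) : Integrable (f p) :=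
    (hfs p).continuous.integrable_of_hasCompactSupport
      (χ.hasCompactSupport.isCompact.of_isClosed_subset (isClosed_tsupport _) (hfsupp p))
  have hfj : Measurable (Function.uncurry f) := by
    have hmk : Measurable (NilManifold.mk Γ) := fun _ hs => hs
    have h1 : Measurable fun z : NilManifold Γ × V => NilManifold.mk Γ (e z.2) :=
      hmk.comp (e.continuous.measurable.comp measurable_snd)
    exact (χ.continuous.measurable.comp measurable_snd).smul
      (hk.measurable_nilKernel.comp (measurable_fst.prodMk h1))
  have haj : Measurable (Function.uncurry fun p ξ => 𝓕 (f p) ξ) := measurable_uncurry_fourier hfj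
  refine ⟨fun p ξ => 𝓕 (f p) ξ, fun ξ q => (Real.fourierChar (inner ℝ ξ (e.symm (s q))) : Circle),
    fun ξ => A * (1 + ‖ξ‖) ^ (-((n + 1 : ℕ) : ℝ)), hα, haj, ?_, hdecay,
    fun ξ q => (Circle.norm_coe _).le,
    fun p q => ?_⟩
  · have h2 : Measurable fun r : ℝ => ((Real.fourierChar r : Circle) : ℂ) :=
      (continuous_subtype_val.comp Real.continuous_fourierChar).measurable
    have h3 : Measurable fun z : V × NilManifold Γ => inner ℝ z.1 (e.symm (s z.2)) :=
      measurable_fst.inner (e.symm.continuous.measurable.comp (hs.comp measurable_snd))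
    exact h2.comp h3
  · have h1 : Integrable (𝓕 (f p)) :=
      hα.mono' (haj.comp measurable_prodMk_left).aestronglyMeasurable
        (Eventually.of_forall (hdecay p))
    have h2 := congrFun ((hfs p).continuous.fourierInv_fourier_eq (hfint p) h1) (e.symm (s q))
    rw [Real.fourierInv_eq] at h2
    have h3 : f p (e.symm (s q)) = nilKernel (fun p => ⇑(κ p)) p q := by
      simp only [f]
      rw [hχ1, one_smul, e.apply_symm_apply, hsec]
    rw [← h3, ← h2]
    refine integral_congr_ae (Eventually.of_forall fun ξ => ?_)
    simp only [Circle.smul_def, smul_eq_mul]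
    exact mul_comm _ _

end FourierDecomposition

/-! ### The dilated symbol and its kernel. -/

section DilatedKernel

variable {G : Type u} [NormedAddCommGroup G] [NormedSpace ℝ G] [Group G] {Γ : Subgroup G}

theorem IsSmoothKernel.continuous [IsTopologicalGroup G] {κ : NilManifold Γ → 𝓢(G, ℂ)}
    (hκ : IsSmoothKernel Γ κ) : Continuous κ :=
  (NilManifold.isOpenQuotientMap_mk Γ).isQuotientMap.continuous_iff.2 (hκ 0)

variable [FiniteDimensional ℝ G] (𝒱 : ℕ → Submodule ℝ G) [DirectSum.Decomposition 𝒱]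

theorem exists_schwartz_eq_dilatedKernel {κ : NilManifold Γ → 𝓢(G, ℂ)} (hκ : Continuous κ)
    {ε : ℝ} (hε : 0 < ε) :
    ∃ κ' : NilManifold Γ → 𝓢(G, ℂ), Continuous κ' ∧
      dilatedKernel 𝒱 κ ε = fun p => ⇑(κ' p) := by
  let T : 𝓢(G, ℂ) →L[ℂ] 𝓢(G, ℂ) := (((ε ^ homogeneousDim 𝒱)⁻¹ : ℝ) : ℂ) •
    SchwartzMap.compCLMOfContinuousLinearEquiv ℂ (dilationEquiv 𝒱 (inv_ne_zero hε.ne'))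
  refine ⟨fun p => T (κ p), T.continuous.comp hκ, ?_⟩
  ext p z
  rfl

variable [LieGroup 𝓘(ℝ, G) ∞ G] [MeasurableSpace G] [BorelSpace G]

/-- Substitute z ↦ D_ε z; the Jacobian ε^Q cancels the normalisation of the dilated kernel. -/
theorem IsSymbolWithKernel.isKernelOfDilatedSymbol (hG : IsExponentialCoordinates G)
    (h𝒱 : IsLieGradation 𝒱) (μ : Measure G) [μ.IsHaarMeasure] {σ : SymbolField Γ}
    {κ : NilManifold Γ → 𝓢(G, ℂ)} (hσ : IsSymbolWithKernel μ Γ σ κ) {ε : ℝ} (hε : 0 < ε) :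
    IsKernelOfDilatedSymbol 𝒱 μ σ ε (dilatedKernel 𝒱 κ ε) := by
  intro p H _ _ _ _ π επ hπ v
  have := isAddHaarMeasure_of_isHaarMeasure 𝒱 hG h𝒱 μ
  have h := integral_comp_dilation 𝒱 μ hε fun z => dilatedKernel 𝒱 κ ε p z • (π.toHom z)⁻¹ v
  have hc : (ε ^ homogeneousDim 𝒱)⁻¹ ≠ 0 := by positivity
  rw [hσ.fourier p H επ v]
  refine smul_right_injective H hc ?_
  change (ε ^ homogeneousDim 𝒱)⁻¹ • _ = (ε ^ homogeneousDim 𝒱)⁻¹ • _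
  rw [← h, ← integral_smul]
  refine integral_congr_ae (Eventually.of_forall fun z => ?_)
  simp only [dilatedKernel, dilation_dilation, inv_mul_cancel₀ hε.ne', dilation_one, hπ]
  rw [mul_smul, Complex.coe_smul]

end DilatedKernel

/-! ### Invariance of integrals under y ↦ y⁻¹x. -/

section Inversion

variable {G : Type u} [NormedAddCommGroup G] [NormedSpace ℝ G] [FiniteDimensional ℝ G]
  [Group G] [IsTopologicalGroup G] [MeasurableSpace G] [BorelSpace G] {E : Type*}
  [NormedAddCommGroup E] {μ : Measure G} [μ.IsAddHaarMeasure] [μ.IsMulLeftInvariant]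

omit [IsTopologicalGroup G] [μ.IsMulLeftInvariant] in
theorem IsExponentialCoordinates.isInvInvariant (hG : IsExponentialCoordinates G) :
    μ.IsInvInvariant := by
  have : ProperSpace G := FiniteDimensional.proper ℝ G
  have : μ.IsNegInvariant := Measure.IsAddHaarMeasure.isNegInvariant_of_regular μ
  refine ⟨?_⟩
  rw [Measure.inv, show (Inv.inv : G → G) = Neg.neg from funext hG.inv_eq_neg]
  exact Measure.map_neg_eq_self μ

theorem IsExponentialCoordinates.integral_inv_mul (hG : IsExponentialCoordinates G)
    [NormedSpace ℝ E] (g : G → E) (x : G) : ∫ y, g (y⁻¹ * x) ∂μ = ∫ y, g y ∂μ := by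
  have : ProperSpace G := FiniteDimensional.proper ℝ G
  have := hG.isInvInvariant (μ := μ)
  rw [← integral_inv_eq_self g μ, ← integral_mul_left_eq_self (fun y => g y⁻¹) x⁻¹]
  simp

theorem IsExponentialCoordinates.integrable_inv_mul (hG : IsExponentialCoordinates G)
    {g : G → E} (hg : Integrable g μ) (x : G) : Integrable (fun y => g (y⁻¹ * x)) μ := by
  have : ProperSpace G := FiniteDimensional.proper ℝ G
  have := hG.isInvInvariant (μ := μ)
  simpa using hg.comp_inv.comp_mul_left x⁻¹

end Inversion

/-! ### Negligibility of the terms γ ≠ 1. -/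

section Asymptotics

theorem norm_tsum_sub_le {ι : Type*} {f : ι → ℂ} {u : ι → ℝ} (hu : Summable u) (i₀ : ι)
    (h0 : 0 ≤ u i₀) (hf : ∀ i ≠ i₀, ‖f i‖ ≤ u i) : ‖∑' i, f i - f i₀‖ ≤ ∑' i, u i := by
  classical
  have hb (i : ι) : ‖if i = i₀ then 0 else f i‖ ≤ u i := by
    split_ifs with h
    · rw [h, norm_zero]; exact h0
    · exact hf i h
  have hs : Summable f := by
    have h1 : Summable fun i => if i = i₀ then 0 else f i := .of_norm_bounded hu hb
    have h2 : Summable fun i => if i = i₀ then f i else 0 :=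
      summable_of_ne_finset_zero (s := {i₀}) fun i hi => by
        rw [Finset.mem_singleton] at hi
        rw [if_neg hi]
    refine (h1.add h2).congr fun i => ?_
    split_ifs <;> simp
  rw [hs.tsum_eq_add_tsum_ite i₀, add_sub_cancel_left]
  exact tsum_of_norm_bounded hu.hasSum hb

variable {G : Type u} [NormedAddCommGroup G] [NormedSpace ℝ G] [FiniteDimensional ℝ G]
  (𝒱 : ℕ → Submodule ℝ G) [DirectSum.Decomposition 𝒱] [Group G]
  [LieGroup 𝓘(ℝ, G) ∞ G] [MeasurableSpace G] [BorelSpace G] {Γ : Subgroup G} [DiscreteTopology Γ]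
  [CompactSpace (NilManifold Γ)]

/-- On the diagonal only the term `γ = 1` of the lattice sum contributes. -/
theorem exists_norm_nilKernel_diag_sub_le (hG : IsExponentialCoordinates G)
    (h𝒱 : IsLieGradation 𝒱) {κ : NilManifold Γ → 𝓢(G, ℂ)} (hκ : Continuous κ) (N : ℕ) :
    ∃ C : ℝ, ∀ ε ∈ Set.Ioc (0 : ℝ) 1, ∀ p,
      ‖nilKernel (dilatedKernel 𝒱 κ ε) p p -
        (((ε ^ homogeneousDim 𝒱)⁻¹ : ℝ) : ℂ) * κ p 0‖ ≤ C * ε ^ N := by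
  have : IsTopologicalGroup G := topologicalGroup_of_lieGroup 𝓘(ℝ, G) ∞
  set Q := homogeneousDim 𝒱
  obtain ⟨s, -, hsec, R, hR0, hR⟩ := NilManifold.exists_measurable_section Γ
  obtain ⟨m, hm⟩ := exists_summable_lattice 𝒱 Γ hG h𝒱
  -- The extra Q powers of ε compensate the prefactor ε^{-Q} of the dilated kernel.
  obtain ⟨D, hD0, q, hD⟩ := exists_pow_norm_lattice_le 𝒱 Γ hG h𝒱 R hR0 (N + Q) m
  obtain ⟨A, hA0, hA⟩ := SchwartzMap.exists_uniform_bound hκ q 0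
  refine ⟨A * D * ∑' γ : Γ, ((1 + ‖(γ : G)‖) ^ m)⁻¹, fun ε hε p => ?_⟩
  have hε0 : 0 < ε := hε.1
  have h := norm_tsum_sub_le
    (f := fun γ : Γ => dilatedKernel 𝒱 κ ε p ((s p)⁻¹ * (γ * s p)))
    (u := fun γ : Γ => A * D * ε ^ N * ((1 + ‖(γ : G)‖) ^ m)⁻¹) (hm.mul_left _) 1 (by positivity)
    fun γ hγ => by
      have h1 := hD ε hε (s p) (hR p) γ hγ
      have h2 := hA p 0 le_rfl (dilation 𝒱 ε⁻¹ ((s p)⁻¹ * (γ * s p)))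
      rw [norm_iteratedFDeriv_zero] at h2
      rw [← div_eq_mul_inv, le_div_iff₀' (by positivity), dilatedKernel, norm_mul,
        Complex.norm_real, Real.norm_of_nonneg (by positivity)]
      set Z := dilation 𝒱 ε⁻¹ ((s p)⁻¹ * (γ * s p))
      calc _ ≤ D * ε ^ (N + Q) * (1 + ‖Z‖) ^ q * ((ε ^ Q)⁻¹ * ‖κ p Z‖) := by gcongr
        _ = D * ε ^ N * (ε ^ Q * (ε ^ Q)⁻¹) * ((1 + ‖Z‖) ^ q * ‖κ p Z‖) := by rw [pow_add]; ring
        _ ≤ D * ε ^ N * 1 * A := by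
            rw [mul_inv_cancel₀ (by positivity)]
            gcongr
        _ = _ := by ring
  have h1 : nilKernel (dilatedKernel 𝒱 κ ε) p p =
      ∑' γ : Γ, dilatedKernel 𝒱 κ ε p ((s p)⁻¹ * (γ * s p)) := by
    conv_lhs => rw [← hsec p]
    rw [nilKernel_mk_mk, latticeKernel, hsec]
  have h2 : dilatedKernel 𝒱 κ ε p ((s p)⁻¹ * (((1 : Γ) : G) * s p)) =
      (((ε ^ Q)⁻¹ : ℝ) : ℂ) * κ p 0 := by
    rw [Subgroup.coe_one, one_mul, inv_mul_cancel, dilatedKernel, hG.one_eq_zero, map_zero]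
  rw [h1, ← h2]
  refine h.trans (le_of_eq ?_)
  rw [tsum_mul_left]
  ring

omit [MeasurableSpace G] [BorelSpace G] in
/-- The product of two distinct terms of the lattice sum is `O(ε^N)`. -/
theorem exists_norm_dilatedKernel_mul_le (hG : IsExponentialCoordinates G)
    (h𝒱 : IsLieGradation 𝒱) {κ : NilManifold Γ → 𝓢(G, ℂ)} (hκ : Continuous κ) {R : ℝ}
    (hR : 0 ≤ R) (N m l : ℕ) : ∃ C : ℝ, 0 ≤ C ∧ ∀ ε ∈ Set.Ioc (0 : ℝ) 1, ∀ p, ∀ x y : G,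
      ‖x‖ ≤ R → ∀ γ : Γ, γ ≠ 1 → (1 + ‖(γ : G)‖) ^ m * (1 + ‖y⁻¹ * x‖) ^ l *
        (‖dilatedKernel 𝒱 κ ε p (y⁻¹ * (γ * x))‖ * ‖dilatedKernel 𝒱 κ ε p (y⁻¹ * x)‖) ≤
          C * ε ^ N := by
  set Q := homogeneousDim 𝒱
  -- Two dilated kernels are multiplied, whence 2Q.
  obtain ⟨D, hD0, q, hD⟩ := exists_pow_norm_lattice_le 𝒱 Γ hG h𝒱 R hR (N + 2 * Q) m
  obtain ⟨K, hK1, k, hK⟩ := exists_one_add_norm_mul_le 𝒱 hG h𝒱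
  obtain ⟨L, hL1, _, hL⟩ := exists_norm_dilation_le 𝒱 h𝒱.zero_eq_bot
  obtain ⟨A, hA0, hA⟩ := SchwartzMap.exists_uniform_bound hκ (k * q + l) 0
  obtain ⟨B, hB0, hB⟩ := SchwartzMap.exists_uniform_bound hκ (k * q) 0
  refine ⟨D * K ^ q * L ^ l * A * B, by positivity, fun ε hε p x y hx γ hγ => ?_⟩
  have hε0 : 0 < ε := hε.1
  have hε1 : 1 ≤ ε⁻¹ := (one_le_inv₀ hε0).2 hε.2
  have h1 := hD ε hε x hx γ hγ
  simp only [dilatedKernel, norm_mul, Complex.norm_real]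
  rw [Real.norm_of_nonneg (by positivity)]
  set Z := dilation 𝒱 ε⁻¹ (y⁻¹ * x) with hZ
  set W := dilation 𝒱 ε⁻¹ (x⁻¹ * (γ * x)) with hW
  have hZW : dilation 𝒱 ε⁻¹ (y⁻¹ * (γ * x)) = Z * W := by
    rw [hZ, hW, ← dilation_mul 𝒱 hG h𝒱]
    congr 1
    group
  rw [hZW]
  -- Since W = Z⁻¹(ZW), the large factor 1 + ‖W‖ is paid for by the decay of the kernel at `Z` and
  -- at `Z * W` together.
  have h2 : 1 + ‖W‖ ≤ K * (1 + ‖Z‖) ^ k * (1 + ‖Z * W‖) ^ k := by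
    have := hK Z⁻¹ (Z * W)
    rwa [inv_mul_cancel_left, hG.inv_eq_neg Z, norm_neg] at this
  have h3 : 1 + ‖y⁻¹ * x‖ ≤ L * (1 + ‖Z‖) := by
    have h4 := (hL ε⁻¹ hε1 Z).2
    rw [inv_inv, hZ, dilation_dilation, mul_inv_cancel₀ hε0.ne', dilation_one, ← hZ] at h4
    have h5 : L * ε * ‖Z‖ ≤ L * 1 * ‖Z‖ := by gcongr; exact hε.2
    linarith
  have h4 := hA p 0 le_rfl Z
  have h5 := hB p 0 le_rfl (Z * W)
  rw [norm_iteratedFDeriv_zero] at h4 h5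
  calc _ ≤ D * ε ^ (N + 2 * Q) * (K * (1 + ‖Z‖) ^ k * (1 + ‖Z * W‖) ^ k) ^ q *
        (L * (1 + ‖Z‖)) ^ l * ((ε ^ Q)⁻¹ * ‖κ p (Z * W)‖ * ((ε ^ Q)⁻¹ * ‖κ p Z‖)) := by
        gcongr
        exact h1.trans (by gcongr)
    _ = D * K ^ q * L ^ l * ε ^ N * (ε ^ Q * (ε ^ Q)⁻¹) ^ 2 *
        ((1 + ‖Z‖) ^ (k * q + l) * ‖κ p Z‖) * ((1 + ‖Z * W‖) ^ (k * q) * ‖κ p (Z * W)‖) := by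
        rw [mul_pow L]
        ring
    _ ≤ D * K ^ q * L ^ l * ε ^ N * 1 ^ 2 * A * B := by
        rw [mul_inv_cancel₀ (by positivity)]
        gcongr
    _ = _ := by ring

omit [LieGroup 𝓘(ℝ, G) ∞ G] [DiscreteTopology Γ] [CompactSpace (NilManifold Γ)] in
theorem integral_norm_sq_dilatedKernel (μ : Measure G) [μ.IsAddHaarMeasure]
    (κ : NilManifold Γ → 𝓢(G, ℂ)) {ε : ℝ} (hε : 0 < ε) (p : NilManifold Γ) :
    ∫ z, ‖dilatedKernel 𝒱 κ ε p z‖ ^ 2 ∂μ =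
      (ε ^ homogeneousDim 𝒱)⁻¹ * ∫ z, ‖κ p z‖ ^ 2 ∂μ := by
  have h := integral_comp_dilation 𝒱 μ (inv_pos.2 hε) fun z => ‖κ p z‖ ^ 2
  simp only [dilatedKernel, norm_mul, Complex.norm_real, mul_pow, integral_const_mul, h]
  rw [Real.norm_of_nonneg (by positivity), smul_eq_mul]
  simp only [inv_pow, inv_inv]
  field_simp

/-- Unfolding one factor of |K(p, q)|² gives the integral over `G` of conj K(p, ẏ) k(y⁻¹x).
Replacing the remaining sum K by its term γ = 1 leaves the integral of |k(y⁻¹x)|², which is the main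
term, and the cross terms are O(ε^N) times an integrable function of y⁻¹x. -/
theorem exists_abs_integral_norm_sq_nilKernel_sub_le (hG : IsExponentialCoordinates G)
    (h𝒱 : IsLieGradation 𝒱) {μ : Measure G} [μ.IsHaarMeasure] {ν : Measure (NilManifold Γ)}
    (hν : IsQuotientMeasure Γ μ ν) {κ : NilManifold Γ → 𝓢(G, ℂ)} (hκ : Continuous κ) (N : ℕ) :
    ∃ C : ℝ, ∀ ε ∈ Set.Ioc (0 : ℝ) 1, ∀ p,
      |∫ q, ‖nilKernel (dilatedKernel 𝒱 κ ε) p q‖ ^ 2 ∂ν -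
        (ε ^ homogeneousDim 𝒱)⁻¹ * ∫ z, ‖κ p z‖ ^ 2 ∂μ| ≤ C * ε ^ N := by
  have : IsTopologicalGroup G := topologicalGroup_of_lieGroup 𝓘(ℝ, G) ∞
  have : ProperSpace G := FiniteDimensional.proper ℝ G
  have : μ.IsAddHaarMeasure := isAddHaarMeasure_of_isHaarMeasure 𝒱 hG h𝒱 μ
  have : IsFiniteMeasure ν := hν.isFiniteMeasure
  obtain ⟨s, -, hsec, R, hR0, hR⟩ := NilManifold.exists_measurable_section Γ
  obtain ⟨m, hm⟩ := exists_summable_lattice 𝒱 Γ hG h𝒱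
  set l := Module.finrank ℝ G + 1 with hl
  obtain ⟨D, hD0, hD⟩ := exists_norm_dilatedKernel_mul_le 𝒱 hG h𝒱 hκ hR0 N m l
  have hw : Integrable (fun z : G => ((1 + ‖z‖) ^ l)⁻¹) μ := by
    have := integrable_one_add_norm (μ := μ) (E := G) (r := (l : ℝ))
      (by rw [hl]; push_cast; linarith)
    refine this.congr (Eventually.of_forall fun z => ?_)
    simp only
    rw [Real.rpow_neg (by positivity), Real.rpow_natCast]
  set S := ∑' γ : Γ, ((1 + ‖(γ : G)‖) ^ m)⁻¹ with hS
  refine ⟨D * S * ∫ z : G, ((1 + ‖z‖) ^ l)⁻¹ ∂μ, fun ε hε p => ?_⟩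
  have hε0 : 0 < ε := hε.1
  obtain ⟨κ', hκ', hκκ'⟩ := exists_schwartz_eq_dilatedKernel 𝒱 hκ hε0
  have hk : IsSummableKernel (dilatedKernel 𝒱 κ ε) := by
    rw [hκκ']
    exact isSummableKernel_schwartz 𝒱 hG h𝒱 hκ'
  set k := dilatedKernel 𝒱 κ ε with hkdef
  obtain ⟨B, hB0, hB⟩ := hk.exists_norm_nilKernel_le
  set x := s p with hx
  have hxp : NilManifold.mk Γ x = p := hsec p
  have hfm : StronglyMeasurable fun q => starRingEnd ℂ (nilKernel k p q) :=
    (Complex.continuous_conj.measurable.comp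
      (hk.measurable_nilKernel.comp measurable_prodMk_left)).stronglyMeasurable
  have hfi : Integrable (fun q => starRingEnd ℂ (nilKernel k p q)) ν :=
    (integrable_const B).mono' hfm.aestronglyMeasurable
      (Eventually.of_forall fun q => by rw [RCLike.norm_conj]; exact hB p q)
  have hI1 := hk.integrable_mul hν hfm hfi x
  have hE1 := hk.integral_mul_eq hν hfm hfi x
  rw [hxp] at hI1 hE1
  have hE2 : ∫ q, nilKernel k p q * starRingEnd ℂ (nilKernel k p q) ∂ν =
      ((∫ q, ‖nilKernel k p q‖ ^ 2 ∂ν : ℝ) : ℂ) := by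
    rw [← integral_complex_ofReal]
    refine integral_congr_ae (Eventually.of_forall fun q => ?_)
    simp only
    rw [Complex.mul_conj, Complex.normSq_eq_norm_sq]
  have hpt (y : G) : ‖starRingEnd ℂ (nilKernel k p (NilManifold.mk Γ y)) * k p (y⁻¹ * x) -
      ((‖k p (y⁻¹ * x)‖ ^ 2 : ℝ) : ℂ)‖ ≤ D * S * ε ^ N * ((1 + ‖y⁻¹ * x‖) ^ l)⁻¹ := by
    have h1 : starRingEnd ℂ (nilKernel k p (NilManifold.mk Γ y)) * k p (y⁻¹ * x) -
        ((‖k p (y⁻¹ * x)‖ ^ 2 : ℝ) : ℂ) =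
        starRingEnd ℂ (nilKernel k p (NilManifold.mk Γ y) - k p (y⁻¹ * x)) * k p (y⁻¹ * x) := by
      rw [map_sub, sub_mul, ← Complex.normSq_eq_norm_sq, Complex.normSq_eq_conj_mul_self]
    rw [h1, norm_mul, RCLike.norm_conj, ← norm_mul, sub_mul]
    have h2 : nilKernel k p (NilManifold.mk Γ y) * k p (y⁻¹ * x) =
        ∑' γ : Γ, k p (y⁻¹ * (γ * x)) * k p (y⁻¹ * x) := by
      rw [tsum_mul_right]
      conv_lhs => rw [← hxp]
      rw [nilKernel_mk_mk, latticeKernel, hxp]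
    rw [h2]
    have h3 := norm_tsum_sub_le (f := fun γ : Γ => k p (y⁻¹ * (γ * x)) * k p (y⁻¹ * x))
      (u := fun γ : Γ => D * ε ^ N * ((1 + ‖y⁻¹ * x‖) ^ l)⁻¹ * ((1 + ‖(γ : G)‖) ^ m)⁻¹)
      (hm.mul_left _) 1 (by positivity) fun γ hγ => by
        have h4 := hD ε hε p x y (hR p) γ hγ
        rw [norm_mul, ← div_eq_mul_inv, le_div_iff₀' (by positivity), ← div_eq_mul_inv,
          le_div_iff₀' (by positivity)]
        refine le_trans (le_of_eq ?_) h4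
        ring
    simp only [Subgroup.coe_one, one_mul] at h3
    refine h3.trans (le_of_eq ?_)
    rw [tsum_mul_left]
    ring
  have hkc : Continuous (k p) := hk.continuous_uncurry.comp (continuous_const.prodMk continuous_id)
  have hk2 : Integrable (fun z => ‖k p z‖ ^ 2) μ := by
    have : MemLp (κ' p) 2 μ := (κ' p).memLp 2 μ
    rw [hκκ']
    exact (memLp_two_iff_integrable_sq_norm this.1).1 this
  have hI2 : Integrable (fun y => ((‖k p (y⁻¹ * x)‖ ^ 2 : ℝ) : ℂ)) μ :=
    (hG.integrable_inv_mul hk2 x).ofReal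
  have hE3 : ∫ y, ((‖k p (y⁻¹ * x)‖ ^ 2 : ℝ) : ℂ) ∂μ =
      (((ε ^ homogeneousDim 𝒱)⁻¹ * ∫ z, ‖κ p z‖ ^ 2 ∂μ : ℝ) : ℂ) := by
    rw [integral_complex_ofReal, hG.integral_inv_mul (fun z => ‖k p z‖ ^ 2) x, hkdef,
      integral_norm_sq_dilatedKernel 𝒱 μ κ hε0]
  have hfin : ‖∫ y, (starRingEnd ℂ (nilKernel k p (NilManifold.mk Γ y)) * k p (y⁻¹ * x) -
      ((‖k p (y⁻¹ * x)‖ ^ 2 : ℝ) : ℂ)) ∂μ‖ ≤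
      ∫ y, D * S * ε ^ N * ((1 + ‖y⁻¹ * x‖) ^ l)⁻¹ ∂μ :=
    norm_integral_le_of_norm_le ((hG.integrable_inv_mul hw x).const_mul _)
      (Eventually.of_forall hpt)
  rw [integral_sub hI1 hI2, hE1, hE2, hE3, ← Complex.ofReal_sub, Complex.norm_real,
    Real.norm_eq_abs, integral_const_mul,
    hG.integral_inv_mul (fun z => ((1 + ‖z‖) ^ l)⁻¹) x] at hfin
  refine hfin.trans (le_of_eq ?_)
  ring

theorem integrable_norm_sq_kernel {μ : Measure G} [μ.IsAddHaarMeasure]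
    {ν : Measure (NilManifold Γ)} [IsFiniteMeasure ν]
    {κ : NilManifold Γ → 𝓢(G, ℂ)} (hκ : Continuous κ) :
    Integrable (fun q : G × NilManifold Γ => ‖κ q.2 q.1‖ ^ 2) (μ.prod ν) := by
  have : IsTopologicalGroup G := topologicalGroup_of_lieGroup 𝓘(ℝ, G) ∞
  have : ProperSpace G := FiniteDimensional.proper ℝ G
  have : SecondCountableTopology G := secondCountable_of_proper
  have := NilManifold.secondCountableTopology Γ
  have : BorelSpace (NilManifold Γ) := NilManifold.borelSpace Γ
  set l := Module.finrank ℝ G + 1 with hl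
  obtain ⟨A, hA0, hA⟩ := SchwartzMap.exists_uniform_bound hκ l 0
  have hw : Integrable (fun z : G => ((1 + ‖z‖) ^ l)⁻¹) μ := by
    have := integrable_one_add_norm (μ := μ) (E := G) (r := (l : ℝ))
      (by rw [hl]; push_cast; linarith)
    refine this.congr (Eventually.of_forall fun z => ?_)
    simp only
    rw [Real.rpow_neg (by positivity), Real.rpow_natCast]
  have hc : Continuous fun q : G × NilManifold Γ => ‖κ q.2 q.1‖ ^ 2 :=
    ((SchwartzMap.continuous_uncurry hκ).comp (continuous_snd.prodMk continuous_fst)).norm.pow 2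
  refine ((hw.mul_prod (integrable_const (A ^ 2) : Integrable _ ν))).mono'
    hc.measurable.aestronglyMeasurable (Eventually.of_forall fun q => ?_)
  have h1 := hA q.2 0 le_rfl q.1
  rw [norm_iteratedFDeriv_zero] at h1
  rw [Real.norm_of_nonneg (by positivity), mul_comm, ← div_eq_mul_inv,
    le_div_iff₀' (by positivity)]
  have h2 : (1 : ℝ) ≤ (1 + ‖q.1‖) ^ l := one_le_pow₀ (by linarith [norm_nonneg q.1])
  calc (1 + ‖q.1‖) ^ l * ‖κ q.2 q.1‖ ^ 2
      ≤ (1 + ‖q.1‖) ^ l * (1 + ‖q.1‖) ^ l * ‖κ q.2 q.1‖ ^ 2 := by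
        gcongr
        exact le_mul_of_one_le_left (by positivity) h2
    _ = ((1 + ‖q.1‖) ^ l * ‖κ q.2 q.1‖) ^ 2 := by ring
    _ ≤ A ^ 2 := by gcongr

end Asymptotics

/-! ### The operator of a Schwartz family. -/

section TraceClass

variable {G : Type u} [NormedAddCommGroup G] [NormedSpace ℝ G] [FiniteDimensional ℝ G]
  (𝒱 : ℕ → Submodule ℝ G) [DirectSum.Decomposition 𝒱] [Group G]
  [LieGroup 𝓘(ℝ, G) ∞ G] [MeasurableSpace G] [BorelSpace G] {Γ : Subgroup G} [DiscreteTopology Γ]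
  [CompactSpace (NilManifold Γ)]

include 𝒱 in
/-- The operator on `L²(M)` defined by a continuous family of Schwartz kernels is Hilbert–Schmidt
and trace class. -/
theorem exists_isOp_schwartz (hG : IsExponentialCoordinates G) (h𝒱 : IsLieGradation 𝒱)
    {μ : Measure G} [μ.IsHaarMeasure] {ν : Measure (NilManifold Γ)}
    (hν : IsQuotientMeasure Γ μ ν) {κ : NilManifold Γ → 𝓢(G, ℂ)} (hκ : Continuous κ) :
    ∃ T : Lp ℂ 2 ν →L[ℂ] Lp ℂ 2 ν, IsOp μ Γ ν (fun p => ⇑(κ p)) T ∧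
      HasHilbertSchmidtNorm T √(∫ p, ∫ q, ‖nilKernel (fun p => ⇑(κ p)) p q‖ ^ 2 ∂ν ∂ν) ∧
      IsTraceClass T ∧ HasTrace T (∫ p, nilKernel (fun p => ⇑(κ p)) p p ∂ν) := by
  have : IsTopologicalGroup G := topologicalGroup_of_lieGroup 𝓘(ℝ, G) ∞
  have : ProperSpace G := FiniteDimensional.proper ℝ G
  have : IsFiniteMeasure ν := hν.isFiniteMeasure
  have : TopologicalSpace.SeparableSpace (Lp ℂ 2 ν) := separableSpace_L2
  have hk := isSummableKernel_schwartz 𝒱 hG h𝒱 hκ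
  obtain ⟨B, hB0, hB⟩ := hk.exists_norm_nilKernel_le
  obtain ⟨a, c, α, hα, ha, hc, haα, hc1, hac⟩ := exists_fourier_decomposition 𝒱 hG h𝒱 hκ
  exact ⟨integralOperator ν _ hk.measurable_nilKernel B hB hB0,
    hk.isOp_integralOperator hν _ hB0 hB, hasHilbertSchmidtNorm_integralOperator ν _ _ B hB hB0,
    isTraceClass_and_hasTrace_integralOperator ν _ _ B hB hB0 volume a c α hα ha hc haα hc1 hac⟩

end TraceClass

end

theorem lemma4 {G : Type u} [NormedAddCommGroup G] [NormedSpace ℝ G] [FiniteDimensional ℝ G]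
    [MeasurableSpace G] [BorelSpace G] [Group G] [LieGroup 𝓘(ℝ, G) ∞ G]
    (hG : IsExponentialCoordinates G)
    (𝒱 : ℕ → Submodule ℝ G) [DirectSum.Decomposition 𝒱] (h𝒱 : IsLieGradation 𝒱)
    (μ : Measure G) [μ.IsHaarMeasure]
    (Γ : Subgroup G) [DiscreteTopology Γ] [CompactSpace (NilManifold Γ)]
    (ν : Measure (NilManifold Γ)) (hν : IsQuotientMeasure Γ μ ν)
    (σ : SymbolField Γ) (κ : NilManifold Γ → 𝓢(G, ℂ)) (hσ : IsSymbolWithKernel μ Γ σ κ) :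
    (∀ ε ∈ Set.Ioc (0 : ℝ) 1, IsKernelOfDilatedSymbol 𝒱 μ σ ε (dilatedKernel 𝒱 κ ε)) ∧
    Integrable (fun q : G × NilManifold Γ => ‖κ q.2 q.1‖ ^ 2) (μ.prod ν) ∧
    Integrable (fun p : NilManifold Γ => κ p 0) ν ∧
    ∃ (Op : ℝ → (Lp ℂ 2 ν →L[ℂ] Lp ℂ 2 ν)) (hs : ℝ → ℝ) (tr : ℝ → ℂ),
      (∀ ε ∈ Set.Ioc (0 : ℝ) 1,
        IsOp μ Γ ν (dilatedKernel 𝒱 κ ε) (Op ε) ∧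
        HasHilbertSchmidtNorm (Op ε) (hs ε) ∧ IsTraceClass (Op ε) ∧ HasTrace (Op ε) (tr ε)) ∧
      (∀ N : ℕ, ∃ C : ℝ, ∀ ε ∈ Set.Ioc (0 : ℝ) 1,
        |hs ε ^ 2 - (ε ^ homogeneousDim 𝒱)⁻¹ *
          ∫ q : G × NilManifold Γ, ‖κ q.2 q.1‖ ^ 2 ∂(μ.prod ν)| ≤ C * ε ^ N) ∧
      (∀ N : ℕ, ∃ C : ℝ, ∀ ε ∈ Set.Ioc (0 : ℝ) 1,
        ‖tr ε - (((ε ^ homogeneousDim 𝒱)⁻¹ : ℝ) : ℂ) * ∫ p, κ p 0 ∂ν‖ ≤ C * ε ^ N) := by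
  have : IsTopologicalGroup G := topologicalGroup_of_lieGroup 𝓘(ℝ, G) ∞
  have : ProperSpace G := FiniteDimensional.proper ℝ G
  have : SecondCountableTopology G := secondCountable_of_proper
  have := NilManifold.secondCountableTopology Γ
  have : BorelSpace (NilManifold Γ) := NilManifold.borelSpace Γ
  have : μ.IsAddHaarMeasure := isAddHaarMeasure_of_isHaarMeasure 𝒱 hG h𝒱 μ
  have : IsFiniteMeasure ν := hν.isFiniteMeasure
  have hκ : Continuous κ := hσ.smooth.continuous
  have hint2 := integrable_norm_sq_kernel (μ := μ) (ν := ν) hκ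
  have hint0 : Integrable (fun p : NilManifold Γ => κ p 0) ν := by
    obtain ⟨A, -, hA⟩ := SchwartzMap.exists_uniform_bound hκ 0 0
    have hc : Continuous fun p => κ p 0 :=
      (SchwartzMap.continuous_uncurry hκ).comp (continuous_id.prodMk continuous_const)
    refine (integrable_const A).mono' hc.measurable.aestronglyMeasurable
      (Eventually.of_forall fun p => ?_)
    simpa using hA p 0 le_rfl 0
  -- For fixed ε the dilated kernel is again a continuous Schwartz family, so existence, the norm
  -- and the trace need no uniformity in ε.
  have hkernel (ε : ℝ) (hε : ε ∈ Set.Ioc (0 : ℝ) 1) :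
      IsSummableKernel (dilatedKernel 𝒱 κ ε) ∧ ∃ T : Lp ℂ 2 ν →L[ℂ] Lp ℂ 2 ν,
      IsOp μ Γ ν (dilatedKernel 𝒱 κ ε) T ∧ HasHilbertSchmidtNorm T
        √(∫ p, ∫ q, ‖nilKernel (dilatedKernel 𝒱 κ ε) p q‖ ^ 2 ∂ν ∂ν) ∧
      IsTraceClass T ∧ HasTrace T (∫ p, nilKernel (dilatedKernel 𝒱 κ ε) p p ∂ν) := by
    obtain ⟨κ', hκ', h⟩ := exists_schwartz_eq_dilatedKernel 𝒱 hκ hε.1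
    rw [h]
    exact ⟨isSummableKernel_schwartz 𝒱 hG h𝒱 hκ', exists_isOp_schwartz 𝒱 hG h𝒱 hν hκ'⟩
  have hk (ε : ℝ) (hε : ε ∈ Set.Ioc (0 : ℝ) 1) := (hkernel ε hε).1
  -- `Op` takes an arbitrary default value outside (0, 1].
  choose! Op hOp using fun ε hε => (hkernel ε hε).2
  refine ⟨fun ε hε => hσ.isKernelOfDilatedSymbol 𝒱 hG h𝒱 μ hε.1, hint2, hint0, Op,
    fun ε => √(∫ p, ∫ q, ‖nilKernel (dilatedKernel 𝒱 κ ε) p q‖ ^ 2 ∂ν ∂ν),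
    fun ε => ∫ p, nilKernel (dilatedKernel 𝒱 κ ε) p p ∂ν, hOp, fun N => ?_, fun N => ?_⟩
  · obtain ⟨C, hC⟩ := exists_abs_integral_norm_sq_nilKernel_sub_le 𝒱 hG h𝒱 hν hκ N
    -- The estimate is uniform in `p`, and `ν` is finite.
    refine ⟨C * ν.real Set.univ, fun ε hε => ?_⟩
    obtain ⟨B, hB0, hB⟩ := (hk ε hε).exists_norm_nilKernel_le
    have h1 := integrable_integral_norm_sq_kernel ν _ (hk ε hε).measurable_nilKernel B hB
    have h2 : Integrable (fun p => (ε ^ homogeneousDim 𝒱)⁻¹ * ∫ z, ‖κ p z‖ ^ 2 ∂μ) ν :=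
      hint2.integral_prod_right.const_mul _
    rw [Real.sq_sqrt (integral_nonneg fun p => integral_nonneg fun q => by positivity),
      integral_prod_symm _ hint2, ← integral_const_mul, ← integral_sub h1 h2, ← Real.norm_eq_abs]
    refine (norm_integral_le_of_norm_le_const (Eventually.of_forall (hC ε hε))).trans
      (le_of_eq ?_)
    ring
  · obtain ⟨C, hC⟩ := exists_norm_nilKernel_diag_sub_le 𝒱 hG h𝒱 hκ N
    refine ⟨C * ν.real Set.univ, fun ε hε => ?_⟩
    obtain ⟨B, hB0, hB⟩ := (hk ε hε).exists_norm_nilKernel_le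
    have h1 : Integrable (fun p => nilKernel (dilatedKernel 𝒱 κ ε) p p) ν :=
      (integrable_const B).mono' ((hk ε hε).measurable_nilKernel.comp
        (measurable_id.prodMk measurable_id)).aestronglyMeasurable
        (Eventually.of_forall fun p => hB p p)
    rw [← integral_const_mul, ← integral_sub h1 (hint0.const_mul _)]
    refine (norm_integral_le_of_norm_le_const (Eventually.of_forall (hC ε hε))).trans
      (le_of_eq ?_)
    ring
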